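/- Let $m>0$, $\alpha\ge 0$ and $Z\in\mathbb R$ with $0\le\alpha Z<\sqrt3/2$. On $\mathfrak H=L^2(\mathbb R^3)\otimes\mathbb C^4$ let $D_0=\boldsymbol\alpha\cdot\frac1i\nabla+m\beta$ be the free Dirac operator and $D_Z=D_0-\alpha Z/|\mathbf x|$ the Coulomb-Dirac operator, both with domain $H^1(\mathbb R^3)\otimes\mathbb C^4$, where $\boldsymbol\alpha,\beta$ are the standard Dirac matrices. Let $F$ be the space of all self-adjoint operators $\delta$ on $\mathfrak H$ with $\|\delta\|_F=\operatorname{tr}(|D_0|^{1/2}|\delta||D_0|^{1/2})<\infty$. Write $x=(\mathbf x,s)$ with $\mathbf x\in\mathbb R^3$, $s\in\{1,2,3,4\}$, and let $\int dx$ include the sum over $s$. For $\delta\in F$ with eigenvalues $\lambda_n$ and an orthonormal basis of eigenvectors $\xi_n$ set $$\delta(x,y)=\sum_n\lambda_n\xi_n(x)\overline{\xi_n(y)},\qquad \rho_\delta(\mathbf x)=\sum_{s=1}^4\sum_n\lambda_n|\xi_n(x)|^2,$$ $$\varphi^{(\delta)}(\mathbf x)=\int_{\mathbb R^3}\frac{\rho_\delta(\mathbf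 y)}{|\mathbf x-\mathbf y|}\,d\mathbf y,\qquad (X^{(\delta)}\psi)(x)=\int\frac{\delta(x,y)\psi(y)}{|\mathbf x-\mathbf y|}\,dy,$$ and let $$D^{(\delta)}=D_Z+\alpha\bigl(\varphi^{(\delta)}-X^{(\delta)}\bigr),\qquad \Lambda_+^{(\delta)}=\chi_{[0,\infty)}(D^{(\delta)}),\qquad \Lambda_-^{(\delta)}=1-\Lambda_+^{(\delta)}.$$ For $q\in\mathbb N_0=\{0,1,2,\dots\}$ let $$S^{(\delta)}_{\partial q}=\{\gamma\in F:\ -\Lambda_-^{(\delta)}\le\gamma\le\Lambda_+^{(\delta)},\ \Lambda_-^{(\delta)}\gamma\Lambda_+^{(\delta)}=0,\ \operatorname{tr}\gamma=q\},$$ and for $\gamma\in F$ let $$\mathcal E(\gamma)=\operatorname{tr}(D_Z\gamma)+\frac\alpha2\int_{\mathbb R^3}\!\int_{\mathbb R^3}\frac{\rho_\gamma(\mathbf x)\rho_\gamma(\mathbf y)}{|\mathbf x-\mathbf y|}\,d\mathbf x\,d\mathbf y-\frac\alpha2\int\!\int\frac{|\gamma(x,y)|^2}{|\mathbf x-\mathbf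 y|}\,dx\,dy,$$ where $\operatorname{tr}(D_Z\gamma)=\sum_n\lambda_n\langle\xi_n,D_Z\xi_n\rangle$ (eigenvalues $\lambda_n$ and orthonormal eigenvectors $\xi_n$ of $\gamma$, terms with $\lambda_n\ne0$ only) is understood in the sense of quadratic forms on $H^{1/2}(\mathbb R^3)\otimes\mathbb C^4$. **Theorem.** Let $\delta\in F$ and $q\in\mathbb N_0$. If $\gamma$ is an orthogonal projection that minimizes $\mathcal E$ on $S^{(\delta)}_{\partial q}$ (that is, $\gamma\in S^{(\delta)}_{\partial q}$ and $\mathcal E(\gamma)\le\mathcal E(\gamma')$ for all $\gamma'\in S^{(\delta)}_{\partial q}$), then $\gamma$ commutes with the no-pair Dirac-Fock operator $\Lambda_+^{(\delta)}D^{(\gamma)}\Lambda_+^{(\delta)}$, $$[\gamma,\Lambda_+^{(\delta)}D^{(\gamma)}\Lambda_+^{(\delta)}]=0 .$$ Precisely: with $T=\Lambda_+^{(\delta)}D^{(\gamma)}\Lambda_+^{(\delta)}$ on its natural domain $\{\psi\in\mathfrak H:\Lambda_+^{(\delta)}\psi\in H^1(\mathbb R^3)\otimes\mathbb C^4\}$,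 the projection $\gamma$ maps the domain of $T$ into itself, and $T\gamma\psi=\gamma T\psi$ for every $\psi$ in this domain. -/

import Mathlib

open MeasureTheory
open scoped ENNReal InnerProductSpace

noncomputable section

namespace DiracFock

/-- Position and momentum space `ℝ³`. -/
abbrev Space : Type := EuclideanSpace ℝ (Fin 3)

/-- Spinor space `ℂ⁴`. -/
abbrev Spinor : Type := EuclideanSpace ℂ (Fin 4)

/-- The one-particle Hilbert space `L²(ℝ³) ⊗ ℂ⁴ = L²(ℝ³; ℂ⁴)`. -/
abbrev Hil : Type := Lp (α := Space) Spinor 2 volume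

/-! ### The spectral projections of an unbounded self-adjoint operator -/

/-- A projection-valued measure on the Borel sets of `ℝ`, acting on `H`. The values of `proj` on
non-Borel sets are irrelevant. -/
structure ProjValuedMeasure (H : Type*) [NormedAddCommGroup H] [InnerProductSpace ℂ H]
    [CompleteSpace H] where
  proj : Set ℝ → H →L[ℂ] H
  isStarProjection : ∀ B, MeasurableSet B → IsStarProjection (proj B)
  proj_univ : proj Set.univ = 1
  proj_inter : ∀ A B, MeasurableSet A → MeasurableSet B → proj (A ∩ B) = proj A * proj B
  hasSum_proj : ∀ A : ℕ → Set ℝ, (∀ n, MeasurableSet (A n)) →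
    Pairwise (Function.onFun Disjoint A) →
      ∀ x, HasSum (fun n => proj (A n) x) (proj (⋃ n, A n) x)

section SpectralProjection

variable {H : Type*} [NormedAddCommGroup H] [InnerProductSpace ℂ H] [CompleteSpace H]

theorem ProjValuedMeasure.inner_eq (E : ProjValuedMeasure H) {B : Set ℝ} (hB : MeasurableSet B)
    (x : H) : ⟪x, E.proj B x⟫_ℂ = ((‖E.proj B x‖ ^ 2 : ℝ) : ℂ) := by
  have h := E.isStarProjection B hB
  have h1 : ⟪E.proj B x, E.proj B x⟫_ℂ = ⟪x, E.proj B (E.proj B x)⟫_ℂ := by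
    rw [← ContinuousLinearMap.adjoint_inner_right, ← ContinuousLinearMap.star_eq_adjoint,
      h.isSelfAdjoint.star_eq]
  have h2 : E.proj B (E.proj B x) = E.proj B x := by
    have := congrArg (fun T : H →L[ℂ] H => T x) h.isIdempotentElem.eq
    simpa using this
  rw [h2] at h1
  rw [← h1, inner_self_eq_norm_sq_to_K]
  norm_cast

/-- The finite Borel measure `B ↦ ⟪x, E(B) x⟫ = ‖E(B) x‖²`. -/
def ProjValuedMeasure.measure (E : ProjValuedMeasure H) (x : H) : Measure ℝ :=
  Measure.ofMeasurable (fun B _ => ENNReal.ofReal (‖E.proj B x‖ ^ 2))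
    (by
      have h := E.hasSum_proj (fun _ => ∅) (fun _ => MeasurableSet.empty)
        (fun _ _ _ => by simp [Function.onFun]) x
      have h0 : E.proj ∅ x = 0 := tendsto_nhds_unique tendsto_const_nhds
        h.summable.tendsto_atTop_zero
      simp [h0])
    (by
      intro A hA hd
      have h := (E.hasSum_proj A hA hd x).mapL (innerSL ℂ x)
      have h' : HasSum (fun n => ‖E.proj (A n) x‖ ^ 2) (‖E.proj (⋃ n, A n) x‖ ^ 2) := by
        simp only [innerSL_apply_apply, E.inner_eq (hA _), E.inner_eq (MeasurableSet.iUnion hA)]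
          at h
        exact_mod_cast h
      rw [← h'.tsum_eq, ENNReal.ofReal_tsum_of_nonneg (fun n => by positivity) h'.summable])

/-- `T = ∫ t dE(t)`: the domain of `T` consists of all `x` with `∫ t² d⟪x, E(t) x⟫ < ∞`, and
`⟪x, T x⟫ = ∫ t d⟪x, E(t) x⟫` for all `x` in the domain. -/
def ProjValuedMeasure.Resolves (E : ProjValuedMeasure H) (T : H →ₗ.[ℂ] H) : Prop :=
  (∀ x : H, x ∈ T.domain ↔ ∫⁻ t, ENNReal.ofReal (t ^ 2) ∂(E.measure x) < ∞) ∧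
    ∀ x : T.domain, ⟪(x : H), T x⟫_ℂ = ((∫ t, t ∂(E.measure (x : H)) : ℝ) : ℂ)

open Classical in
/-- The spectral projection `χ_B(T) = E(B)` of a self-adjoint operator `T = ∫ t dE(t)`; by the
spectral theorem `E` exists, and is unique, for every self-adjoint `T`. (The value is `0` if `T`
has no spectral resolution, i.e. is not self-adjoint.) -/
def spectralProjection (T : H →ₗ.[ℂ] H) (B : Set ℝ) : H →L[ℂ] H :=
  if h : ∃ E : ProjValuedMeasure H, E.Resolves T then h.choose.proj B else 0

/-- The nonnegative square root `|B|^{1/2}` of the absolute value of a bounded operator. -/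
def sqrtAbs (B : H →L[ℂ] H) : H →L[ℂ] H := CFC.sqrt (CFC.abs B)

end SpectralProjection

/-! ### The Dirac operator -/

/-- The Dirac matrices `α₁, α₂, α₃` in the standard representation. -/
def diracAlpha : Fin 3 → Matrix (Fin 4) (Fin 4) ℂ :=
  ![!![0, 0, 0, 1; 0, 0, 1, 0; 0, 1, 0, 0; 1, 0, 0, 0],
    !![0, 0, 0, -Complex.I; 0, 0, Complex.I, 0; 0, -Complex.I, 0, 0; Complex.I, 0, 0, 0],
    !![0, 0, 1, 0; 0, 0, 0, -1; 1, 0, 0, 0; 0, -1, 0, 0]]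

/-- The Dirac matrix `β` in the standard representation. -/
def diracBeta : Matrix (Fin 4) (Fin 4) ℂ := Matrix.diagonal ![1, 1, -1, -1]

/-- The matrix `𝛂 · p + m β` as an operator on `ℂ⁴`. -/
def diracSymbol (m : ℝ) (p : Space) : Spinor →L[ℂ] Spinor :=
  Matrix.toEuclideanCLM (𝕜 := ℂ) ((∑ j, (p j : ℂ) • diracAlpha j) + (m : ℂ) • diracBeta)

theorem toLp_of_ae_add {f g h : Space → Spinor} (hf : MemLp f 2 volume) (hg : MemLp g 2 volume)
    (hh : MemLp h 2 volume) (H : f =ᵐ[volume] g + h) :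
    (MemLp.toLp f hf : Hil) = MemLp.toLp g hg + MemLp.toLp h hh := by
  rw [← MemLp.toLp_add hg hh]
  exact MemLp.toLp_congr hf (hg.add hh) H

theorem toLp_of_ae_smul {f g : Space → Spinor} (c : ℂ) (hf : MemLp f 2 volume)
    (hg : MemLp g 2 volume) (H : f =ᵐ[volume] c • g) :
    (MemLp.toLp f hf : Hil) = c • MemLp.toLp g hg := by
  rw [← MemLp.toLp_const_smul c hg]
  exact MemLp.toLp_congr hf (hg.const_smul c) H

theorem mul_add_ae (M : Space → Spinor →L[ℂ] Spinor) (ψ χ : Hil) :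
    (fun x => M x ((ψ + χ : Hil) x)) =ᵐ[volume] (fun x => M x (ψ x)) + fun x => M x (χ x) := by
  filter_upwards [Lp.coeFn_add ψ χ] with x hx
  rw [hx, Pi.add_apply, map_add, Pi.add_apply]

theorem mul_smul_ae (M : Space → Spinor →L[ℂ] Spinor) (c : ℂ) (ψ : Hil) :
    (fun x => M x ((c • ψ : Hil) x)) =ᵐ[volume] c • fun x => M x (ψ x) := by
  filter_upwards [Lp.coeFn_smul c ψ] with x hx
  rw [hx, Pi.smul_apply, map_smul, Pi.smul_apply]

/-- The maximal domain `{ψ | M ψ ∈ L²}` of the multiplication by an operator-valued function. -/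
def mulDomain (M : Space → Spinor →L[ℂ] Spinor) : Submodule ℂ Hil where
  carrier := {ψ | MemLp (fun x => M x (ψ x)) 2 volume}
  zero_mem' := by
    refine (memLp_congr_ae ?_).mpr (MemLp.zero (ε := Spinor))
    filter_upwards [Lp.coeFn_zero Spinor 2 (volume : Measure Space)] with x hx
    rw [hx, Pi.zero_apply, map_zero]
  add_mem' := fun {ψ χ} hψ hχ => (memLp_congr_ae (mul_add_ae M ψ χ)).mpr (MemLp.add hψ hχ)
  smul_mem' := fun c ψ hψ => (memLp_congr_ae (mul_smul_ae M c ψ)).mpr (MemLp.const_smul hψ c)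

/-- Multiplication by an operator-valued function, on its maximal domain. -/
def mulOp (M : Space → Spinor →L[ℂ] Spinor) : Hil →ₗ.[ℂ] Hil where
  domain := mulDomain M
  toFun :=
    { toFun := fun ψ => MemLp.toLp (fun x => M x ((ψ : Hil) x)) ψ.2
      map_add' := fun ψ χ => toLp_of_ae_add _ ψ.2 χ.2 (mul_add_ae M ψ χ)
      map_smul' := fun c ψ => toLp_of_ae_smul c _ ψ.2 (mul_smul_ae M c ψ) }

/-- Multiplication by a real function, on its maximal domain. -/
def potential (V : Space → ℝ) : Hil →ₗ.[ℂ] Hil :=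
  mulOp fun x => (V x : ℂ) • ContinuousLinearMap.id ℂ Spinor

/-- The Fourier transform on `L²(ℝ³; ℂ⁴)`, with `(𝓕 ψ)(k) = ∫ exp(-2πi k·x) ψ(x) dx`, so that
`(1/i)∇` is multiplication by `2πk` on the Fourier side. -/
def fourier : Hil ≃ₗᵢ[ℂ] Hil := Lp.fourierTransformₗᵢ Space Spinor

/-- The free Dirac operator `D₀ = 𝛂 · (1/i)∇ + m β`. Its domain is `H¹(ℝ³; ℂ⁴)`, because
`‖diracSymbol m p v‖² = (|p|² + m²) ‖v‖²`. -/
def diracFree (m : ℝ) : Hil →ₗ.[ℂ] Hil where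
  domain := (mulOp fun k => diracSymbol m ((2 * Real.pi) • k)).domain.comap
    (fourier.toLinearEquiv : Hil →ₗ[ℂ] Hil)
  toFun := (fourier.symm.toLinearEquiv : Hil →ₗ[ℂ] Hil) ∘ₗ
    (mulOp fun k => diracSymbol m ((2 * Real.pi) • k)).toFun ∘ₗ
      ((fourier.toLinearEquiv : Hil →ₗ[ℂ] Hil).restrict fun _ h => h)

/-- The Coulomb-Dirac operator `D_Z = D₀ - α Z / |x|`. By Hardy's inequality its domain is that of
`D₀`, i.e. `H¹(ℝ³; ℂ⁴)`. -/
def diracCoulomb (m α Z : ℝ) : Hil →ₗ.[ℂ] Hil :=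
  diracFree m - ((α * Z : ℝ) : ℂ) • potential fun x => ‖x‖⁻¹

/-- `‖ |D₀|^{1/2} ψ ‖²` with `|D₀| = √(-Δ + m²)`; the value is `∞` if `ψ` is not in the domain of
`|D₀|^{1/2}`. -/
def freeEnergy (m : ℝ) (ψ : Hil) : ℝ≥0∞ :=
  ∫⁻ k, ENNReal.ofReal (Real.sqrt (‖(2 * Real.pi) • k‖ ^ 2 + m ^ 2) * ‖(fourier ψ) k‖ ^ 2)

/-- The quadratic form `⟨ψ, D_Z ψ⟩` of the Coulomb-Dirac operator, for `ψ` in the form domain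
`H^{1/2}(ℝ³; ℂ⁴)`. -/
def diracForm (m α Z : ℝ) (ψ : Hil) : ℝ :=
  (∫ k, (⟪(fourier ψ) k, diracSymbol m ((2 * Real.pi) • k) ((fourier ψ) k)⟫_ℂ).re) -
    α * Z * ∫ x, ‖ψ x‖ ^ 2 / ‖x‖

/-! ### The space `F` and the mean field -/

/-- The norm `‖δ‖_F = tr(|D₀|^{1/2} |δ| |D₀|^{1/2})`. The trace of the nonnegative operator `B B*`,
`B = |D₀|^{1/2} |δ|^{1/2}`, is that of `B* B`, i.e. the supremum of `∑ ‖B e‖²` over finite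
orthonormal sets. -/
def normF (m : ℝ) (δ : Hil →L[ℂ] Hil) : ℝ≥0∞ :=
  ⨆ (s : Finset Hil) (_ : Orthonormal ℂ ((↑) : s → Hil)),
    ∑ e ∈ s, freeEnergy m (sqrtAbs δ e)

/-- Membership in the space `F` of self-adjoint operators with finite norm `normF`. -/
def MemF (m : ℝ) (δ : Hil →L[ℂ] Hil) : Prop :=
  IsSelfAdjoint δ ∧ normF m δ < ∞

/-- An orthonormal basis of eigenvectors of `δ` together with the (real) eigenvalues. -/
structure EigenSystem (δ : Hil →L[ℂ] Hil) where
  basis : HilbertBasis ℕ ℂ Hil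
  eigenvalue : ℕ → ℝ
  apply_basis : ∀ n, δ (basis n) = (eigenvalue n : ℂ) • basis n

open Classical in
/-- The eigenvalues of `δ`, repeated according to multiplicity. Every `δ ∈ F` is compact and
self-adjoint, so that an `EigenSystem` exists; one is chosen, the same one for `eigenvalue` and
`eigenvector`. -/
def eigenvalue (δ : Hil →L[ℂ] Hil) (n : ℕ) : ℝ :=
  if h : Nonempty (EigenSystem δ) then h.some.eigenvalue n else 0

open Classical in
/-- The corresponding orthonormal eigenvectors of `δ`. -/
def eigenvector (δ : Hil →L[ℂ] Hil) (n : ℕ) : Hil :=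
  if h : Nonempty (EigenSystem δ) then h.some.basis n else 0

/-- The trace of a self-adjoint trace class operator. -/
def opTrace (γ : Hil →L[ℂ] Hil) : ℝ := ∑' n, eigenvalue γ n

/-- The integral kernel `δ(x,s;y,t) = ∑ₙ λₙ ξₙ(x,s) conj ξₙ(y,t)`, as a matrix in `s, t`. -/
def kernel (δ : Hil →L[ℂ] Hil) (x y : Space) : Matrix (Fin 4) (Fin 4) ℂ :=
  Matrix.of fun s t => ∑' n, (eigenvalue δ n : ℂ) * eigenvector δ n x s *
    (starRingEnd ℂ) (eigenvector δ n y t)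

/-- The density `ρ_δ(x) = ∑ₛ ∑ₙ λₙ |ξₙ(x,s)|²`. -/
def density (δ : Hil →L[ℂ] Hil) (x : Space) : ℝ :=
  ∑ s : Fin 4, ∑' n, eigenvalue δ n * ‖eigenvector δ n x s‖ ^ 2

/-- The electric potential `φ^{(δ)}(x) = ∫ ρ_δ(y) / |x - y| dy`. -/
def directPotential (δ : Hil →L[ℂ] Hil) (x : Space) : ℝ :=
  ∫ y, density δ y / ‖x - y‖

/-- The integrand `y ↦ δ(x,y) ψ(y) / |x - y|` of the exchange operator. -/
def exchangeIntegrand (δ : Hil →L[ℂ] Hil) (ψ : Hil) (x y : Space) : Spinor :=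
  ((‖x - y‖⁻¹ : ℝ) : ℂ) • Matrix.toEuclideanCLM (𝕜 := ℂ) (kernel δ x y) (ψ y)

/-- The function `X^{(δ)} ψ`, i.e. `x ↦ ∫ δ(x,y) ψ(y) / |x - y| dy`. -/
def exchangeFun (δ : Hil →L[ℂ] Hil) (ψ : Hil) (x : Space) : Spinor :=
  ∫ y, exchangeIntegrand δ ψ x y

theorem exchangeIntegrand_add (δ : Hil →L[ℂ] Hil) (ψ χ : Hil) (x : Space) :
    exchangeIntegrand δ (ψ + χ) x =ᵐ[volume]
      exchangeIntegrand δ ψ x + exchangeIntegrand δ χ x := by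
  filter_upwards [Lp.coeFn_add ψ χ] with y hy
  simp only [exchangeIntegrand, Pi.add_apply]
  rw [hy, Pi.add_apply, map_add, smul_add]

theorem exchangeIntegrand_smul (δ : Hil →L[ℂ] Hil) (c : ℂ) (ψ : Hil) (x : Space) :
    exchangeIntegrand δ (c • ψ) x =ᵐ[volume] c • exchangeIntegrand δ ψ x := by
  filter_upwards [Lp.coeFn_smul c ψ] with y hy
  simp only [exchangeIntegrand, Pi.smul_apply]
  rw [hy, Pi.smul_apply, map_smul, smul_comm]

theorem exchangeFun_add {δ : Hil →L[ℂ] Hil} {ψ χ : Hil}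
    (hψ : ∀ᵐ x, Integrable (exchangeIntegrand δ ψ x))
    (hχ : ∀ᵐ x, Integrable (exchangeIntegrand δ χ x)) :
    exchangeFun δ (ψ + χ) =ᵐ[volume] exchangeFun δ ψ + exchangeFun δ χ := by
  filter_upwards [hψ, hχ] with x h1 h2
  simp only [exchangeFun, Pi.add_apply]
  rw [integral_congr_ae (exchangeIntegrand_add δ ψ χ x), integral_add' h1 h2]

theorem exchangeFun_smul (δ : Hil →L[ℂ] Hil) (c : ℂ) (ψ : Hil) :
    exchangeFun δ (c • ψ) = c • exchangeFun δ ψ := by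
  funext x
  simp only [exchangeFun, Pi.smul_apply]
  rw [integral_congr_ae (exchangeIntegrand_smul δ c ψ x)]
  exact integral_smul c _

/-- The maximal domain of the exchange operator, which is all of `L²(ℝ³; ℂ⁴)` for `δ ∈ F`. -/
def exchangeDomain (δ : Hil →L[ℂ] Hil) : Submodule ℂ Hil where
  carrier := {ψ | (∀ᵐ x, Integrable (exchangeIntegrand δ ψ x)) ∧
    MemLp (exchangeFun δ ψ) 2 volume}
  zero_mem' := by
    have h : ∀ x, exchangeIntegrand δ 0 x =ᵐ[volume] (0 : Space → Spinor) := fun x => by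
      filter_upwards [Lp.coeFn_zero Spinor 2 (volume : Measure Space)] with y hy
      simp only [exchangeIntegrand]
      rw [hy, Pi.zero_apply, map_zero, smul_zero]
    refine ⟨.of_forall fun x => (integrable_congr (h x)).mpr (integrable_zero _ _ _), ?_⟩
    have h' : exchangeFun δ 0 = 0 := by
      funext x
      simp only [exchangeFun]
      rw [integral_congr_ae (h x)]
      exact integral_zero _ _
    rw [h']
    exact MemLp.zero
  add_mem' := fun {ψ χ} hψ hχ => by
    refine ⟨?_, (memLp_congr_ae (exchangeFun_add hψ.1 hχ.1)).mpr (MemLp.add hψ.2 hχ.2)⟩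
    filter_upwards [hψ.1, hχ.1] with x h1 h2
    exact (integrable_congr (exchangeIntegrand_add δ ψ χ x)).mpr (h1.add h2)
  smul_mem' := fun c ψ hψ => by
    refine ⟨?_, ?_⟩
    · filter_upwards [hψ.1] with x h1
      exact (integrable_congr (exchangeIntegrand_smul δ c ψ x)).mpr (h1.smul c)
    · rw [exchangeFun_smul]
      exact MemLp.const_smul hψ.2 c

/-- The exchange operator `(X^{(δ)} ψ)(x) = ∫ δ(x,y) ψ(y) / |x - y| dy`, on its maximal domain. -/
def exchange (δ : Hil →L[ℂ] Hil) : Hil →ₗ.[ℂ] Hil where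
  domain := exchangeDomain δ
  toFun :=
    { toFun := fun ψ => MemLp.toLp (exchangeFun δ ψ) ψ.2.2
      map_add' := fun ψ χ => toLp_of_ae_add _ ψ.2.2 χ.2.2 (exchangeFun_add ψ.2.1 χ.2.1)
      map_smul' := fun c ψ => toLp_of_ae_smul c _ ψ.2.2
        (.of_forall fun x => congrFun (exchangeFun_smul δ c (ψ : Hil)) x) }

/-- The mean field potential `W^{(δ)} = φ^{(δ)} - X^{(δ)}`. -/
def meanField (δ : Hil →L[ℂ] Hil) : Hil →ₗ.[ℂ] Hil :=
  potential (directPotential δ) - exchange δ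

/-- The Dirac-Fock operator `D^{(δ)} = D_Z + α W^{(δ)}`. For `δ ∈ F` the operator `W^{(δ)}` is
bounded, so that the domain is `H¹(ℝ³; ℂ⁴)`. -/
def diracFock (m α Z : ℝ) (δ : Hil →L[ℂ] Hil) : Hil →ₗ.[ℂ] Hil :=
  diracCoulomb m α Z + (α : ℂ) • meanField δ

/-- The electron projection `Λ₊^{(δ)} = χ_{[0,∞)}(D^{(δ)})`. -/
def projPlus (m α Z : ℝ) (δ : Hil →L[ℂ] Hil) : Hil →L[ℂ] Hil :=
  spectralProjection (diracFock m α Z δ) (Set.Ici 0)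

/-- The positron projection `Λ₋^{(δ)} = 1 - Λ₊^{(δ)}`. -/
def projMinus (m α Z : ℝ) (δ : Hil →L[ℂ] Hil) : Hil →L[ℂ] Hil :=
  1 - projPlus m α Z δ

/-- The operator `P T P` on its natural domain `{ψ | P ψ ∈ dom T}`. -/
def compress (P : Hil →L[ℂ] Hil) (T : Hil →ₗ.[ℂ] Hil) : Hil →ₗ.[ℂ] Hil where
  domain := T.domain.comap (P : Hil →ₗ[ℂ] Hil)
  toFun := (P : Hil →ₗ[ℂ] Hil) ∘ₗ T.toFun ∘ₗ (P : Hil →ₗ[ℂ] Hil).restrict fun _ h => h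

/-- A bounded operator `B` commutes with an unbounded operator `T`, `[B, T] = 0`: `B` maps the
domain of `T` into itself, and `T B ψ = B T ψ` for all `ψ` in the domain of `T`. -/
def CommutesWith (B : Hil →L[ℂ] Hil) (T : Hil →ₗ.[ℂ] Hil) : Prop :=
  ∀ ψ : T.domain, ∃ h : B ψ ∈ T.domain, T ⟨B ψ, h⟩ = B (T ψ)

/-! ### Density matrices and the energy -/

/-- The set `S^{(δ)}` of charge density matrices. -/
def densityMatrices (m α Z : ℝ) (δ : Hil →L[ℂ] Hil) : Set (Hil →L[ℂ] Hil) :=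
  {γ | MemF m γ ∧ -projMinus m α Z δ ≤ γ ∧ γ ≤ projPlus m α Z δ ∧
    projMinus m α Z δ * γ * projPlus m α Z δ = 0}

/-- The set `S^{(δ)}_{∂q}` of charge density matrices of charge `q`. -/
def densityMatricesOfCharge (m α Z : ℝ) (δ : Hil →L[ℂ] Hil) (q : ℝ) : Set (Hil →L[ℂ] Hil) :=
  {γ | γ ∈ densityMatrices m α Z δ ∧ opTrace γ = q}

/-- The Coulomb scalar product `D[ρ, σ] = ½ ∬ ρ(x) σ(y) / |x - y| dx dy` of real densities. -/
def coulombProduct (ρ σ : Space → ℝ) : ℝ :=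
  1 / 2 * ∫ x, ∫ y, ρ x * σ y / ‖x - y‖

/-- The exchange scalar product `E[γ, γ'] = ½ ∬ conj γ(x,y) γ'(x,y) / |x - y| dx dy`, where the
integrals include the sums over the spin indices; it is real for self-adjoint `γ, γ'`. -/
def exchangeProduct (γ γ' : Hil →L[ℂ] Hil) : ℝ :=
  1 / 2 * (∫ x, ∫ y, (∑ s, ∑ t, (starRingEnd ℂ) (kernel γ x y s t) * kernel γ' x y s t) /
    (‖x - y‖ : ℂ)).re

/-- `Q[γ, γ'] = D[ρ_γ, ρ_γ'] - E[γ, γ']`. -/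
def interaction (γ γ' : Hil →L[ℂ] Hil) : ℝ :=
  coulombProduct (density γ) (density γ') - exchangeProduct γ γ'

/-- `tr(D_Z γ) = ∑ₙ λₙ ⟨ξₙ, D_Z ξₙ⟩`, in the sense of quadratic forms. -/
def diracTrace (m α Z : ℝ) (γ : Hil →L[ℂ] Hil) : ℝ :=
  ∑' n, eigenvalue γ n * diracForm m α Z (eigenvector γ n)

/-- The Hartree-Fock energy `ℰ(γ) = tr(D_Z γ) + α Q[γ, γ]`. -/
def energy (m α Z : ℝ) (γ : Hil →L[ℂ] Hil) : ℝ :=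
  diracTrace m α Z γ + α * interaction γ γ

end DiracFock

end

noncomputable section

namespace DiracFock

/-! ### Spectral resolutions -/

namespace ProjValuedMeasure

variable {H : Type*} [NormedAddCommGroup H] [InnerProductSpace ℂ H] [CompleteSpace H]
  (E : ProjValuedMeasure H)

/-! Write P for the electron projection of `δ`. A unit vector in the range of the projection γ
contributes at least m to ‖γ‖_F, so γ has finite rank: γ = ∑ |uᵢ⟩⟨uᵢ| with orthonormal uᵢ in H^{1/2}
and P uᵢ = uᵢ (`exists_eq_frameProj`). Let φ be a unit vector in H^{1/2} ∩ ran P, orthogonal to all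
uᵢ. Replacing u_k by cos θ u_k + sin θ φ gives another projection below P with the same charge,
hence a competitor. Its difference from γ is cos θ sin θ (|φ⟩⟨u_k| + |u_k⟩⟨φ|) + sin²θ (|φ⟩⟨φ| -
|u_k⟩⟨u_k|), so the energy is a quadratic polynomial in cos θ sin θ and sin²θ, and its derivative at
θ = 0 is twice the real part of the form of D^{(γ)} at (φ, u_k). Minimality makes this vanish, and
multiplying φ by i removes the imaginary part as well (`fockSesq_eq_zero`). Thus the form of D^{(γ)}
on ran P does not couple ran γ to its complement, which is the commutation in the weak sense.

To pass to operators, the u_k must be shown to lie in the operator domain. The mean fields of γ and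
δ are bounded operators, so D^{(γ)} and D^{(δ)} have the same domain and differ by a bounded
operator; with the Euler–Lagrange equation, φ ↦ ⟨D^{(δ)}φ, u_k⟩ is then bounded on dom D^{(δ)} ∩ ran
P. The spectral resolution of D^{(δ)} converts this into u_k ∈ dom D^{(δ)}
(`Resolves.mem_domain_of_bounded`, `frame_mem_domain`), and `commutesWith_compress` concludes by
testing against a dense set.

The analytic input is Kato's inequality (`exists_kato`). It bounds the mean field and makes all
Coulomb and exchange double integrals absolutely convergent, through one amplitude g with sup_a ∫
g(x)²/|a - x| dx < ∞ that dominates every density and kernel in play. Eigenvalues and eigenvectors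
of an operator come from an arbitrary choice; `exists_eigen_expansion` shows that traces, kernels
and densities of γ can be computed from the uᵢ instead. -/

theorem measure_apply (x : H) {B : Set ℝ} (hB : MeasurableSet B) :
    E.measure x B = ENNReal.ofReal (‖E.proj B x‖ ^ 2) :=
  Measure.ofMeasurable_apply B hB

theorem proj_proj {A B : Set ℝ} (hA : MeasurableSet A) (hB : MeasurableSet B) (x : H) :
    E.proj A (E.proj B x) = E.proj (A ∩ B) x := by
  rw [E.proj_inter A B hA hB]; rfl

theorem proj_empty : E.proj ∅ = 0 := by
  ext x
  have h := E.hasSum_proj (fun _ => ∅) (fun _ => MeasurableSet.empty)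
    (fun _ _ _ => by simp [Function.onFun]) x
  exact tendsto_nhds_unique tendsto_const_nhds h.summable.tendsto_atTop_zero

theorem inner_proj_left {B : Set ℝ} (hB : MeasurableSet B) (x y : H) :
    ⟪E.proj B x, y⟫_ℂ = ⟪x, E.proj B y⟫_ℂ := by
  rw [← ContinuousLinearMap.adjoint_inner_right, ← ContinuousLinearMap.star_eq_adjoint,
    (E.isStarProjection B hB).isSelfAdjoint.star_eq]

theorem inner_proj_proj_of_disjoint {A B : Set ℝ} (hA : MeasurableSet A) (hB : MeasurableSet B)
    (h : A ∩ B = ∅) (x y : H) : ⟪E.proj A x, E.proj B y⟫_ℂ = 0 := by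
  rw [E.inner_proj_left hA, E.proj_proj hA hB, h, E.proj_empty]
  simp

theorem proj_add_compl {B : Set ℝ} (hB : MeasurableSet B) (x : H) :
    E.proj B x + E.proj Bᶜ x = x := by
  have h := E.hasSum_proj (fun n => if n = 0 then B else if n = 1 then Bᶜ else ∅)
    (fun n => by
      split_ifs
      exacts [hB, hB.compl, MeasurableSet.empty])
    (by
      intro i j hij
      simp only [Function.onFun]
      split_ifs <;> simp_all [disjoint_compl_right, disjoint_compl_left]) x
  have hU : (⋃ n : ℕ, if n = 0 then B else if n = 1 then Bᶜ else ∅) = Set.univ := by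
    refine Set.eq_univ_of_forall fun t => ?_
    by_cases ht : t ∈ B
    · exact Set.mem_iUnion.2 ⟨0, by simpa using ht⟩
    · exact Set.mem_iUnion.2 ⟨1, by simpa using ht⟩
  rw [hU, E.proj_univ] at h
  have h2 := hasSum_sum_of_ne_finset_zero (L := SummationFilter.unconditional ℕ)
    (s := Finset.range 2)
    (f := fun n : ℕ => E.proj (if n = 0 then B else if n = 1 then Bᶜ else ∅) x) (by
      intro n hn
      have : n ≠ 0 ∧ n ≠ 1 := by simp at hn; omega
      simp [this.1, this.2, E.proj_empty])
  have h3 := h2.unique h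
  simpa [Finset.sum_range_succ] using h3

instance (x : H) : IsFiniteMeasure (E.measure x) :=
  ⟨by rw [E.measure_apply x MeasurableSet.univ]; exact ENNReal.ofReal_lt_top⟩

theorem measure_proj {B : Set ℝ} (hB : MeasurableSet B) (x : H) :
    E.measure (E.proj B x) = (E.measure x).restrict B := by
  ext A hA
  rw [Measure.restrict_apply hA, E.measure_apply _ hA, E.measure_apply _ (hA.inter hB),
    E.proj_proj hA hB]

/-- Pythagoras on every Borel set A: the components in `A ∩ B` and `A ∩ Bᶜ` are orthogonal. -/
theorem measure_add {B : Set ℝ} (hB : MeasurableSet B) (x y : H) :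
    E.measure (E.proj B x + E.proj Bᶜ y) =
      E.measure (E.proj B x) + E.measure (E.proj Bᶜ y) := by
  ext A hA
  rw [Measure.add_apply, E.measure_apply _ hA, E.measure_apply _ hA, E.measure_apply _ hA,
    ← ENNReal.ofReal_add (by positivity) (by positivity), map_add, E.proj_proj hA hB,
    E.proj_proj hA hB.compl]
  congr 1
  have := norm_add_sq_eq_norm_sq_add_norm_sq_of_inner_eq_zero
    (E.proj (A ∩ B) x) (E.proj (A ∩ Bᶜ) y)
    (E.inner_proj_proj_of_disjoint (hA.inter hB) (hA.inter hB.compl) (by ext; simp; tauto) x y)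
  simpa [sq] using this

variable {E} {T : H →ₗ.[ℂ] H}

theorem Resolves.proj_mem (hE : E.Resolves T) {B : Set ℝ} (hB : MeasurableSet B) {x : H}
    (hx : x ∈ T.domain) : E.proj B x ∈ T.domain := by
  rw [hE.1] at hx ⊢
  rw [E.measure_proj hB]
  exact (lintegral_mono' Measure.restrict_le_self le_rfl).trans_lt hx

theorem Resolves.proj_mem_of_bounded (hE : E.Resolves T) {B : Set ℝ} (hB : MeasurableSet B)
    {c : ℝ} (hc : ∀ t ∈ B, |t| ≤ c) (x : H) : E.proj B x ∈ T.domain := by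
  rw [hE.1, E.measure_proj hB]
  calc ∫⁻ t in B, ENNReal.ofReal (t ^ 2) ∂(E.measure x)
      ≤ ∫⁻ _ in B, ENNReal.ofReal (c ^ 2) ∂(E.measure x) := by
        refine setLIntegral_mono measurable_const fun t ht => ENNReal.ofReal_le_ofReal ?_
        rw [← sq_abs]
        exact pow_le_pow_left₀ (abs_nonneg t) (hc t ht) 2
    _ < ∞ := by
        rw [setLIntegral_const]
        exact ENNReal.mul_lt_top ENNReal.ofReal_lt_top (measure_lt_top _ _)

/-- The spectral bands n ≤ |t| < n + 1 decompose x into components on which T is bounded, so all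
partial sums of the decomposition lie in the domain. -/
theorem Resolves.dense_domain (hE : E.Resolves T) : T.domain.topologicalClosure = ⊤ := by
  rw [eq_top_iff]
  intro x _
  have hm : ∀ n : ℕ, MeasurableSet {t : ℝ | ⌊|t|⌋₊ = n} := fun n =>
    (Nat.measurable_floor.comp measurable_norm) (measurableSet_singleton n)
  have h := E.hasSum_proj (fun n => {t : ℝ | ⌊|t|⌋₊ = n}) hm
    (by
      intro i j hij
      refine Set.disjoint_left.2 fun t hi hj => hij ?_
      exact hi.symm.trans hj) x
  have hU : (⋃ n : ℕ, {t : ℝ | ⌊|t|⌋₊ = n}) = Set.univ :=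
    Set.eq_univ_of_forall fun t => Set.mem_iUnion.2 ⟨_, rfl⟩
  rw [hU, E.proj_univ] at h
  refine mem_closure_of_tendsto h (.of_forall fun s => ?_)
  refine T.domain.sum_mem fun n _ =>
    hE.proj_mem_of_bounded (hm n) (c := n + 1) (fun t ht => ?_) x
  have := Nat.lt_floor_add_one |t|
  rw [show ⌊|t|⌋₊ = n from ht] at this
  exact this.le

theorem Resolves.integrable (hE : E.Resolves T) {x : H} (hx : x ∈ T.domain) :
    Integrable (fun t : ℝ => t) (E.measure x) := by
  have h2 : MemLp (fun t : ℝ => t) 2 (E.measure x) := by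
    refine (memLp_two_iff_integrable_sq (f := fun t : ℝ => t)
      measurable_id.aestronglyMeasurable).2 ⟨by fun_prop, ?_⟩
    have h := (hE.1 x).1 hx
    rw [hasFiniteIntegral_iff_ofReal (.of_forall fun t => sq_nonneg t)]
    exact h
  exact h2.integrable one_le_two

/-- `Resolves` prescribes only the diagonal values ⟨x, T x⟩. Additivity of the spectral measure
across B and its complement forces the sum of the two cross terms to vanish. -/
theorem Resolves.inner_add (hE : E.Resolves T) {B : Set ℝ} (hB : MeasurableSet B)
    {x y : T.domain} (hx : E.proj B x = x) (hy : E.proj Bᶜ y = y) :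
    ⟪(x : H), T y⟫_ℂ + ⟪(y : H), T x⟫_ℂ = 0 := by
  have h1 := hE.2 (x + y)
  have hm := E.measure_add hB (x : H) (y : H)
  rw [hx, hy] at hm
  rw [Submodule.coe_add, hm, integral_add_measure (hE.integrable x.2) (hE.integrable y.2),
    Complex.ofReal_add, ← hE.2 x, ← hE.2 y, LinearPMap.map_add, inner_add_left,
    inner_add_right, inner_add_right] at h1
  linear_combination h1

theorem Resolves.inner_eq_zero (hE : E.Resolves T) {B : Set ℝ} (hB : MeasurableSet B)
    {x y : T.domain} (hx : E.proj B x = x) (hy : E.proj Bᶜ y = y) :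
    ⟪(y : H), T x⟫_ℂ = 0 := by
  have h1 := hE.inner_add hB hx hy
  -- Polarisation: replacing y by iy turns the vanishing sum of cross terms into a vanishing
  -- difference. No symmetry of T is presupposed.
  have h2 := hE.inner_add hB hx (y := Complex.I • y) (by simp [hy])
  rw [LinearPMap.map_smul, Submodule.coe_smul, inner_smul_left, inner_smul_right] at h2
  have h3 : Complex.I * (⟪(x : H), T y⟫_ℂ - ⟪(y : H), T x⟫_ℂ) = 0 := by
    simp only [Complex.conj_I] at h2
    linear_combination h2
  have h4 := (mul_eq_zero.1 h3).resolve_left Complex.I_ne_zero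
  linear_combination (1 / 2 : ℂ) * h1 - (1 / 2 : ℂ) * h4

/-- The vector is orthogonal to the dense domain, because the projection `E.proj Bᶜ` can be moved
onto the test vector without leaving the domain. -/
theorem Resolves.proj_compl_apply (hE : E.Resolves T) {B : Set ℝ} (hB : MeasurableSet B)
    {x : T.domain} (hx : E.proj B x = x) : E.proj Bᶜ (T x) = 0 := by
  have hclosed : IsClosed {y : H | ⟪y, E.proj Bᶜ (T x)⟫_ℂ = 0} :=
    isClosed_eq (by fun_prop) continuous_const
  have hsub : (T.domain : Set H) ⊆ {y : H | ⟪y, E.proj Bᶜ (T x)⟫_ℂ = 0} := by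
    intro y hy
    have hm := hE.proj_mem hB.compl hy
    have := hE.inner_eq_zero hB hx (y := ⟨_, hm⟩)
      (by simp [E.proj_proj hB.compl hB.compl])
    rw [Set.mem_ofPred_eq, ← E.inner_proj_left hB.compl]
    exact this
  have h : (E.proj Bᶜ (T x)) ∈ closure (T.domain : Set H) := by
    have : E.proj Bᶜ (T x) ∈ T.domain.topologicalClosure := by rw [hE.dense_domain]; trivial
    exact this
  have := hclosed.closure_subset_iff.2 hsub h
  exact inner_self_eq_zero.1 this

theorem Resolves.apply_proj (hE : E.Resolves T) {B : Set ℝ} (hB : MeasurableSet B)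
    (x : T.domain) : T ⟨E.proj B x, hE.proj_mem hB x.2⟩ = E.proj B (T x) := by
  have hd : T x = T ⟨E.proj B x, hE.proj_mem hB x.2⟩ +
      T ⟨E.proj Bᶜ x, hE.proj_mem hB.compl x.2⟩ := by
    rw [← LinearPMap.map_add]
    congr 1
    exact Subtype.ext (E.proj_add_compl hB x).symm
  have h1 := hE.proj_compl_apply hB (x := ⟨E.proj B x, hE.proj_mem hB x.2⟩)
    (by simp [E.proj_proj hB hB])
  have h2 := hE.proj_compl_apply hB.compl (x := ⟨E.proj Bᶜ x, hE.proj_mem hB.compl x.2⟩)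
    (by simp [E.proj_proj hB.compl hB.compl])
  rw [compl_compl] at h2
  have h3 := E.proj_add_compl hB (T ⟨E.proj B x, hE.proj_mem hB x.2⟩)
  rw [h1, add_zero] at h3
  rw [hd, _root_.map_add, h2, add_zero, h3]

/-- A vector in the nonnegative spectral subspace on which the adjoint of the nonnegative part of
`T` is bounded belongs to the domain of `T`. -/
theorem Resolves.mem_domain_of_bounded (hE : E.Resolves T) {ψ : H}
    (hψ : E.proj (Set.Ici 0) ψ = ψ) {C : ℝ}
    (hC : ∀ φ : T.domain, E.proj (Set.Ici 0) φ = φ → ‖⟪T φ, ψ⟫_ℂ‖ ≤ C * ‖(φ : H)‖) :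
    ψ ∈ T.domain := by
  -- Unit bands of the half line. Since ψ is in the nonnegative spectral subspace, they carry its
  -- whole spectral measure.
  set I : ℕ → Set ℝ := fun j => Set.Ico (j : ℝ) (j + 1) with hI
  have hIm : ∀ j, MeasurableSet (I j) := fun j => measurableSet_Ico
  have hdisj : ∀ i j, i ≠ j → I i ∩ I j = ∅ := by
    intro i j hij
    ext t
    simp only [hI, Set.mem_inter_iff, Set.mem_Ico, Set.mem_empty_iff_false, iff_false]
    rintro ⟨⟨h1, h2⟩, h3, h4⟩
    have h5 : (i : ℝ) < j + 1 := by linarith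
    have h6 : (j : ℝ) < i + 1 := by linarith
    have h7 : i < j + 1 := by exact_mod_cast h5
    have h8 : j < i + 1 := by exact_mod_cast h6
    omega
  have hU : (⋃ j, I j) = Set.Ici 0 := by
    ext t
    simp only [hI, Set.mem_iUnion, Set.mem_Ico, Set.mem_Ici]
    constructor
    · rintro ⟨j, hj, _⟩
      exact (Nat.cast_nonneg j).trans hj
    · intro ht
      exact ⟨⌊t⌋₊, Nat.floor_le ht, Nat.lt_floor_add_one t⟩
  have hmem : ∀ j, E.proj (I j) ψ ∈ T.domain := fun j =>
    hE.proj_mem_of_bounded (hIm j) (c := j + 1) (fun t ht => by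
      rw [abs_of_nonneg ((Nat.cast_nonneg j).trans ht.1)]; exact ht.2.le) ψ
  set v : ℕ → T.domain := fun j => ⟨E.proj (I j) ψ, hmem j⟩ with hv
  have hvpos : ∀ j, E.proj (Set.Ici 0) (v j) = v j := fun j => by
    simp only [hv]
    rw [E.proj_proj measurableSet_Ici (hIm j), Set.inter_eq_right.2 (hU ▸ Set.subset_iUnion I j)]
  have hinner : ∀ j : ℕ, ((j : ℝ) * ‖(v j : H)‖ ^ 2) ≤ RCLike.re ⟪T (v j), ψ⟫_ℂ := by
    intro j
    have h1 : T (v j) = E.proj (I j) (T (v j)) := by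
      rw [← hE.apply_proj (hIm j)]
      congr 1
      exact Subtype.ext (by simp [hv, E.proj_proj (hIm j) (hIm j)])
    have h2 : ⟪T (v j), ψ⟫_ℂ = ⟪T (v j), (v j : H)⟫_ℂ := by
      rw [h1, E.inner_proj_left (hIm j), ← h1]
    rw [h2, ← inner_conj_symm, hE.2, RCLike.conj_re]
    have h3 : RCLike.re (((∫ t, t ∂(E.measure (v j : H)) : ℝ) : ℂ)) =
      ∫ t, t ∂(E.measure (v j : H)) := rfl
    rw [h3]
    have h4 : ∫ t, (j : ℝ) ∂(E.measure (v j : H)) ≤ ∫ t, t ∂(E.measure (v j : H)) := by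
      refine integral_mono_ae (integrable_const _) (hE.integrable (v j).2) ?_
      simp only [hv]
      rw [E.measure_proj (hIm j)]
      exact (ae_restrict_mem (hIm j)).mono fun t ht => ht.1
    rw [integral_const, smul_eq_mul, measureReal_def, E.measure_apply _ MeasurableSet.univ,
      E.proj_univ, ENNReal.toReal_ofReal (by positivity)] at h4
    simp only [one_apply_eq_self] at h4
    linarith
  -- A truncation of ⌊T⌋ψ. It is chosen so that ‖φ n‖² = S n while Re⟨T φ n, ψ⟩ ≥ S n, the weight j
  -- being at most the spectral parameter on band j.
  set φ : ℕ → T.domain := fun n => ∑ j ∈ Finset.range n, ((j : ℝ) : ℂ) • v j with hφ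
  set S : ℕ → ℝ := fun n => ∑ j ∈ Finset.range n, (j : ℝ) ^ 2 * ‖(v j : H)‖ ^ 2 with hS
  have hφpos : ∀ n, E.proj (Set.Ici 0) (φ n) = φ n := fun n => by
    simp only [hφ, AddSubmonoidClass.coe_finsetSum, Submodule.coe_smul, _root_.map_sum,
      _root_.map_smul, hvpos]
  have hφnorm : ∀ n, ‖(φ n : H)‖ ^ 2 = S n := by
    intro n
    induction n with
    | zero => simp [hφ, hS]
    | succ n ih =>
      have h1 : (φ (n + 1) : H) = φ n + ((n : ℝ) : ℂ) • (v n : H) := by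
        simp [hφ, Finset.sum_range_succ]
      have h2 : ⟪(φ n : H), ((n : ℝ) : ℂ) • (v n : H)⟫_ℂ = 0 := by
        rw [inner_smul_right]
        simp only [hφ, AddSubmonoidClass.coe_finsetSum, Submodule.coe_smul, sum_inner]
        rw [Finset.sum_eq_zero, mul_zero]
        intro j hj
        rw [inner_smul_left, E.inner_proj_proj_of_disjoint (hIm j) (hIm n)
          (hdisj j n (Finset.mem_range.1 hj).ne), mul_zero]
      have h3 := norm_add_sq_eq_norm_sq_add_norm_sq_of_inner_eq_zero _ _ h2
      rw [h1, sq, h3, ← sq, ih]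
      simp only [hS, Finset.sum_range_succ, norm_smul, Complex.norm_real, Real.norm_natCast]
      ring
  have hSle : ∀ n, S n ≤ C ^ 2 := by
    intro n
    have h1 : S n ≤ RCLike.re ⟪T (φ n), ψ⟫_ℂ := by
      have : T (φ n) = ∑ j ∈ Finset.range n, ((j : ℝ) : ℂ) • T (v j) := by
        simp only [hφ]
        rw [← LinearPMap.toFun_eq_coe, _root_.map_sum]
        simp only [_root_.map_smul, LinearPMap.toFun_eq_coe]
      rw [this, sum_inner, map_sum]
      refine Finset.sum_le_sum fun j _ => ?_
      rw [inner_smul_left, Complex.conj_ofReal]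
      have := mul_le_mul_of_nonneg_left (hinner j) (Nat.cast_nonneg j)
      have h5 : RCLike.re (((j : ℝ) : ℂ) * ⟪T (v j), ψ⟫_ℂ) = (j : ℝ) * RCLike.re ⟪T (v j), ψ⟫_ℂ :=
        Complex.re_ofReal_mul _ _
      rw [h5]
      linarith
    have h2 := (h1.trans (RCLike.re_le_norm _)).trans (hC (φ n) (hφpos n))
    have h3 := hφnorm n
    -- From a² ≤ C a it follows that a² ≤ C², by expanding (C - a)² ≥ 0.
    nlinarith [norm_nonneg (φ n : H), sq_nonneg (C - ‖(φ n : H)‖)]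
  -- On band j one has t² ≤ (j + 1)² ≤ 2j² + 2, so this series dominates the second moment of the
  -- spectral measure.
  have hsum : Summable fun j : ℕ => (2 * (j : ℝ) ^ 2 + 2) * ‖(v j : H)‖ ^ 2 := by
    have hs1 : Summable fun j : ℕ => (j : ℝ) ^ 2 * ‖(v j : H)‖ ^ 2 :=
      summable_of_sum_range_le (fun j => by positivity) hSle
    have hs2 : Summable fun j : ℕ => ‖(v j : H)‖ ^ 2 := by
      have h := (E.hasSum_proj I hIm (fun i j hij =>
        Set.disjoint_iff_inter_eq_empty.2 (hdisj i j hij)) ψ).mapL (innerSL ℂ ψ)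
      simp only [innerSL_apply_apply, E.inner_eq (hIm _)] at h
      have h' := h.summable
      exact_mod_cast h'
    exact ((hs1.mul_left 2).add (hs2.mul_left 2)).congr fun j => by ring
  rw [hE.1]
  have hmeas : E.measure ψ = (E.measure ψ).restrict (⋃ j, I j) := by
    rw [hU, ← E.measure_proj measurableSet_Ici, hψ]
  rw [hmeas, lintegral_iUnion hIm
    (fun i j hij => Set.disjoint_iff_inter_eq_empty.2 (hdisj i j hij))]
  calc ∑' j, ∫⁻ t in I j, ENNReal.ofReal (t ^ 2) ∂(E.measure ψ)
      ≤ ∑' j : ℕ, ENNReal.ofReal ((2 * (j : ℝ) ^ 2 + 2) * ‖(v j : H)‖ ^ 2) := by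
        refine ENNReal.tsum_le_tsum fun j => ?_
        calc ∫⁻ t in I j, ENNReal.ofReal (t ^ 2) ∂(E.measure ψ)
            ≤ ∫⁻ _ in I j, ENNReal.ofReal (2 * (j : ℝ) ^ 2 + 2) ∂(E.measure ψ) := by
              refine setLIntegral_mono measurable_const fun t ht => ENNReal.ofReal_le_ofReal ?_
              have h0 : (0 : ℝ) ≤ j := Nat.cast_nonneg j
              have h1 := ht.1
              have h2 := ht.2
              nlinarith [sq_nonneg ((j : ℝ) - 1)]
          _ = _ := by
              rw [setLIntegral_const, E.measure_apply _ (hIm j),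
                ← ENNReal.ofReal_mul (by positivity)]
    _ = ENNReal.ofReal (∑' j : ℕ, (2 * (j : ℝ) ^ 2 + 2) * ‖(v j : H)‖ ^ 2) :=
        (ENNReal.ofReal_tsum_of_nonneg (fun j => by positivity) hsum).symm
    _ < ∞ := ENNReal.ofReal_lt_top

end ProjValuedMeasure

/-! ### Kato's inequality -/

open FourierTransform in
/-- The inverse Fourier transform of an integrable `L²` function is given by the Fourier
integral. -/
theorem fourier_symm_ae_eq (f : Hil) (hf : Integrable (f : Space → Spinor)) :
    (fourier.symm f : Hil) =ᵐ[volume] (𝓕⁻ (f : Space → Spinor) : Space → Spinor) := by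
  have hcont : Continuous (𝓕⁻ (f : Space → Spinor) : Space → Spinor) :=
    VectorFourier.fourierIntegral_continuous Real.continuous_fourierChar
      (L := -innerₗ Space) (show Continuous fun p : Space × Space => -⟪p.1, p.2⟫_ℝ from
      continuous_inner.neg) hf
  -- Both sides are tested against smooth compactly supported functions. On the L² side the
  -- transform is moved to the test function through tempered distributions, on the integrable side
  -- by Fubini.
  refine ae_eq_of_integral_contDiff_smul_eq
    ((Lp.memLp (fourier.symm f : Hil)).locallyIntegrable one_le_two) hcont.locallyIntegrable ?_
  intro g g_smooth g_cpt
  have hg₁ : HasCompactSupport (Complex.ofRealCLM ∘ g) := g_cpt.comp_left rfl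
  have hg₂ : ContDiff ℝ ((⊤ : ℕ∞) : WithTop ℕ∞) (Complex.ofRealCLM ∘ g) :=
    Complex.ofRealCLM.contDiff.comp g_smooth
  set G := hg₁.toSchwartzMap hg₂ with hG
  have h1 : ∫ x, g x • (fourier.symm f : Hil) x =
      Lp.toTemperedDistribution (𝓕⁻ f : Hil) G := by
    rw [Lp.toTemperedDistribution_apply]
    simp only [hG]
    rfl
  rw [h1, ← Lp.fourierInv_toTemperedDistribution_eq, TemperedDistribution.fourierInv_apply,
    Lp.toTemperedDistribution_apply]
  have h2 := VectorFourier.integral_fourierIntegral_smul_eq_flip (L := -innerₗ Space)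
    (μ := volume) (ν := volume) (f := G) (g := (f : Space → Spinor))
    Real.continuous_fourierChar (show Continuous fun p : Space × Space => -⟪p.1, p.2⟫_ℝ from
      continuous_inner.neg) G.integrable hf
  have h3 : (-innerₗ Space).flip = -innerₗ Space := by
    ext x y; simp [real_inner_comm]
  rw [h3] at h2
  rw [SchwartzMap.fourierInv_coe]
  exact h2.trans (integral_congr_ae (.of_forall fun x => rfl))

theorem enorm_fourier_symm_le (f : Hil) (hf : Integrable (f : Space → Spinor)) :
    ∀ᵐ x, ‖(fourier.symm f : Hil) x‖ₑ ≤ ∫⁻ k, ‖f k‖ₑ := by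
  filter_upwards [fourier_symm_ae_eq f hf] with x hx
  rw [hx, Real.fourierInv_eq]
  refine (enorm_integral_le_lintegral_enorm _).trans (le_of_eq ?_)
  refine lintegral_congr fun k => ?_
  rw [← ofReal_norm, ← ofReal_norm, Circle.norm_smul]

theorem lintegral_enorm_sq (f : Hil) : ∫⁻ x, ‖f x‖ₑ ^ 2 = ‖f‖ₑ ^ 2 := by
  rw [Lp.enorm_def, eLpNorm_eq_lintegral_rpow_enorm_toReal two_ne_zero ENNReal.ofNat_ne_top,
    ← ENNReal.rpow_natCast, ← ENNReal.rpow_mul]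
  simp

theorem sq_lintegral_mul_le {X : Type*} [MeasurableSpace X] {μ : Measure X} {f g : X → ℝ≥0∞}
    (hf : AEMeasurable f μ) (hg : AEMeasurable g μ) :
    (∫⁻ x, f x * g x ∂μ) ^ 2 ≤ (∫⁻ x, f x ^ 2 ∂μ) * ∫⁻ x, g x ^ 2 ∂μ := by
  have h := ENNReal.lintegral_mul_le_Lp_mul_Lq μ Real.HolderConjugate.two_two hf hg
  calc (∫⁻ x, f x * g x ∂μ) ^ 2
      ≤ ((∫⁻ x, f x ^ (2 : ℝ) ∂μ) ^ (1 / 2 : ℝ) * (∫⁻ x, g x ^ (2 : ℝ) ∂μ) ^ (1 / 2 : ℝ)) ^ 2 :=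
        pow_le_pow_left' h 2
    _ = _ := by
        rw [mul_pow, ← ENNReal.rpow_natCast, ← ENNReal.rpow_natCast, ← ENNReal.rpow_mul,
          ← ENNReal.rpow_mul]
        simp

theorem lintegral_Ioi_inv_sq {r : ℝ} (hr : 0 < r) :
    ∫⁻ R in Set.Ioi r, ENNReal.ofReal ((R ^ 2)⁻¹) = ENNReal.ofReal r⁻¹ := by
  have h0 : ∀ R ∈ Set.Ioi r, (R ^ 2)⁻¹ = R ^ (-2 : ℝ) := fun R hR => by
    have hR0 : 0 < R := hr.trans hR
    rw [Real.rpow_neg hR0.le]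
    norm_num
  have hi : IntegrableOn (fun R : ℝ => (R ^ 2)⁻¹) (Set.Ioi r) :=
    (integrableOn_Ioi_rpow_of_lt (by norm_num : (-2 : ℝ) < -1) hr).congr_fun
      (fun R hR => (h0 R hR).symm) measurableSet_Ioi
  rw [← ofReal_integral_eq_lintegral_ofReal hi (.of_forall fun R => by positivity),
    setIntegral_congr_fun measurableSet_Ioi h0, integral_Ioi_rpow_of_lt (by norm_num) hr]
  congr 1
  norm_num
  rw [Real.rpow_neg_one]

/-- In polar coordinates the factor r² cancels the integrand; the constant is the area of the unit
sphere, three times the volume of the unit ball. -/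
theorem lintegral_ball_inv_norm_sq {K : ℝ} (hK : 0 < K) :
    ∫⁻ k in Metric.ball (0 : Space) K, (‖k‖ₑ⁻¹) ^ 2 =
      ENNReal.ofReal (3 * volume.real (Metric.ball (0 : Space) 1) * K) := by
  have h3 : Module.finrank ℝ Space = 3 := by simp
  set f : ℝ → ℝ := (Set.Iio K).indicator fun y => (y ^ 2)⁻¹ with hf
  have hEq : Set.EqOn (fun y : ℝ => y ^ (Module.finrank ℝ Space - 1) • f y)
      ((Set.Ioo 0 K).indicator 1) (Set.Ioi 0) := by
    intro y hy
    have hy0 : y ≠ 0 := ne_of_gt hy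
    have hy1 : 0 < y := hy
    by_cases hyK : y < K
    · simp [hf, hyK, hy1, h3, hy0]
    · simp [hf, hyK]
  have hint : Integrable (fun k : Space => f ‖k‖) := by
    rw [integrable_fun_norm_addHaar]
    refine IntegrableOn.congr_fun ?_ hEq.symm measurableSet_Ioi
    exact ((integrable_indicator_iff measurableSet_Ioo).2
      (integrableOn_const (by simp))).integrableOn
  have hval := integral_fun_norm_addHaar (volume : Measure Space) f
  rw [setIntegral_congr_fun measurableSet_Ioi hEq, setIntegral_indicator measurableSet_Ioo,
    Set.inter_eq_right.2 (fun y hy => hy.1)] at hval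
  simp only [Pi.one_apply, integral_const, smul_eq_mul, mul_one, h3] at hval
  have hval' : ∫ k : Space, f ‖k‖ = 3 * volume.real (Metric.ball (0 : Space) 1) * K := by
    rw [hval]; simp [hK.le]; ring
  rw [← hval', ofReal_integral_eq_lintegral_ofReal hint
    (.of_forall fun k => Set.indicator_nonneg (fun y _ => by positivity) _),
    ← lintegral_indicator Metric.isOpen_ball.measurableSet]
  refine lintegral_congr_ae ?_
  have hne : ∀ᵐ k : Space, k ≠ 0 := Measure.ae_ne volume 0
  filter_upwards [hne] with k hk
  have hk' : 0 < ‖k‖ := norm_pos_iff.2 hk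
  by_cases hkK : ‖k‖ < K
  · rw [Set.indicator_of_mem (by simpa using hkK)]
    simp only [hf]
    rw [Set.indicator_of_mem (by simpa using hkK), ENNReal.ofReal_inv_of_pos (by positivity),
      ENNReal.ofReal_pow hk'.le, ofReal_norm, ENNReal.inv_pow]
  · rw [Set.indicator_of_notMem (by simpa using hkK)]
    simp only [hf]
    rw [Set.indicator_of_notMem (by simpa using hkK), ENNReal.ofReal_zero]

theorem measurable_enorm (f : Hil) : Measurable (fun x => ‖f x‖ₑ) :=
  (Lp.stronglyMeasurable f).enorm

theorem add_sq_le_two_mul (a b : ℝ≥0∞) : (a + b) ^ 2 ≤ 2 * a ^ 2 + 2 * b ^ 2 := by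
  have h := ENNReal.rpow_add_le_mul_rpow_add_rpow a b one_le_two
  norm_num at h
  rw [← mul_add]
  exact h

theorem exists_add_eq_indicator (φ : Hil) {B : Set Space} (hB : MeasurableSet B) :
    ∃ f g : Hil, φ = f + g ∧ f =ᵐ[volume] B.indicator φ ∧ g =ᵐ[volume] Bᶜ.indicator φ := by
  have hf := (Lp.memLp φ).indicator hB
  have hg := (Lp.memLp φ).indicator hB.compl
  refine ⟨hf.toLp _, hg.toLp _, ?_, hf.coeFn_toLp, hg.coeFn_toLp⟩
  rw [← MemLp.toLp_add]
  refine Lp.ext (Filter.EventuallyEq.trans ?_ (MemLp.coeFn_toLp _).symm)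
  rw [Set.indicator_self_add_compl]

/-- Frequencies are split at 1/R, the scale dual to the ball. The high part is estimated by
Plancherel on all of space, the low part by its supremum times the volume of the ball. Integrated
against R⁻² dR this yields Kato's inequality. -/
theorem lintegral_ball_enorm_sq_le : ∃ c : ℝ≥0∞, c < ∞ ∧ ∀ (ψ : Hil) (a : Space) (R : ℝ), 0 < R →
    ∫⁻ x in Metric.ball a R, ‖ψ x‖ₑ ^ 2 ≤
      2 * (∫⁻ k in (Metric.ball (0 : Space) R⁻¹)ᶜ, ‖fourier ψ k‖ₑ ^ 2) +
        c * ENNReal.ofReal (R ^ 2) *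
          ∫⁻ k in Metric.ball (0 : Space) R⁻¹, ‖k‖ₑ ^ 2 * ‖fourier ψ k‖ₑ ^ 2 := by
  set V := volume.real (Metric.ball (0 : Space) 1) with hV
  refine ⟨2 * ENNReal.ofReal V * ENNReal.ofReal (3 * V), by
    refine ENNReal.mul_lt_top (ENNReal.mul_lt_top (by simp) ENNReal.ofReal_lt_top)
      ENNReal.ofReal_lt_top, ?_⟩
  intro ψ a R hR
  set B := Metric.ball (0 : Space) R⁻¹ with hB
  have hBm : MeasurableSet B := Metric.isOpen_ball.measurableSet
  obtain ⟨f1, f2, hadd, hi1, hi2⟩ := exists_add_eq_indicator (fourier ψ) hBm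
  have hψ : ψ = fourier.symm f1 + fourier.symm f2 := by
    rw [← LinearIsometryEquiv.map_add fourier.symm, ← hadd]
    exact (fourier.symm_apply_apply ψ).symm
  have hf1e : (fun k => ‖f1 k‖ₑ) =ᵐ[volume] B.indicator fun k => ‖fourier ψ k‖ₑ := by
    filter_upwards [hi1] with k hk
    rw [hk]
    by_cases h : k ∈ B <;> simp [h]
  have hf2e : (fun k => ‖f2 k‖ₑ ^ 2) =ᵐ[volume] Bᶜ.indicator fun k => ‖fourier ψ k‖ₑ ^ 2 := by
    filter_upwards [hi2] with k hk
    rw [hk]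
    by_cases h : k ∈ B <;> simp [h]
  have hhi : ∫⁻ x, ‖(fourier.symm f2 : Hil) x‖ₑ ^ 2 = ∫⁻ k in Bᶜ, ‖fourier ψ k‖ₑ ^ 2 := by
    rw [lintegral_enorm_sq, LinearIsometryEquiv.enorm_map, ← lintegral_enorm_sq,
      lintegral_congr_ae hf2e, lintegral_indicator hBm.compl]
  have hl1 : ∫⁻ k, ‖f1 k‖ₑ = ∫⁻ k in B, ‖fourier ψ k‖ₑ := by
    rw [lintegral_congr_ae hf1e, lintegral_indicator hBm]
  have hint : Integrable (f1 : Space → Spinor) := by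
    have : Integrable (B.indicator (fourier ψ : Space → Spinor)) := by
      rw [integrable_indicator_iff hBm]
      have : IsFiniteMeasure (volume.restrict B) :=
        ⟨by rw [hB, Measure.restrict_apply_univ]; exact measure_ball_lt_top⟩
      exact ((Lp.memLp (fourier ψ)).restrict B).integrable one_le_two
    exact this.congr hi1.symm
  set S := ∫⁻ k in B, ‖k‖ₑ ^ 2 * ‖fourier ψ k‖ₑ ^ 2 with hS
  -- Cauchy–Schwarz after inserting |k|⁻¹|k|; |k|⁻² is integrable near the origin in dimension
  -- three.
  have hl1sq : (∫⁻ k, ‖f1 k‖ₑ) ^ 2 ≤ ENNReal.ofReal (3 * V * R⁻¹) * S := by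
    rw [hl1, ← lintegral_ball_inv_norm_sq (inv_pos.2 hR)]
    have h1 : ∫⁻ k in B, ‖fourier ψ k‖ₑ =
        ∫⁻ k in B, ‖k‖ₑ⁻¹ * (‖k‖ₑ * ‖fourier ψ k‖ₑ) := by
      refine lintegral_congr_ae (ae_restrict_of_ae ?_)
      filter_upwards [Measure.ae_ne (volume : Measure Space) 0] with k hk
      rw [← mul_assoc, ENNReal.inv_mul_cancel (by simpa using hk) enorm_ne_top, one_mul]
    rw [h1]
    refine (sq_lintegral_mul_le (by fun_prop) ?_).trans (le_of_eq ?_)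
    · exact ((measurable_id.enorm).mul (measurable_enorm _)).aemeasurable
    · simp only [mul_pow, hS]
      rfl
  have hlo : ∫⁻ x in Metric.ball a R, ‖(fourier.symm f1 : Hil) x‖ₑ ^ 2 ≤
      ENNReal.ofReal (3 * V * R⁻¹) * S * ENNReal.ofReal (R ^ 3 * V) := by
    calc ∫⁻ x in Metric.ball a R, ‖(fourier.symm f1 : Hil) x‖ₑ ^ 2
        ≤ ∫⁻ x in Metric.ball a R, ENNReal.ofReal (3 * V * R⁻¹) * S := by
          refine lintegral_mono_ae (ae_restrict_of_ae ?_)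
          filter_upwards [enorm_fourier_symm_le f1 hint] with x hx
          exact (pow_le_pow_left' hx 2).trans hl1sq
      _ = _ := by
          rw [setLIntegral_const, Measure.addHaar_ball _ _ hR.le,
            ENNReal.ofReal_mul (p := R ^ 3) (by positivity), hV,
            ofReal_measureReal measure_ball_lt_top.ne]
          simp
  calc ∫⁻ x in Metric.ball a R, ‖ψ x‖ₑ ^ 2
      ≤ ∫⁻ x in Metric.ball a R, (2 * ‖(fourier.symm f2 : Hil) x‖ₑ ^ 2 +
          2 * ‖(fourier.symm f1 : Hil) x‖ₑ ^ 2) := by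
        refine lintegral_mono_ae (ae_restrict_of_ae ?_)
        have hc := Lp.coeFn_add (fourier.symm f1) (fourier.symm f2)
        rw [← hψ] at hc
        filter_upwards [hc] with x hx
        rw [hx, Pi.add_apply]
        refine (pow_le_pow_left' (enorm_add_le _ _) 2).trans ?_
        rw [add_comm]
        exact add_sq_le_two_mul _ _
    _ ≤ 2 * (∫⁻ k in Bᶜ, ‖fourier ψ k‖ₑ ^ 2) +
          2 * (ENNReal.ofReal (3 * V * R⁻¹) * S * ENNReal.ofReal (R ^ 3 * V)) := by
        rw [lintegral_add_left (((measurable_enorm _).pow_const 2).const_mul 2),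
          lintegral_const_mul _ ((measurable_enorm _).pow_const 2),
          lintegral_const_mul _ ((measurable_enorm _).pow_const 2), ← hhi]
        gcongr
        exact Measure.restrict_le_self
    _ = _ := by
        congr 1
        -- The squared supremum contributes R⁻¹ and the volume of the ball R³, which leaves R².
        have h1 : ENNReal.ofReal (3 * V * R⁻¹) * ENNReal.ofReal (R ^ 3 * V) =
            ENNReal.ofReal V * ENNReal.ofReal (3 * V) * ENNReal.ofReal (R ^ 2) := by
          rw [← ENNReal.ofReal_mul (by positivity), ← ENNReal.ofReal_mul (by positivity),
            ← ENNReal.ofReal_mul (by positivity)]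
          congr 1
          field_simp
        calc 2 * (ENNReal.ofReal (3 * V * R⁻¹) * S * ENNReal.ofReal (R ^ 3 * V))
            = 2 * (ENNReal.ofReal (3 * V * R⁻¹) * ENNReal.ofReal (R ^ 3 * V)) * S := by ring
          _ = _ := by rw [h1]; ring

theorem enorm_mul_sq_le_freeEnergy (m : ℝ) (ψ : Hil) :
    ∫⁻ k, ‖k‖ₑ * ‖fourier ψ k‖ₑ ^ 2 ≤ freeEnergy m ψ := by
  refine lintegral_mono fun k => ?_
  rw [← ofReal_norm, ← ofReal_norm, ← ENNReal.ofReal_pow (norm_nonneg _),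
    ← ENNReal.ofReal_mul (norm_nonneg _)]
  refine ENNReal.ofReal_le_ofReal (mul_le_mul_of_nonneg_right ?_ (sq_nonneg _))
  refine Real.le_sqrt_of_sq_le ?_
  rw [norm_smul, Real.norm_of_nonneg (by positivity), mul_pow]
  have hpi : (1 : ℝ) ≤ (2 * Real.pi) ^ 2 := by nlinarith [Real.pi_gt_three]
  nlinarith [sq_nonneg m, sq_nonneg ‖k‖]

/-- Kato's inequality `1 / |x - a| ≤ C |p|`, with an unspecified constant. -/
theorem exists_kato : ∃ C : ℝ≥0∞, C < ∞ ∧ ∀ (m : ℝ) (ψ : Hil) (a : Space),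
    ∫⁻ x, ‖ψ x‖ₑ ^ 2 * ENNReal.ofReal ‖a - x‖⁻¹ ≤ C * freeEnergy m ψ := by
  obtain ⟨c, hc, hball⟩ := lintegral_ball_enorm_sq_le
  refine ⟨2 + c, ENNReal.add_lt_top.2 ⟨by simp, hc⟩, fun m ψ a => ?_⟩
  set w : ℝ → ℝ≥0∞ := fun R => ENNReal.ofReal ((R ^ 2)⁻¹) with hw
  have hwm : Measurable w := by fun_prop
  set v : Space → ℝ≥0∞ := fun k => ‖fourier ψ k‖ₑ ^ 2 with hv
  have hvm : Measurable v := (measurable_enorm _).pow_const 2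
  set s₁ : Set (ℝ × Space) := {p | 0 < p.1 ∧ p.1⁻¹ ≤ ‖p.2‖} with hs₁
  set s₂ : Set (ℝ × Space) := {p | 0 < p.1 ∧ ‖p.2‖ < p.1⁻¹} with hs₂
  have hs₁m : MeasurableSet s₁ := (measurableSet_lt measurable_const measurable_fst).inter
    (measurableSet_le measurable_fst.inv measurable_snd.norm)
  have hs₂m : MeasurableSet s₂ := (measurableSet_lt measurable_const measurable_fst).inter
    (measurableSet_lt measurable_snd.norm measurable_fst.inv)
  set F₁ : ℝ × Space → ℝ≥0∞ := s₁.indicator fun p => w p.1 * v p.2 with hF₁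
  set F₂ : ℝ × Space → ℝ≥0∞ := s₂.indicator fun p => ‖p.2‖ₑ ^ 2 * v p.2 with hF₂
  have hF₁m : Measurable F₁ :=
    ((hwm.comp measurable_fst).mul (hvm.comp measurable_snd)).indicator hs₁m
  have hF₂m : Measurable F₂ :=
    ((measurable_snd.enorm.pow_const 2).mul (hvm.comp measurable_snd)).indicator hs₂m
  set t : Set (Space × ℝ) := {p | ‖a - p.1‖ < p.2} with ht
  have htm : MeasurableSet t :=
    measurableSet_lt (measurable_const.sub measurable_fst).norm measurable_snd
  set G : Space × ℝ → ℝ≥0∞ := t.indicator fun p => ‖ψ p.1‖ₑ ^ 2 * w p.2 with hG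
  have hGm : Measurable G := ((((measurable_enorm ψ).pow_const 2).comp measurable_fst).mul
    (hwm.comp measurable_snd)).indicator htm
  -- Layer-cake representation: 1/r is the integral of R⁻² over R > r. At x = a the left side is 0,
  -- since the inverse of 0 is 0.
  have h1 : ∀ x, ‖ψ x‖ₑ ^ 2 * ENNReal.ofReal ‖a - x‖⁻¹ ≤ ∫⁻ R, G (x, R) := by
    intro x
    rcases eq_or_ne (a - x) 0 with h0 | h0
    · simp [h0]
    · rw [← lintegral_Ioi_inv_sq (norm_pos_iff.2 h0), ← lintegral_const_mul _ hwm,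
        ← lintegral_indicator measurableSet_Ioi]
      refine lintegral_mono fun R => ?_
      by_cases hR : ‖a - x‖ < R <;> simp [hG, ht, hR, hw]
  have h2 : ∀ R, ∫⁻ x, G (x, R) ≤ ∫⁻ k, (2 * F₁ (R, k) + c * F₂ (R, k)) := by
    intro R
    by_cases hR : 0 < R
    · have e1 : ∫⁻ x, G (x, R) = (∫⁻ x in Metric.ball a R, ‖ψ x‖ₑ ^ 2) * w R := by
        rw [← lintegral_mul_const _ ((measurable_enorm ψ).pow_const 2),
          ← lintegral_indicator Metric.isOpen_ball.measurableSet]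
        refine lintegral_congr fun x => ?_
        by_cases hx : ‖a - x‖ < R
        · rw [Set.indicator_of_mem (by rwa [Metric.mem_ball, dist_comm, dist_eq_norm])]
          simp [hG, ht, hx]
        · rw [Set.indicator_of_notMem (by rwa [Metric.mem_ball, dist_comm, dist_eq_norm])]
          simp [hG, ht, hx]
      have e2 : ∫⁻ k, F₁ (R, k) = w R * ∫⁻ k in (Metric.ball (0 : Space) R⁻¹)ᶜ, v k := by
        rw [← lintegral_const_mul _ hvm,
          ← lintegral_indicator Metric.isOpen_ball.measurableSet.compl]
        refine lintegral_congr fun k => ?_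
        by_cases hk : R⁻¹ ≤ ‖k‖
        · rw [Set.indicator_of_mem (by simpa using hk)]
          simp [hF₁, hs₁, hk, hR]
        · rw [Set.indicator_of_notMem (by simpa using hk)]
          simp [hF₁, hs₁, hk]
      have e3 : ∫⁻ k, F₂ (R, k) = ∫⁻ k in Metric.ball (0 : Space) R⁻¹, ‖k‖ₑ ^ 2 * v k := by
        rw [← lintegral_indicator Metric.isOpen_ball.measurableSet]
        refine lintegral_congr fun k => ?_
        by_cases hk : ‖k‖ < R⁻¹
        · rw [Set.indicator_of_mem (by simpa using hk)]
          simp [hF₂, hs₂, hk, hR]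
        · rw [Set.indicator_of_notMem (by simpa using hk)]
          simp [hF₂, hs₂, hk]
      have e4 : w R * ENNReal.ofReal (R ^ 2) = 1 := by
        rw [hw, ← ENNReal.ofReal_mul (by positivity), inv_mul_cancel₀ (by positivity)]
        simp
      have hF₁R : Measurable fun k => F₁ (R, k) := hF₁m.comp measurable_prodMk_left
      have hF₂R : Measurable fun k => F₂ (R, k) := hF₂m.comp measurable_prodMk_left
      rw [lintegral_add_left (hF₁R.const_mul 2), lintegral_const_mul _ hF₁R,
        lintegral_const_mul _ hF₂R, e1, e2, e3]
      calc (∫⁻ x in Metric.ball a R, ‖ψ x‖ₑ ^ 2) * w R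
          ≤ (2 * (∫⁻ k in (Metric.ball (0 : Space) R⁻¹)ᶜ, v k) + c * ENNReal.ofReal (R ^ 2) *
            ∫⁻ k in Metric.ball (0 : Space) R⁻¹, ‖k‖ₑ ^ 2 * v k) * w R := by
            gcongr
            exact hball ψ a R hR
        _ = 2 * (w R * ∫⁻ k in (Metric.ball (0 : Space) R⁻¹)ᶜ, v k) +
            c * (∫⁻ k in Metric.ball (0 : Space) R⁻¹, ‖k‖ₑ ^ 2 * v k) *
              (w R * ENNReal.ofReal (R ^ 2)) := by ring
        _ = _ := by rw [e4, mul_one]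
    · have : ∀ x, G (x, R) = 0 := fun x => by
        simp only [hG, ht]
        refine Set.indicator_of_notMem (fun h => hR ?_) _
        exact (norm_nonneg _).trans_lt h
      simp [this]
  -- At fixed k the high-frequency part is active for R ≥ 1/|k| and the low-frequency part for R <
  -- 1/|k|; after integration in R each gives exactly one factor |k|.
  have h3 : ∀ k : Space, k ≠ 0 → ∫⁻ R, F₁ (R, k) = ‖k‖ₑ * v k := by
    intro k hk
    have hk' : 0 < ‖k‖ := norm_pos_iff.2 hk
    have : ∀ R, F₁ (R, k) = (Set.Ici ‖k‖⁻¹).indicator (fun R => w R * v k) R := by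
      intro R
      by_cases hR : ‖k‖⁻¹ ≤ R
      · have hR0 : 0 < R := (inv_pos.2 hk').trans_le hR
        have hR1 : R⁻¹ ≤ ‖k‖ := (inv_le_comm₀ hR0 hk').2 hR
        simp [hF₁, hs₁, hR0, hR1, hR]
      · have : ¬ (0 < R ∧ R⁻¹ ≤ ‖k‖) := fun h => hR ((inv_le_comm₀ h.1 hk').1 h.2)
        rw [Set.indicator_of_notMem (by simpa using hR)]
        exact Set.indicator_of_notMem (show (R, k) ∉ s₁ from this) _
    rw [lintegral_congr this, lintegral_indicator measurableSet_Ici, lintegral_mul_const _ hwm,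
      setLIntegral_congr Ioi_ae_eq_Ici.symm, lintegral_Ioi_inv_sq (inv_pos.2 hk'), inv_inv, ofReal_norm]
  have h4 : ∀ k : Space, k ≠ 0 → ∫⁻ R, F₂ (R, k) = ‖k‖ₑ * v k := by
    intro k hk
    have hk' : 0 < ‖k‖ := norm_pos_iff.2 hk
    have : ∀ R, F₂ (R, k) = (Set.Ioo 0 ‖k‖⁻¹).indicator (fun _ => ‖k‖ₑ ^ 2 * v k) R := by
      intro R
      by_cases hR : R ∈ Set.Ioo 0 ‖k‖⁻¹
      · have hR1 : ‖k‖ < R⁻¹ := (lt_inv_comm₀ hR.1 hk').1 hR.2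
        rw [Set.indicator_of_mem hR]
        exact Set.indicator_of_mem (show (R, k) ∈ s₂ from ⟨hR.1, hR1⟩) _
      · have : ¬ (0 < R ∧ ‖k‖ < R⁻¹) := fun h => hR ⟨h.1, (lt_inv_comm₀ h.1 hk').2 h.2⟩
        rw [Set.indicator_of_notMem hR]
        exact Set.indicator_of_notMem (show (R, k) ∉ s₂ from this) _
    rw [lintegral_congr this, lintegral_indicator measurableSet_Ioo, setLIntegral_const,
      Real.volume_Ioo, sub_zero, ENNReal.ofReal_inv_of_pos hk', ofReal_norm]
    calc ‖k‖ₑ ^ 2 * v k * ‖k‖ₑ⁻¹ = ‖k‖ₑ * v k * (‖k‖ₑ * ‖k‖ₑ⁻¹) := by ring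
      _ = _ := by rw [ENNReal.mul_inv_cancel (by simpa using hk) enorm_ne_top, mul_one]
  calc ∫⁻ x, ‖ψ x‖ₑ ^ 2 * ENNReal.ofReal ‖a - x‖⁻¹
      ≤ ∫⁻ x, ∫⁻ R, G (x, R) := lintegral_mono h1
    _ = ∫⁻ R, ∫⁻ x, G (x, R) := lintegral_lintegral_swap hGm.aemeasurable
    _ ≤ ∫⁻ R, ∫⁻ k, (2 * F₁ (R, k) + c * F₂ (R, k)) := lintegral_mono h2
    _ = ∫⁻ k, ∫⁻ R, (2 * F₁ (R, k) + c * F₂ (R, k)) :=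
        lintegral_lintegral_swap ((hF₁m.const_mul 2).add (hF₂m.const_mul c)).aemeasurable
    _ = ∫⁻ k, (2 + c) * (‖k‖ₑ * v k) := by
        refine lintegral_congr_ae ?_
        filter_upwards [Measure.ae_ne (volume : Measure Space) 0] with k hk
        have hF₁k : Measurable fun R => F₁ (R, k) := hF₁m.comp measurable_prodMk_right
        have hF₂k : Measurable fun R => F₂ (R, k) := hF₂m.comp measurable_prodMk_right
        rw [lintegral_add_left (hF₁k.const_mul 2), lintegral_const_mul _ hF₁k,
          lintegral_const_mul _ hF₂k, h3 k hk, h4 k hk, add_mul]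
    _ = (2 + c) * ∫⁻ k, ‖k‖ₑ * v k := lintegral_const_mul _ (measurable_id.enorm.mul hvm)
    _ ≤ _ := by
        gcongr
        exact enorm_mul_sq_le_freeEnergy m ψ

/-! ### The free energy -/

/-- The symbol `√(|p|² + m²)` of `|D₀|`. -/
def freeSymbol (m : ℝ) (k : Space) : ℝ := Real.sqrt (‖(2 * Real.pi) • k‖ ^ 2 + m ^ 2)

theorem continuous_freeSymbol (m : ℝ) : Continuous (freeSymbol m) := by
  unfold freeSymbol
  fun_prop

theorem freeEnergy_eq (m : ℝ) (ψ : Hil) :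
    freeEnergy m ψ = ∫⁻ k, ENNReal.ofReal (freeSymbol m k) * ‖fourier ψ k‖ₑ ^ 2 := by
  refine lintegral_congr fun k => ?_
  rw [← ofReal_norm, ← ENNReal.ofReal_pow (norm_nonneg _),
    ← ENNReal.ofReal_mul (by exact Real.sqrt_nonneg _)]
  rfl

theorem enorm_sq_le_freeEnergy (m : ℝ) (ψ : Hil) :
    ENNReal.ofReal m * ‖ψ‖ₑ ^ 2 ≤ freeEnergy m ψ := by
  rw [← fourier.enorm_map ψ, ← lintegral_enorm_sq, freeEnergy_eq,
    ← lintegral_const_mul _ ((measurable_enorm _).pow_const 2)]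
  refine lintegral_mono fun k => ?_
  gcongr
  exact Real.le_sqrt_of_sq_le (by nlinarith [sq_nonneg ‖(2 * Real.pi) • k‖])

theorem freeEnergy_smul (m : ℝ) (c : ℂ) (ψ : Hil) :
    freeEnergy m (c • ψ) = ‖c‖ₑ ^ 2 * freeEnergy m ψ := by
  have hm : Measurable fun k => ENNReal.ofReal (freeSymbol m k) * ‖fourier ψ k‖ₑ ^ 2 :=
    (continuous_freeSymbol m).measurable.ennreal_ofReal.mul ((measurable_enorm _).pow_const 2)
  rw [freeEnergy_eq, freeEnergy_eq, ← lintegral_const_mul _ hm]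
  refine lintegral_congr_ae ?_
  rw [map_smul]
  filter_upwards [Lp.coeFn_smul c (fourier ψ)] with k hk
  rw [hk, Pi.smul_apply, enorm_smul]
  ring

theorem freeEnergy_add_le (m : ℝ) (ψ χ : Hil) :
    freeEnergy m (ψ + χ) ≤ 2 * freeEnergy m ψ + 2 * freeEnergy m χ := by
  have hm : ∀ ψ : Hil, Measurable fun k => ENNReal.ofReal (freeSymbol m k) * ‖fourier ψ k‖ₑ ^ 2 :=
    fun ψ => (continuous_freeSymbol m).measurable.ennreal_ofReal.mul
      ((measurable_enorm _).pow_const 2)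
  rw [freeEnergy_eq, freeEnergy_eq, freeEnergy_eq, ← lintegral_const_mul _ (hm ψ),
    ← lintegral_const_mul _ (hm χ), ← lintegral_add_left ((hm ψ).const_mul 2)]
  refine lintegral_mono_ae ?_
  rw [map_add]
  filter_upwards [Lp.coeFn_add (fourier ψ) (fourier χ)] with k hk
  rw [hk, Pi.add_apply]
  calc ENNReal.ofReal (freeSymbol m k) * ‖fourier ψ k + fourier χ k‖ₑ ^ 2
      ≤ ENNReal.ofReal (freeSymbol m k) * (2 * ‖fourier ψ k‖ₑ ^ 2 + 2 * ‖fourier χ k‖ₑ ^ 2) := by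
        gcongr
        exact (pow_le_pow_left' (enorm_add_le _ _) 2).trans (add_sq_le_two_mul _ _)
    _ = _ := by ring

/-- The form domain `H^{1/2}(ℝ³; ℂ⁴)`. -/
def formDomain (m : ℝ) : Submodule ℂ Hil where
  carrier := {ψ | freeEnergy m ψ < ∞}
  zero_mem' := by
    have := freeEnergy_smul m 0 0
    simp only [zero_smul, enorm_zero, ne_eq, OfNat.ofNat_ne_zero, not_false_eq_true, zero_pow,
      zero_mul] at this
    rw [Set.mem_ofPred_eq, this]
    exact ENNReal.zero_lt_top
  add_mem' := fun {ψ χ} hψ hχ => (freeEnergy_add_le m ψ χ).trans_lt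
    (ENNReal.add_lt_top.2 ⟨ENNReal.mul_lt_top (by simp) hψ, ENNReal.mul_lt_top (by simp) hχ⟩)
  smul_mem' := fun c ψ hψ => by
    rw [Set.mem_ofPred_eq, freeEnergy_smul]
    exact ENNReal.mul_lt_top (by simp) hψ

theorem mem_formDomain {m : ℝ} {ψ : Hil} : ψ ∈ formDomain m ↔ freeEnergy m ψ < ∞ := Iff.rfl

/-! ### Eigenvalues of elements of `F` -/

section Sqrt

variable {H : Type*} [NormedAddCommGroup H] [InnerProductSpace ℂ H] [CompleteSpace H]

/-- With S the square root and f = S e - √μ e, one has (S + √μ) f = S²e - μ e = 0. For μ > 0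
positivity of S gives f = 0; for μ = 0 one uses ‖S e‖² = ⟨e, A e⟩ = 0. -/
theorem sqrt_apply_of_eigenvector {A : H →L[ℂ] H} (hA : 0 ≤ A) {e : H} {μ : ℝ} (hμ : 0 ≤ μ)
    (he : A e = (μ : ℂ) • e) : CFC.sqrt A e = ((Real.sqrt μ : ℝ) : ℂ) • e := by
  set S := CFC.sqrt A with hS
  have hS0 : S.IsPositive := (ContinuousLinearMap.nonneg_iff_isPositive S).1 (CFC.sqrt_nonneg A)
  have hSS : ∀ x, S (S x) = A x := fun x => by
    have := congrArg (fun T : H →L[ℂ] H => T x) (CFC.sqrt_mul_sqrt_self A hA)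
    simpa using this
  have hsq : ((Real.sqrt μ : ℝ) : ℂ) * ((Real.sqrt μ : ℝ) : ℂ) = μ := by
    rw [← Complex.ofReal_mul, Real.mul_self_sqrt hμ]
  set f := S e - ((Real.sqrt μ : ℝ) : ℂ) • e with hf
  have h1 : S f + ((Real.sqrt μ : ℝ) : ℂ) • f = 0 := by
    rw [hf, map_sub, hSS, he, map_smul, smul_sub, smul_smul, hsq]
    abel
  rcases hμ.eq_or_lt with h0 | h0
  · have h2 : ⟪S e, S e⟫_ℂ = 0 := by
      have h3 := hS0.isSelfAdjoint.isSymmetric e (S e)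
      simp only [ContinuousLinearMap.coe_coe] at h3
      rw [h3, hSS, he, ← h0]
      simp
    rw [inner_self_eq_zero.1 h2, ← h0]
    simp
  · have h2 : RCLike.re ⟪S f, f⟫_ℂ + Real.sqrt μ * ‖f‖ ^ 2 = 0 := by
      have h3 := congrArg (fun x => RCLike.re ⟪x, f⟫_ℂ) h1
      simp only [inner_add_left, inner_smul_left, map_add, inner_zero_left, map_zero] at h3
      rw [Complex.conj_ofReal, inner_self_eq_norm_sq_to_K] at h3
      have h4 : RCLike.re (((Real.sqrt μ : ℝ) : ℂ) * ((‖f‖ : ℝ) : ℂ) ^ 2) =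
          Real.sqrt μ * ‖f‖ ^ 2 := by
        rw [← Complex.ofReal_pow, ← Complex.ofReal_mul]; rfl
      rw [← h4]
      exact h3
    have h3 := hS0.re_inner_nonneg_left f
    have h4 : 0 < Real.sqrt μ := Real.sqrt_pos.2 h0
    have h5 : ‖f‖ ^ 2 = 0 := by nlinarith [sq_nonneg ‖f‖]
    have h6 : f = 0 := by simpa using h5
    exact sub_eq_zero.1 h6

theorem sqrtAbs_apply_of_eigenvector {B : H →L[ℂ] H} (hB : IsSelfAdjoint B) {e : H} {c : ℝ}
    (he : B e = (c : ℂ) • e) : sqrtAbs B e = ((Real.sqrt |c| : ℝ) : ℂ) • e := by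
  refine sqrt_apply_of_eigenvector (CFC.abs_nonneg B) (abs_nonneg c) ?_
  rw [← Real.sqrt_sq_eq_abs]
  refine sqrt_apply_of_eigenvector (star_mul_self_nonneg B) (sq_nonneg c) ?_
  rw [hB.star_eq, mul_apply_eq_comp, he, map_smul, he, smul_smul]
  push_cast
  ring_nf

end Sqrt

theorem sum_freeEnergy_le_normF (m : ℝ) (δ : Hil →L[ℂ] Hil) {ι : Type*} (s : Finset ι)
    {e : ι → Hil} (he : Orthonormal ℂ e) :
    ∑ i ∈ s, freeEnergy m (sqrtAbs δ (e i)) ≤ normF m δ := by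
  classical
  have hinj : Function.Injective e := he.linearIndependent.injective
  have h1 : ∑ i ∈ s, freeEnergy m (sqrtAbs δ (e i)) =
      ∑ x ∈ s.image e, freeEnergy m (sqrtAbs δ x) :=
    (Finset.sum_image (f := fun x => freeEnergy m (sqrtAbs δ x)) (fun i _ j _ h => hinj h)).symm
  rw [h1]
  refine le_iSup₂_of_le (s.image e) ?_ le_rfl
  have hch : ∀ x : ↥(s.image e), ∃ i, e i = (x : Hil) := fun x => by
    obtain ⟨i, _, hi⟩ := Finset.mem_image.1 x.2
    exact ⟨i, hi⟩
  choose j hj using hch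
  have : ((↑) : ↥(s.image e) → Hil) = e ∘ j := by
    ext1 x; exact (hj x).symm
  rw [this]
  refine he.comp j fun x y hxy => Subtype.ext ?_
  rw [← hj x, ← hj y, hxy]

/-- The eigenbasis is one of the orthonormal families over which `normF` takes its supremum. If no
eigensystem exists, all `eigenvalue`s are 0 by default and the bound is trivial, so compactness of δ
is not needed here. -/
theorem tsum_eigenvalue_freeEnergy_le (m : ℝ) {δ : Hil →L[ℂ] Hil} (hδ : IsSelfAdjoint δ) :
    ∑' n, ‖eigenvalue δ n‖ₑ * freeEnergy m (eigenvector δ n) ≤ normF m δ := by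
  by_cases h : Nonempty (EigenSystem δ)
  · rw [ENNReal.tsum_eq_iSup_sum]
    refine iSup_le fun s => ?_
    refine le_trans (le_of_eq (Finset.sum_congr rfl fun n _ => ?_))
      (sum_freeEnergy_le_normF m δ s h.some.basis.orthonormal)
    simp only [eigenvalue, eigenvector, dif_pos h]
    rw [sqrtAbs_apply_of_eigenvector hδ (h.some.apply_basis n), freeEnergy_smul]
    congr 1
    rw [← ofReal_norm, ← ofReal_norm, ← ENNReal.ofReal_pow (norm_nonneg _), Complex.norm_real,
      Real.norm_of_nonneg (Real.sqrt_nonneg _), Real.sq_sqrt (abs_nonneg _), Real.norm_eq_abs]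
  · simp [eigenvalue, dif_neg h]

/-! ### Coulomb-bounded amplitudes -/

/-- An amplitude `g` for which the potential of `g²` is bounded and `∫ g²` is finite. -/
structure CoulombBounded (g : Space → ℝ≥0∞) : Prop where
  measurable : Measurable g
  lintegral_sq_lt_top : ∫⁻ x, g x ^ 2 < ∞
  exists_bound : ∃ M : ℝ≥0∞, M < ∞ ∧ ∀ a, ∫⁻ x, g x ^ 2 * ENNReal.ofReal ‖a - x‖⁻¹ ≤ M

theorem coulombBounded_enorm {m : ℝ} {ψ : Hil} (hψ : ψ ∈ formDomain m) :
    CoulombBounded fun x => ‖ψ x‖ₑ := by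
  obtain ⟨C, hC, hkato⟩ := exists_kato
  refine ⟨measurable_enorm ψ, ?_, C * freeEnergy m ψ, ENNReal.mul_lt_top hC hψ, hkato m ψ⟩
  rw [lintegral_enorm_sq]
  exact ENNReal.pow_lt_top enorm_lt_top

theorem CoulombBounded.add {g h : Space → ℝ≥0∞} (hg : CoulombBounded g) (hh : CoulombBounded h) :
    CoulombBounded fun x => g x + h x := by
  obtain ⟨M, hM, hgM⟩ := hg.exists_bound
  obtain ⟨N, hN, hhN⟩ := hh.exists_bound
  have hgm := hg.measurable
  have hhm := hh.measurable
  refine ⟨hgm.add hhm, ?_, 2 * M + 2 * N, by simp [ENNReal.mul_lt_top_iff, hM, hN], fun a => ?_⟩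
  · calc ∫⁻ x, (g x + h x) ^ 2 ≤ ∫⁻ x, (2 * g x ^ 2 + 2 * h x ^ 2) :=
          lintegral_mono fun x => add_sq_le_two_mul _ _
      _ = 2 * (∫⁻ x, g x ^ 2) + 2 * ∫⁻ x, h x ^ 2 := by
          rw [lintegral_add_left (by fun_prop), lintegral_const_mul _ (by fun_prop),
            lintegral_const_mul _ (by fun_prop)]
      _ < ∞ := by
          simp [ENNReal.mul_lt_top_iff, hg.lintegral_sq_lt_top, hh.lintegral_sq_lt_top]
  · calc ∫⁻ x, (g x + h x) ^ 2 * ENNReal.ofReal ‖a - x‖⁻¹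
        ≤ ∫⁻ x, (2 * (g x ^ 2 * ENNReal.ofReal ‖a - x‖⁻¹) +
            2 * (h x ^ 2 * ENNReal.ofReal ‖a - x‖⁻¹)) := by
          refine lintegral_mono fun x => ?_
          calc _ ≤ (2 * g x ^ 2 + 2 * h x ^ 2) * ENNReal.ofReal ‖a - x‖⁻¹ := by
                gcongr; exact add_sq_le_two_mul _ _
            _ = _ := by ring
      _ = 2 * (∫⁻ x, g x ^ 2 * ENNReal.ofReal ‖a - x‖⁻¹) +
            2 * ∫⁻ x, h x ^ 2 * ENNReal.ofReal ‖a - x‖⁻¹ := by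
          rw [lintegral_add_left (by fun_prop), lintegral_const_mul _ (by fun_prop),
            lintegral_const_mul _ (by fun_prop)]
      _ ≤ _ := by
          gcongr
          exacts [hgM a, hhN a]

/-- The amplitude `(∑ₙ |λₙ| |ξₙ|²)^{1/2}` of an operator. -/
def amplitude (δ : Hil →L[ℂ] Hil) (x : Space) : ℝ≥0∞ :=
  (∑' n, ‖eigenvalue δ n‖ₑ * ‖eigenvector δ n x‖ₑ ^ 2) ^ (1 / 2 : ℝ)

theorem amplitude_sq (δ : Hil →L[ℂ] Hil) (x : Space) :
    amplitude δ x ^ 2 = ∑' n, ‖eigenvalue δ n‖ₑ * ‖eigenvector δ n x‖ₑ ^ 2 := by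
  rw [amplitude, ← ENNReal.rpow_natCast, ← ENNReal.rpow_mul]
  simp

theorem measurable_amplitude (δ : Hil →L[ℂ] Hil) : Measurable (amplitude δ) :=
  (Measurable.tsum fun n =>
    ((measurable_enorm (eigenvector δ n)).pow_const 2).const_mul _).pow_const _

/-- Kato's inequality is applied to each eigenvector and summed with the weights |λₙ|; |D₀| ≥ m > 0
makes the amplitude square integrable. -/
theorem coulombBounded_amplitude {m : ℝ} (hm : 0 < m) {δ : Hil →L[ℂ] Hil} (hδ : MemF m δ) :
    CoulombBounded (amplitude δ) := by
  obtain ⟨C, hC, hkato⟩ := exists_kato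
  have hsum := (tsum_eigenvalue_freeEnergy_le m hδ.1).trans_lt hδ.2
  refine ⟨measurable_amplitude δ, ?_, C * normF m δ, ENNReal.mul_lt_top hC hδ.2, fun a => ?_⟩
  · simp only [amplitude_sq]
    rw [lintegral_tsum fun n =>
      (((measurable_enorm (eigenvector δ n)).pow_const 2).const_mul _).aemeasurable]
    have h1 : ENNReal.ofReal m * ∑' n, ‖eigenvalue δ n‖ₑ * ‖eigenvector δ n‖ₑ ^ 2 < ∞ := by
      rw [← ENNReal.tsum_mul_left]
      refine lt_of_le_of_lt (ENNReal.tsum_le_tsum fun n => ?_) hsum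
      rw [mul_left_comm]
      gcongr
      exact enorm_sq_le_freeEnergy m _
    simp only [lintegral_const_mul _ ((measurable_enorm _).pow_const 2), lintegral_enorm_sq]
    by_contra hcon
    rw [not_lt, top_le_iff] at hcon
    rw [hcon, ENNReal.mul_top (by simpa using hm)] at h1
    exact lt_irrefl _ h1
  · simp only [amplitude_sq, ← ENNReal.tsum_mul_right]
    have hw : Measurable fun x : Space => ENNReal.ofReal ‖a - x‖⁻¹ := by fun_prop
    rw [lintegral_tsum (f := fun n x =>
      ‖eigenvalue δ n‖ₑ * ‖eigenvector δ n x‖ₑ ^ 2 * ENNReal.ofReal ‖a - x‖⁻¹) fun n =>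
      ((((measurable_enorm (eigenvector δ n)).pow_const 2).const_mul _).mul hw).aemeasurable]
    calc ∑' n, ∫⁻ x, ‖eigenvalue δ n‖ₑ * ‖eigenvector δ n x‖ₑ ^ 2 * ENNReal.ofReal ‖a - x‖⁻¹
        ≤ ∑' n, C * (‖eigenvalue δ n‖ₑ * freeEnergy m (eigenvector δ n)) := by
          refine ENNReal.tsum_le_tsum fun n => ?_
          simp only [mul_assoc]
          rw [lintegral_const_mul' _ _ enorm_ne_top, mul_left_comm]
          gcongr
          exact hkato m _ a
      _ ≤ _ := by
          rw [ENNReal.tsum_mul_left]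
          gcongr
          exact tsum_eigenvalue_freeEnergy_le m hδ.1

/-! ### Densities and kernels dominated by a Coulomb-bounded amplitude -/

/-- A density `ρ` with `|ρ| ≤ g²`. -/
structure DominatedDensity (g : Space → ℝ≥0∞) (ρ : Space → ℝ) : Prop where
  measurable : Measurable ρ
  bound : ∀ x, ‖ρ x‖ₑ ≤ g x ^ 2

/-- An integral kernel `K` with `|K(x, y)| ≤ g(x) g(y)`. -/
structure DominatedKernel (g : Space → ℝ≥0∞) (K : Space → Space → Matrix (Fin 4) (Fin 4) ℂ) :
    Prop where
  measurable : ∀ s t, Measurable fun p : Space × Space => K p.1 p.2 s t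
  bound : ∀ x y s t, ‖K x y s t‖ₑ ≤ g x * g y

theorem measurable_eval (ψ : Hil) (s : Fin 4) : Measurable fun x => ψ x s :=
  (EuclideanSpace.proj (𝕜 := ℂ) s).continuous.measurable.comp (Lp.stronglyMeasurable ψ).measurable

theorem enorm_eval_le (v : Spinor) (s : Fin 4) : ‖v s‖ₑ ≤ ‖v‖ₑ := by
  rw [← ofReal_norm, ← ofReal_norm]
  exact ENNReal.ofReal_le_ofReal (PiLp.norm_apply_le v s)

theorem enorm_sq_eq_sum (v : Spinor) : ‖v‖ₑ ^ 2 = ∑ s, ‖v s‖ₑ ^ 2 := by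
  simp only [← ofReal_norm, ← ENNReal.ofReal_pow (norm_nonneg _)]
  rw [← ENNReal.ofReal_sum_of_nonneg (fun _ _ => by positivity), EuclideanSpace.norm_sq_eq]

theorem dominatedDensity_density (δ : Hil →L[ℂ] Hil) :
    DominatedDensity (amplitude δ) (density δ) := by
  refine ⟨?_, fun x => ?_⟩
  · refine Finset.measurable_sum _ fun s _ => ?_
    exact Measurable.tsum fun n => ((measurable_eval _ s).norm.pow_const 2).const_mul _
  · rw [amplitude_sq]
    calc ‖density δ x‖ₑ ≤ ∑ s, ‖∑' n, eigenvalue δ n * ‖eigenvector δ n x s‖ ^ 2‖ₑ :=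
          enorm_sum_le _ _
      _ ≤ ∑ s, ∑' n, ‖eigenvalue δ n‖ₑ * ‖eigenvector δ n x s‖ₑ ^ 2 := by
          refine Finset.sum_le_sum fun s _ => enorm_tsum_le_tsum_enorm.trans (le_of_eq ?_)
          refine tsum_congr fun n => ?_
          rw [enorm_mul, enorm_pow, enorm_norm]
      _ = _ := by
          rw [← Summable.tsum_finsetSum fun _ _ => ENNReal.summable]
          refine tsum_congr fun n => ?_
          rw [enorm_sq_eq_sum, Finset.mul_sum]

/-- Cauchy–Schwarz for the sum over n, with |λₙ| split evenly between the two eigenfunctions. -/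
theorem dominatedKernel_kernel (δ : Hil →L[ℂ] Hil) :
    DominatedKernel (amplitude δ) (kernel δ) := by
  refine ⟨fun s t => ?_, fun x y s t => ?_⟩
  · refine Measurable.tsum fun n => ?_
    refine Measurable.mul (((measurable_eval _ s).comp measurable_fst).const_mul _) ?_
    exact Complex.continuous_conj.measurable.comp ((measurable_eval _ t).comp measurable_snd)
  · have h1 : ‖kernel δ x y s t‖ₑ ≤
        ∑' n, ‖eigenvalue δ n‖ₑ * (‖eigenvector δ n x‖ₑ * ‖eigenvector δ n y‖ₑ) := by
      refine enorm_tsum_le_tsum_enorm.trans (ENNReal.tsum_le_tsum fun n => ?_)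
      rw [enorm_mul, enorm_mul, mul_assoc, RCLike.enorm_conj]
      have : ‖((eigenvalue δ n : ℝ) : ℂ)‖ₑ = ‖eigenvalue δ n‖ₑ := by
        rw [← ofReal_norm, ← ofReal_norm, Complex.norm_real]
      rw [this]
      gcongr <;> exact enorm_eval_le _ _
    refine h1.trans ?_
    rw [← ENNReal.pow_le_pow_left_iff two_ne_zero, mul_pow, amplitude_sq, amplitude_sq]
    set a : ℕ → ℝ≥0∞ := fun n => ‖eigenvalue δ n‖ₑ ^ (1 / 2 : ℝ) with ha
    have ha2 : ∀ n, ‖eigenvalue δ n‖ₑ = a n * a n := fun n => by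
      rw [ha, ← ENNReal.rpow_add_of_nonneg _ _ (by norm_num) (by norm_num)]
      norm_num
    have h := sq_lintegral_mul_le (μ := Measure.count)
      (f := fun n => a n * ‖eigenvector δ n x‖ₑ) (g := fun n => a n * ‖eigenvector δ n y‖ₑ)
      (Measurable.of_discrete).aemeasurable (Measurable.of_discrete).aemeasurable
    simp only [lintegral_count] at h
    simp only [ha2]
    refine (le_of_eq ?_).trans (h.trans (le_of_eq ?_))
    · congr 1; exact tsum_congr fun n => by ring
    · congr 1 <;> exact tsum_congr fun n => by ring

/-- Cauchy–Schwarz with weight 1/|x - y| bounds the squared inner integral by M ∫ |ψ(y)|²/|x - y|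
dy; doing the x integral first then gives the second factor M. This is the L² boundedness of the
exchange operator. -/
theorem lintegral_mul_enorm_le {g : Space → ℝ≥0∞} (hg : Measurable g) {M : ℝ≥0∞}
    (hM : ∀ a, ∫⁻ x, g x ^ 2 * ENNReal.ofReal ‖a - x‖⁻¹ ≤ M) (ψ : Hil) :
    ∫⁻ x, g x ^ 2 * (∫⁻ y, g y * ‖ψ y‖ₑ * ENNReal.ofReal ‖x - y‖⁻¹) ^ 2 ≤ M ^ 2 * ‖ψ‖ₑ ^ 2 := by
  have hψ := measurable_enorm ψ
  have h1 : ∀ x, (∫⁻ y, g y * ‖ψ y‖ₑ * ENNReal.ofReal ‖x - y‖⁻¹) ^ 2 ≤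
      M * ∫⁻ y, ‖ψ y‖ₑ ^ 2 * ENNReal.ofReal ‖x - y‖⁻¹ := by
    intro x
    set w : Space → ℝ≥0∞ := fun y => ENNReal.ofReal ‖x - y‖⁻¹ ^ (1 / 2 : ℝ) with hw
    have hwm : Measurable w := by fun_prop
    have hw2 : ∀ y, ENNReal.ofReal ‖x - y‖⁻¹ = w y * w y := fun y => by
      rw [hw, ← ENNReal.rpow_add_of_nonneg _ _ (by norm_num) (by norm_num)]
      norm_num
    have h := sq_lintegral_mul_le (μ := volume) (hg.mul hwm).aemeasurable
      (hψ.mul hwm).aemeasurable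
    calc (∫⁻ y, g y * ‖ψ y‖ₑ * ENNReal.ofReal ‖x - y‖⁻¹) ^ 2
        = (∫⁻ y, (g * w) y * ((fun y => ‖ψ y‖ₑ) * w) y) ^ 2 := by
          congr 1
          refine lintegral_congr fun y => ?_
          rw [hw2, Pi.mul_apply, Pi.mul_apply]
          ring
      _ ≤ _ := h
      _ = (∫⁻ y, g y ^ 2 * ENNReal.ofReal ‖x - y‖⁻¹) *
            ∫⁻ y, ‖ψ y‖ₑ ^ 2 * ENNReal.ofReal ‖x - y‖⁻¹ := by
          congr 1 <;>
          · refine lintegral_congr fun y => ?_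
            rw [hw2, Pi.mul_apply]
            ring
      _ ≤ _ := by gcongr; exact hM x
  calc ∫⁻ x, g x ^ 2 * (∫⁻ y, g y * ‖ψ y‖ₑ * ENNReal.ofReal ‖x - y‖⁻¹) ^ 2
      ≤ ∫⁻ x, ∫⁻ y, M * (‖ψ y‖ₑ ^ 2 * (g x ^ 2 * ENNReal.ofReal ‖y - x‖⁻¹)) := by
        refine lintegral_mono fun x => ?_
        calc _ ≤ g x ^ 2 * (M * ∫⁻ y, ‖ψ y‖ₑ ^ 2 * ENNReal.ofReal ‖x - y‖⁻¹) := by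
              gcongr; exact h1 x
          _ = _ := by
              rw [← lintegral_const_mul _ (by fun_prop), ← lintegral_const_mul _ (by fun_prop)]
              refine lintegral_congr fun y => ?_
              rw [norm_sub_rev]
              ring
    _ = ∫⁻ y, ∫⁻ x, M * (‖ψ y‖ₑ ^ 2 * (g x ^ 2 * ENNReal.ofReal ‖y - x‖⁻¹)) :=
        lintegral_lintegral_swap (by fun_prop)
    _ ≤ ∫⁻ y, M * (‖ψ y‖ₑ ^ 2 * M) := by
        refine lintegral_mono fun y => ?_
        rw [lintegral_const_mul _ (by fun_prop), lintegral_const_mul _ (by fun_prop)]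
        gcongr
        exact hM y
    _ = M ^ 2 * ‖ψ‖ₑ ^ 2 := by
        rw [lintegral_const_mul _ (by fun_prop), lintegral_mul_const _ (by fun_prop),
          lintegral_enorm_sq]
        ring

/-! ### Boundedness of the direct potential -/

section Potential

variable {g : Space → ℝ≥0∞} {ρ : Space → ℝ}

theorem DominatedDensity.stronglyMeasurable_potential (hρ : DominatedDensity g ρ) :
    StronglyMeasurable fun x => ∫ y, ρ y / ‖x - y‖ :=
  StronglyMeasurable.integral_prod_right' (f := fun p : Space × Space => ρ p.2 / ‖p.1 - p.2‖)
    (((hρ.measurable.comp measurable_snd).div (by fun_prop)).stronglyMeasurable)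

theorem enorm_div_norm (c : ℝ) (x : Space) : ‖c / ‖x‖‖ₑ = ‖c‖ₑ * ENNReal.ofReal ‖x‖⁻¹ := by
  rw [div_eq_mul_inv, enorm_mul, Real.enorm_of_nonneg (inv_nonneg.2 (norm_nonneg x))]

theorem DominatedDensity.enorm_potential_le (hρ : DominatedDensity g ρ) {M : ℝ≥0∞}
    (hM : ∀ a, ∫⁻ x, g x ^ 2 * ENNReal.ofReal ‖a - x‖⁻¹ ≤ M) (x : Space) :
    ‖∫ y, ρ y / ‖x - y‖‖ₑ ≤ M := by
  refine (enorm_integral_le_lintegral_enorm _).trans ((lintegral_mono fun y => ?_).trans (hM x))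
  rw [enorm_div_norm]
  gcongr
  exact hρ.bound y

theorem DominatedDensity.potential_domain (hg : CoulombBounded g) (hρ : DominatedDensity g ρ) :
    (potential fun x => ∫ y, ρ y / ‖x - y‖).domain = ⊤ := by
  obtain ⟨M, hMt, hM⟩ := hg.exists_bound
  rw [eq_top_iff]
  intro ψ _
  refine MemLp.of_le_mul (c := M.toReal) (Lp.memLp ψ) ?_ (.of_forall fun x => ?_)
  · exact (Complex.continuous_ofReal.comp_aestronglyMeasurable
      hρ.stronglyMeasurable_potential.aestronglyMeasurable).smul (Lp.aestronglyMeasurable ψ)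
  · have h := hρ.enorm_potential_le hM x
    rw [smul_apply, norm_smul, Complex.norm_real, ContinuousLinearMap.id_apply]
    gcongr
    rw [← toReal_enorm]
    exact ENNReal.toReal_mono hMt.ne h

end Potential

/-! ### Boundedness of the exchange operator -/

section Exchange

theorem toEuclideanCLM_apply_eq_sum (A : Matrix (Fin 4) (Fin 4) ℂ) (v : Spinor) :
    Matrix.toEuclideanCLM (𝕜 := ℂ) A v =
      ∑ s, ∑ t, (A s t * v t) • EuclideanSpace.single s (1 : ℂ) := by
  ext i
  simp only [Matrix.ofLp_toEuclideanCLM, Matrix.mulVec, dotProduct, WithLp.ofLp_sum,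
    WithLp.ofLp_smul, Finset.sum_apply, Pi.smul_apply, smul_eq_mul]
  symm
  rw [Finset.sum_eq_single i (fun j _ hj => by simp [hj.symm]) (by simp)]
  simp

theorem enorm_toEuclideanCLM_le {A : Matrix (Fin 4) (Fin 4) ℂ} {c : ℝ≥0∞}
    (hA : ∀ s t, ‖A s t‖ₑ ≤ c) (v : Spinor) :
    ‖Matrix.toEuclideanCLM (𝕜 := ℂ) A v‖ₑ ≤ 16 * (c * ‖v‖ₑ) := by
  rw [toEuclideanCLM_apply_eq_sum]
  calc _ ≤ ∑ s : Fin 4, ∑ t : Fin 4, c * ‖v‖ₑ := by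
        refine (enorm_sum_le _ _).trans (Finset.sum_le_sum fun s _ => ?_)
        refine (enorm_sum_le _ _).trans (Finset.sum_le_sum fun t _ => ?_)
        rw [enorm_smul, enorm_mul]
        have : ‖EuclideanSpace.single s (1 : ℂ)‖ₑ = 1 := by
          rw [← ofReal_norm]; simp
        rw [this, mul_one]
        gcongr
        exacts [hA s t, enorm_eval_le v t]
    _ = _ := by
        simp only [Finset.sum_const, Finset.card_univ, Fintype.card_fin, nsmul_eq_mul]
        push_cast
        ring

variable {g : Space → ℝ≥0∞} {δ : Hil →L[ℂ] Hil}

theorem stronglyMeasurable_exchangeIntegrand (hK : DominatedKernel g (kernel δ)) (ψ : Hil) :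
    StronglyMeasurable fun p : Space × Space => exchangeIntegrand δ ψ p.1 p.2 := by
  simp only [exchangeIntegrand, toEuclideanCLM_apply_eq_sum]
  have h : StronglyMeasurable fun p : Space × Space => ((‖p.1 - p.2‖⁻¹ : ℝ) : ℂ) :=
    (Complex.continuous_ofReal.measurable.comp (by fun_prop)).stronglyMeasurable
  refine h.smul (Finset.stronglyMeasurable_fun_sum _ fun s _ =>
    Finset.stronglyMeasurable_fun_sum _ fun t _ => ?_)
  exact ((hK.measurable s t).mul
    ((measurable_eval ψ t).comp measurable_snd)).stronglyMeasurable.smul_const _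

theorem enorm_exchangeIntegrand_le (hK : DominatedKernel g (kernel δ)) (ψ : Hil) (x y : Space) :
    ‖exchangeIntegrand δ ψ x y‖ₑ ≤ 16 * g x * (g y * ‖ψ y‖ₑ * ENNReal.ofReal ‖x - y‖⁻¹) := by
  rw [exchangeIntegrand, enorm_smul]
  have : ‖((‖x - y‖⁻¹ : ℝ) : ℂ)‖ₑ = ENNReal.ofReal ‖x - y‖⁻¹ := by
    rw [← ofReal_norm, Complex.norm_real, Real.norm_of_nonneg (by positivity)]
  rw [this]
  calc _ ≤ ENNReal.ofReal ‖x - y‖⁻¹ * (16 * (g x * g y * ‖ψ y‖ₑ)) := by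
        gcongr
        exact enorm_toEuclideanCLM_le (hK.bound x y) _
    _ = _ := by ring

theorem lintegral_sq_exchangeIntegrand_lt_top (hg : CoulombBounded g)
    (hK : DominatedKernel g (kernel δ)) (ψ : Hil) :
    ∫⁻ x, (∫⁻ y, ‖exchangeIntegrand δ ψ x y‖ₑ) ^ 2 < ∞ := by
  obtain ⟨M, hMt, hM⟩ := hg.exists_bound
  have hgm := hg.measurable
  have hψ := measurable_enorm ψ
  calc ∫⁻ x, (∫⁻ y, ‖exchangeIntegrand δ ψ x y‖ₑ) ^ 2
      ≤ ∫⁻ x, 16 ^ 2 *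
          (g x ^ 2 * (∫⁻ y, g y * ‖ψ y‖ₑ * ENNReal.ofReal ‖x - y‖⁻¹) ^ 2) := by
        refine lintegral_mono fun x => ?_
        calc _ ≤ (∫⁻ y, 16 * g x * (g y * ‖ψ y‖ₑ * ENNReal.ofReal ‖x - y‖⁻¹)) ^ 2 := by
              gcongr with y
              exact enorm_exchangeIntegrand_le hK ψ x y
          _ = _ := by
              rw [lintegral_const_mul _ (by fun_prop)]
              ring
    _ = 16 ^ 2 * ∫⁻ x, g x ^ 2 * (∫⁻ y, g y * ‖ψ y‖ₑ * ENNReal.ofReal ‖x - y‖⁻¹) ^ 2 :=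
        lintegral_const_mul' _ _ (by simp)
    _ ≤ 16 ^ 2 * (M ^ 2 * ‖ψ‖ₑ ^ 2) := by
        gcongr
        exact lintegral_mul_enorm_le hgm hM ψ
    _ < ∞ := by
        simp [ENNReal.mul_lt_top_iff, ENNReal.pow_lt_top_iff, hMt]

theorem exchange_domain (hg : CoulombBounded g) (hK : DominatedKernel g (kernel δ)) :
    (exchange δ).domain = ⊤ := by
  rw [eq_top_iff]
  intro ψ _
  have hlt := lintegral_sq_exchangeIntegrand_lt_top hg hK ψ
  have hsm := stronglyMeasurable_exchangeIntegrand hK ψ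
  refine ⟨?_, ?_, ?_⟩
  · filter_upwards [ae_lt_top ((hsm.enorm.lintegral_prod_right').pow_const 2) hlt.ne] with x hx
    exact ⟨(hsm.comp_measurable measurable_prodMk_left).aestronglyMeasurable,
      (ENNReal.pow_lt_top_iff.1 hx).resolve_right two_ne_zero⟩
  · exact hsm.integral_prod_right'.aestronglyMeasurable
  · rw [eLpNorm_lt_top_iff_lintegral_rpow_enorm_lt_top two_ne_zero ENNReal.ofNat_ne_top]
    refine lt_of_le_of_lt (lintegral_mono fun x => ?_) hlt
    refine (ENNReal.rpow_le_rpow (enorm_integral_le_lintegral_enorm _) (by simp)).trans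
      (le_of_eq ?_)
    simp

end Exchange

theorem meanField_domain {m : ℝ} (hm : 0 < m) {δ : Hil →L[ℂ] Hil} (hδ : MemF m δ) :
    (meanField δ).domain = ⊤ := by
  have hg := coulombBounded_amplitude hm hδ
  change (potential (directPotential δ)).domain ⊓ (exchange δ).domain = ⊤
  rw [exchange_domain hg (dominatedKernel_kernel δ), inf_top_eq]
  exact (dominatedDensity_density δ).potential_domain hg

/-- The right side does not involve δ, so D^{(δ)} and D^{(γ)} share their domain. This is what lets
regularity proved for one be used for the other. -/
theorem diracFock_domain {m : ℝ} (hm : 0 < m) (α Z : ℝ) {δ : Hil →L[ℂ] Hil} (hδ : MemF m δ) :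
    (diracFock m α Z δ).domain = (diracCoulomb m α Z).domain := by
  change (diracCoulomb m α Z).domain ⊓ (meanField δ).domain = _
  rw [meanField_domain hm hδ, inf_top_eq]

/-! ### The symbol of the Dirac operator -/

theorem diracMatrix_isHermitian (m : ℝ) (p : Space) :
    ((∑ j, (p j : ℂ) • diracAlpha j) + (m : ℂ) • diracBeta).IsHermitian := by
  ext s t
  fin_cases s <;> fin_cases t <;>
    simp [Fin.sum_univ_three, diracAlpha, diracBeta, Matrix.conjTranspose_apply]

theorem diracMatrix_mul_self (m : ℝ) (p : Space) :
    ((∑ j, (p j : ℂ) • diracAlpha j) + (m : ℂ) • diracBeta) *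
      ((∑ j, (p j : ℂ) • diracAlpha j) + (m : ℂ) • diracBeta) =
      ((‖p‖ ^ 2 + m ^ 2 : ℝ) : ℂ) • (1 : Matrix (Fin 4) (Fin 4) ℂ) := by
  have hp : ‖p‖ ^ 2 = p 0 ^ 2 + p 1 ^ 2 + p 2 ^ 2 := by
    rw [EuclideanSpace.norm_sq_eq, Fin.sum_univ_three]
    simp
  rw [hp]
  have hI : Complex.I ^ 2 = -1 := Complex.I_sq
  ext s t
  fin_cases s <;> fin_cases t <;>
    simp [Fin.sum_univ_three, Fin.sum_univ_four, diracAlpha, diracBeta, Matrix.mul_apply] <;>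
    ring_nf <;> (try rw [hI]) <;> ring

theorem diracSymbol_inner (m : ℝ) (p : Space) (v w : Spinor) :
    ⟪diracSymbol m p v, w⟫_ℂ = ⟪v, diracSymbol m p w⟫_ℂ := by
  have h : IsSelfAdjoint (diracSymbol m p) := by
    rw [IsSelfAdjoint, diracSymbol, ← map_star]
    congr 1
    exact diracMatrix_isHermitian m p
  exact h.isSymmetric v w

theorem diracSymbol_diracSymbol (m : ℝ) (p : Space) (v : Spinor) :
    diracSymbol m p (diracSymbol m p v) = ((‖p‖ ^ 2 + m ^ 2 : ℝ) : ℂ) • v := by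
  have h : diracSymbol m p * diracSymbol m p = ((‖p‖ ^ 2 + m ^ 2 : ℝ) : ℂ) • 1 := by
    rw [diracSymbol, ← map_mul, diracMatrix_mul_self, map_smul, map_one]
  have := congrArg (fun T : Spinor →L[ℂ] Spinor => T v) h
  simpa using this

/-- The symbol is Hermitian and, by the anticommutation of the Dirac matrices, its square is the
scalar |p|² + m². -/
theorem norm_diracSymbol_sq (m : ℝ) (p : Space) (v : Spinor) :
    ‖diracSymbol m p v‖ ^ 2 = (‖p‖ ^ 2 + m ^ 2) * ‖v‖ ^ 2 := by
  have h1 : ((‖diracSymbol m p v‖ ^ 2 : ℝ) : ℂ) = (((‖p‖ ^ 2 + m ^ 2) * ‖v‖ ^ 2 : ℝ) : ℂ) := by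
    have h2 := inner_self_eq_norm_sq_to_K (𝕜 := ℂ) (diracSymbol m p v)
    have h3 := inner_self_eq_norm_sq_to_K (𝕜 := ℂ) v
    rw [diracSymbol_inner, diracSymbol_diracSymbol, inner_smul_right, h3] at h2
    push_cast at h2 ⊢
    exact h2.symm
  exact_mod_cast h1

theorem norm_diracSymbol (m : ℝ) (k : Space) (v : Spinor) :
    ‖diracSymbol m ((2 * Real.pi) • k) v‖ = freeSymbol m k * ‖v‖ := by
  rw [← Real.sqrt_sq (norm_nonneg (diracSymbol m ((2 * Real.pi) • k) v)), norm_diracSymbol_sq,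
    Real.sqrt_mul (by positivity), Real.sqrt_sq (norm_nonneg v), freeSymbol]

theorem measurable_diracSymbol (m : ℝ) (ψ : Hil) :
    StronglyMeasurable fun k => diracSymbol m ((2 * Real.pi) • k) (ψ k) := by
  simp only [diracSymbol, toEuclideanCLM_apply_eq_sum]
  refine Finset.stronglyMeasurable_fun_sum _ fun s _ =>
    Finset.stronglyMeasurable_fun_sum _ fun t _ => ?_
  refine (Measurable.mul ?_ (measurable_eval ψ t)).stronglyMeasurable.smul_const _
  refine Continuous.measurable ?_
  simp only [Matrix.add_apply, Matrix.sum_apply, Matrix.smul_apply, PiLp.smul_apply]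
  fun_prop

/-! ### Multiplication forms -/

/-- The sesquilinear form `∫ ⟨φ(x), A(x) ψ(x)⟩ dx`. -/
def mulForm (A : Space → Spinor →L[ℂ] Spinor) (φ ψ : Hil) : ℂ := ∫ x, ⟪φ x, A x (ψ x)⟫_ℂ

/-- The integrand of `mulForm` is integrable. -/
def MulFormIntegrable (A : Space → Spinor →L[ℂ] Spinor) (φ ψ : Hil) : Prop :=
  Integrable fun x => ⟪φ x, A x (ψ x)⟫_ℂ

section MulForm

variable {A : Space → Spinor →L[ℂ] Spinor}

theorem mulForm_add_right {φ ψ χ : Hil} (h₁ : MulFormIntegrable A φ ψ)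
    (h₂ : MulFormIntegrable A φ χ) : mulForm A φ (ψ + χ) = mulForm A φ ψ + mulForm A φ χ := by
  unfold mulForm
  rw [← integral_add h₁ h₂]
  refine integral_congr_ae ?_
  filter_upwards [Lp.coeFn_add ψ χ] with x hx
  rw [hx, Pi.add_apply, map_add, inner_add_right]

theorem mulForm_smul_right (c : ℂ) (φ ψ : Hil) : mulForm A φ (c • ψ) = c * mulForm A φ ψ := by
  unfold mulForm
  rw [← integral_const_mul]
  refine integral_congr_ae ?_
  filter_upwards [Lp.coeFn_smul c ψ] with x hx
  rw [hx, Pi.smul_apply, map_smul, inner_smul_right]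

/-- Conjugation commutes with the Bochner integral even when the latter takes its default value 0,
so no integrability is required. -/
theorem mulForm_conj_symm (hA : ∀ x v w, ⟪A x v, w⟫_ℂ = ⟪v, A x w⟫_ℂ) (φ ψ : Hil) :
    (starRingEnd ℂ) (mulForm A ψ φ) = mulForm A φ ψ := by
  unfold mulForm
  rw [← integral_conj]
  refine integral_congr_ae (.of_forall fun x => ?_)
  simp only
  rw [inner_conj_symm, hA]

theorem mul_le_sq_add_sq (a b : ℝ≥0∞) : a * b ≤ a ^ 2 + b ^ 2 := by
  rcases le_total a b with h | h
  · calc a * b ≤ b * b := by gcongr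
      _ ≤ _ := by rw [← sq]; exact le_add_self
  · calc a * b ≤ a * a := by gcongr
      _ ≤ _ := by rw [← sq]; exact le_self_add

theorem mulFormIntegrable_of_le {φ ψ : Hil} {w : Space → ℝ≥0∞} (hwm : Measurable w)
    (hm : AEStronglyMeasurable (fun x => A x (ψ x)) volume)
    (hw : ∀ x, ‖A x (ψ x)‖ₑ ≤ w x * ‖ψ x‖ₑ) (hφ : ∫⁻ x, w x * ‖φ x‖ₑ ^ 2 < ∞)
    (hψ : ∫⁻ x, w x * ‖ψ x‖ₑ ^ 2 < ∞) : MulFormIntegrable A φ ψ := by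
  refine ⟨(Lp.aestronglyMeasurable φ).inner hm, ?_⟩
  calc ∫⁻ x, ‖⟪φ x, A x (ψ x)⟫_ℂ‖ₑ
      ≤ ∫⁻ x, (w x * ‖φ x‖ₑ ^ 2 + w x * ‖ψ x‖ₑ ^ 2) := by
        refine lintegral_mono fun x => ?_
        calc ‖⟪φ x, A x (ψ x)⟫_ℂ‖ₑ ≤ ‖φ x‖ₑ * ‖A x (ψ x)‖ₑ := by
              simp only [← ofReal_norm]
              rw [← ENNReal.ofReal_mul (norm_nonneg _)]
              exact ENNReal.ofReal_le_ofReal (norm_inner_le_norm _ _)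
          _ ≤ ‖φ x‖ₑ * (w x * ‖ψ x‖ₑ) := by gcongr; exact hw x
          _ = w x * (‖φ x‖ₑ * ‖ψ x‖ₑ) := by ring
          _ ≤ w x * (‖φ x‖ₑ ^ 2 + ‖ψ x‖ₑ ^ 2) := by gcongr; exact mul_le_sq_add_sq _ _
          _ = _ := by ring
    _ = (∫⁻ x, w x * ‖φ x‖ₑ ^ 2) + ∫⁻ x, w x * ‖ψ x‖ₑ ^ 2 :=
        lintegral_add_left (hwm.mul ((measurable_enorm φ).pow_const 2)) _
    _ < ∞ := ENNReal.add_lt_top.2 ⟨hφ, hψ⟩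

end MulForm

/-! ### The form of the Coulomb-Dirac operator -/

/-- The symbol of the free Dirac operator in the Fourier variable. -/
abbrev kineticSymbol (m : ℝ) (k : Space) : Spinor →L[ℂ] Spinor :=
  diracSymbol m ((2 * Real.pi) • k)

/-- Multiplication by a real number, acting on spinors. -/
abbrev realMul (V : Space → ℝ) (x : Space) : Spinor →L[ℂ] Spinor :=
  (V x : ℂ) • ContinuousLinearMap.id ℂ Spinor

theorem kinetic_integrable {m : ℝ} {φ ψ : Hil} (hφ : φ ∈ formDomain m) (hψ : ψ ∈ formDomain m) :
    MulFormIntegrable (kineticSymbol m) (fourier φ) (fourier ψ) := by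
  rw [mem_formDomain, freeEnergy_eq] at hφ hψ
  refine mulFormIntegrable_of_le (continuous_freeSymbol m).measurable.ennreal_ofReal
    (measurable_diracSymbol m _).aestronglyMeasurable (fun k => ?_) hφ hψ
  rw [← ofReal_norm, ← ofReal_norm, norm_diracSymbol,
    ENNReal.ofReal_mul (by exact Real.sqrt_nonneg _)]

theorem realMul_inner (V : Space → ℝ) (x : Space) (v w : Spinor) :
    ⟪realMul V x v, w⟫_ℂ = ⟪v, realMul V x w⟫_ℂ := by
  simp

theorem coulomb_integrable {m : ℝ} {φ ψ : Hil} (hφ : φ ∈ formDomain m) (hψ : ψ ∈ formDomain m) :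
    MulFormIntegrable (realMul fun x => ‖x‖⁻¹) φ ψ := by
  have key : ∀ χ ∈ formDomain m, ∫⁻ x, ENNReal.ofReal ‖x‖⁻¹ * ‖χ x‖ₑ ^ 2 < ∞ := by
    intro χ hχ
    obtain ⟨M, hM, h⟩ := (coulombBounded_enorm hχ).exists_bound
    refine lt_of_le_of_lt ?_ ((h 0).trans_lt hM)
    simp only [zero_sub, norm_neg, mul_comm, le_refl]
  refine mulFormIntegrable_of_le (by fun_prop) ?_ (fun x => ?_) (key φ hφ) (key ψ hψ)
  · have h : Measurable fun x : Space => ((‖x‖⁻¹ : ℝ) : ℂ) :=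
      Complex.continuous_ofReal.measurable.comp (by fun_prop)
    exact h.aestronglyMeasurable.smul (Lp.aestronglyMeasurable ψ)
  · rw [← ofReal_norm, smul_apply, norm_smul, Complex.norm_real,
      ENNReal.ofReal_mul (norm_nonneg _), Real.norm_of_nonneg (by positivity), ofReal_norm]
    rfl

/-- The sesquilinear form of the Coulomb-Dirac operator. -/
def diracSesq (m α Z : ℝ) (φ ψ : Hil) : ℂ :=
  mulForm (kineticSymbol m) (fourier φ) (fourier ψ) -
    ((α * Z : ℝ) : ℂ) * mulForm (realMul fun x => ‖x‖⁻¹) φ ψ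

section DiracSesq

variable {m : ℝ} (α Z : ℝ)

theorem diracSesq_conj_symm (φ ψ : Hil) :
    (starRingEnd ℂ) (diracSesq m α Z ψ φ) = diracSesq m α Z φ ψ := by
  simp only [diracSesq, map_sub, map_mul, Complex.conj_ofReal]
  rw [mulForm_conj_symm fun x => diracSymbol_inner m _, mulForm_conj_symm (realMul_inner _)]

theorem diracSesq_add_right {φ ψ χ : Hil} (hφ : φ ∈ formDomain m) (hψ : ψ ∈ formDomain m)
    (hχ : χ ∈ formDomain m) :
    diracSesq m α Z φ (ψ + χ) = diracSesq m α Z φ ψ + diracSesq m α Z φ χ := by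
  simp only [diracSesq, map_add]
  rw [mulForm_add_right (kinetic_integrable hφ hψ) (kinetic_integrable hφ hχ),
    mulForm_add_right (coulomb_integrable hφ hψ) (coulomb_integrable hφ hχ)]
  ring

theorem diracSesq_smul_right (c : ℂ) (φ ψ : Hil) :
    diracSesq m α Z φ (c • ψ) = c * diracSesq m α Z φ ψ := by
  simp only [diracSesq, map_smul]
  rw [mulForm_smul_right, mulForm_smul_right]
  ring

theorem diracForm_eq_re {ψ : Hil} (hψ : ψ ∈ formDomain m) :
    diracForm m α Z ψ = (diracSesq m α Z ψ ψ).re := by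
  have h : mulForm (realMul fun x => ‖x‖⁻¹) ψ ψ = ((∫ x, ‖ψ x‖ ^ 2 / ‖x‖ : ℝ) : ℂ) := by
    rw [mulForm, ← integral_complex_ofReal]
    refine integral_congr_ae (.of_forall fun x => ?_)
    simp only [smul_apply, ContinuousLinearMap.id_apply, inner_smul_right,
      inner_self_eq_norm_sq_to_K]
    push_cast
    rw [div_eq_mul_inv, mul_comm]
    rfl
  rw [diracSesq, h, ← Complex.ofReal_mul, Complex.sub_re, Complex.ofReal_re]
  exact congrArg (· - _) (integral_re (kinetic_integrable hψ hψ))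

end DiracSesq

/-- H¹ is contained in H^{1/2}: with w the symbol of |D₀|, w|v|² ≤ |v|² + |wv|². -/
theorem diracFree_domain_le (m : ℝ) : (diracFree m).domain ≤ formDomain m := by
  intro ψ hψ
  have h : MemLp (fun k => diracSymbol m ((2 * Real.pi) • k) (fourier ψ k)) 2 volume := hψ
  have h1 : ∫⁻ k, ‖diracSymbol m ((2 * Real.pi) • k) (fourier ψ k)‖ₑ ^ 2 < ∞ := by
    have := (eLpNorm_lt_top_iff_lintegral_rpow_enorm_lt_top two_ne_zero ENNReal.ofNat_ne_top).1 h.2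
    simpa using this
  rw [mem_formDomain, freeEnergy_eq]
  calc ∫⁻ k, ENNReal.ofReal (freeSymbol m k) * ‖fourier ψ k‖ₑ ^ 2
      ≤ ∫⁻ k, (‖fourier ψ k‖ₑ ^ 2 + ‖diracSymbol m ((2 * Real.pi) • k) (fourier ψ k)‖ₑ ^ 2) := by
        refine lintegral_mono fun k => ?_
        have h2 : ‖diracSymbol m ((2 * Real.pi) • k) (fourier ψ k)‖ₑ =
            ENNReal.ofReal (freeSymbol m k) * ‖fourier ψ k‖ₑ := by
          rw [← ofReal_norm, ← ofReal_norm, norm_diracSymbol,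
            ENNReal.ofReal_mul (by exact Real.sqrt_nonneg _)]
        rw [h2]
        calc _ = ‖fourier ψ k‖ₑ * (ENNReal.ofReal (freeSymbol m k) * ‖fourier ψ k‖ₑ) := by ring
          _ ≤ _ := mul_le_sq_add_sq _ _
    _ = (∫⁻ k, ‖fourier ψ k‖ₑ ^ 2) +
          ∫⁻ k, ‖diracSymbol m ((2 * Real.pi) • k) (fourier ψ k)‖ₑ ^ 2 :=
        lintegral_add_left ((measurable_enorm _).pow_const 2) _
    _ < ∞ := by
        rw [lintegral_enorm_sq]
        exact ENNReal.add_lt_top.2 ⟨ENNReal.pow_lt_top enorm_lt_top, h1⟩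

theorem inner_mulOp (A : Space → Spinor →L[ℂ] Spinor) (φ : Hil) (ψ : (mulOp A).domain) :
    ⟪φ, mulOp A ψ⟫_ℂ = mulForm A φ ψ := by
  rw [L2.inner_def]
  refine integral_congr_ae ?_
  have h : (mulOp A ψ : Hil) =ᵐ[volume] fun x => A x ((ψ : Hil) x) := MemLp.coeFn_toLp ψ.2
  filter_upwards [h] with x hx
  rw [hx]

theorem inner_diracCoulomb (m α Z : ℝ) (φ : Hil) (ψ : (diracCoulomb m α Z).domain) :
    ⟪φ, diracCoulomb m α Z ψ⟫_ℂ = diracSesq m α Z φ ψ := by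
  have h0 : diracCoulomb m α Z ψ = fourier.symm (mulOp (kineticSymbol m) ⟨fourier ψ, ψ.2.1⟩) -
      ((α * Z : ℝ) : ℂ) • potential (fun x => ‖x‖⁻¹) ⟨ψ, ψ.2.2⟩ := rfl
  rw [h0, inner_sub_right, inner_smul_right, diracSesq]
  congr 1
  · rw [← fourier.inner_map_map, LinearIsometryEquiv.apply_symm_apply, inner_mulOp]
  · congr 1
    exact inner_mulOp _ _ _

/-! ### Coulomb and exchange pairings -/

/-- The Coulomb pairing `∬ ρ(x) σ(y) / |x - y| dx dy`. -/
def coulombPairing (ρ σ : Space → ℝ) : ℝ :=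
  ∫ p : Space × Space, ρ p.1 * σ p.2 / ‖p.1 - p.2‖

/-- The exchange pairing `∬ tr (K(x, y)* K'(x, y)) / |x - y| dx dy`. -/
def exchangePairing (K K' : Space → Space → Matrix (Fin 4) (Fin 4) ℂ) : ℂ :=
  ∫ p : Space × Space, (∑ s, ∑ t, (starRingEnd ℂ) (K p.1 p.2 s t) * K' p.1 p.2 s t) /
    (‖p.1 - p.2‖ : ℂ)

section Pairing

variable {g : Space → ℝ≥0∞}

theorem CoulombBounded.lintegral_prod_lt_top (hg : CoulombBounded g) :
    ∫⁻ p : Space × Space, g p.1 ^ 2 * (g p.2 ^ 2 * ENNReal.ofReal ‖p.1 - p.2‖⁻¹) < ∞ := by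
  obtain ⟨M, hMt, hM⟩ := hg.exists_bound
  have hgm := hg.measurable
  rw [Measure.volume_eq_prod, lintegral_prod _ (by fun_prop)]
  calc _ ≤ ∫⁻ x, g x ^ 2 * M := by
        refine lintegral_mono fun x => ?_
        simp only
        rw [lintegral_const_mul _ (by fun_prop)]
        gcongr
        exact hM x
    _ = (∫⁻ x, g x ^ 2) * M := lintegral_mul_const _ (by fun_prop)
    _ < ∞ := ENNReal.mul_lt_top hg.lintegral_sq_lt_top hMt

theorem coulombPairing_integrable (hg : CoulombBounded g) {ρ σ : Space → ℝ}
    (hρ : DominatedDensity g ρ) (hσ : DominatedDensity g σ) :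
    Integrable fun p : Space × Space => ρ p.1 * σ p.2 / ‖p.1 - p.2‖ := by
  have h1 := hρ.measurable
  have h2 := hσ.measurable
  refine ⟨(by fun_prop : Measurable _).aestronglyMeasurable, ?_⟩
  refine lt_of_le_of_lt (lintegral_mono fun p => ?_) hg.lintegral_prod_lt_top
  rw [enorm_div_norm, enorm_mul, mul_assoc]
  gcongr
  exacts [hρ.bound _, hσ.bound _]

theorem exchangePairing_integrable (hg : CoulombBounded g)
    {K K' : Space → Space → Matrix (Fin 4) (Fin 4) ℂ}
    (hK : DominatedKernel g K) (hK' : DominatedKernel g K') :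
    Integrable fun p : Space × Space =>
      (∑ s, ∑ t, (starRingEnd ℂ) (K p.1 p.2 s t) * K' p.1 p.2 s t) / (‖p.1 - p.2‖ : ℂ) := by
  refine ⟨Measurable.aestronglyMeasurable ?_, ?_⟩
  · refine Measurable.div ?_ (Complex.continuous_ofReal.measurable.comp (by fun_prop))
    refine Finset.measurable_fun_sum _ fun s _ => Finset.measurable_fun_sum _ fun t _ => ?_
    exact (Complex.continuous_conj.measurable.comp (hK.measurable s t)).mul (hK'.measurable s t)
  · have h := ENNReal.mul_lt_top (a := 16) (by simp) hg.lintegral_prod_lt_top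
    rw [← lintegral_const_mul' _ _ (by simp)] at h
    refine lt_of_le_of_lt (lintegral_mono fun p => ?_) h
    change ‖(∑ s, ∑ t, (starRingEnd ℂ) (K p.1 p.2 s t) * K' p.1 p.2 s t) /
      (‖p.1 - p.2‖ : ℂ)‖ₑ ≤ _
    rw [div_eq_mul_inv, enorm_mul]
    have h1 : ‖((‖p.1 - p.2‖ : ℝ) : ℂ)⁻¹‖ₑ = ENNReal.ofReal ‖p.1 - p.2‖⁻¹ := by
      rw [← ofReal_norm, norm_inv, Complex.norm_real, norm_norm]
    rw [h1]
    calc _ ≤ (∑ s : Fin 4, ∑ t : Fin 4, (g p.1 * g p.2) * (g p.1 * g p.2)) *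
          ENNReal.ofReal ‖p.1 - p.2‖⁻¹ := by
          gcongr
          refine (enorm_sum_le _ _).trans (Finset.sum_le_sum fun s _ => ?_)
          refine (enorm_sum_le _ _).trans (Finset.sum_le_sum fun t _ => ?_)
          rw [enorm_mul, RCLike.enorm_conj]
          gcongr
          exacts [hK.bound _ _ s t, hK'.bound _ _ s t]
      _ = _ := by
          simp only [Finset.sum_const, Finset.card_univ, Fintype.card_fin, nsmul_eq_mul]
          push_cast
          ring

/-- Fubini. Integrals over the product space depend only on almost-everywhere classes of pairs and
are symmetric under the swap, which the variation below relies on. -/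
theorem coulombProduct_eq (hg : CoulombBounded g) {ρ σ : Space → ℝ}
    (hρ : DominatedDensity g ρ) (hσ : DominatedDensity g σ) :
    coulombProduct ρ σ = 1 / 2 * coulombPairing ρ σ := by
  rw [coulombProduct, coulombPairing, Measure.volume_eq_prod, integral_prod]
  exact coulombPairing_integrable hg hρ hσ

theorem exchangeProduct_eq (hg : CoulombBounded g) {γ γ' : Hil →L[ℂ] Hil}
    (hK : DominatedKernel g (kernel γ)) (hK' : DominatedKernel g (kernel γ')) :
    exchangeProduct γ γ' = 1 / 2 * (exchangePairing (kernel γ) (kernel γ')).re := by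
  rw [exchangeProduct, exchangePairing, Measure.volume_eq_prod, integral_prod]
  exact exchangePairing_integrable hg hK hK'

theorem coulombPairing_comm (ρ σ : Space → ℝ) : coulombPairing ρ σ = coulombPairing σ ρ := by
  rw [coulombPairing, coulombPairing, Measure.volume_eq_prod, ← integral_prod_swap]
  refine integral_congr_ae (.of_forall fun p => ?_)
  simp only [Prod.fst_swap, Prod.snd_swap]
  rw [norm_sub_rev, mul_comm]

theorem exchangePairing_conj_symm (K K' : Space → Space → Matrix (Fin 4) (Fin 4) ℂ) :
    (starRingEnd ℂ) (exchangePairing K' K) = exchangePairing K K' := by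
  rw [exchangePairing, exchangePairing, ← integral_conj]
  refine integral_congr_ae (.of_forall fun p => ?_)
  simp only [map_div₀, map_sum, map_mul, Complex.conj_conj, Complex.conj_ofReal]
  simp only [mul_comm]

theorem exchangePairing_adjoint (K K' : Space → Space → Matrix (Fin 4) (Fin 4) ℂ) :
    exchangePairing (fun x y => (K y x).conjTranspose) (fun x y => (K' y x).conjTranspose) =
      exchangePairing K' K := by
  rw [exchangePairing, exchangePairing, Measure.volume_eq_prod, ← integral_prod_swap]
  refine integral_congr_ae (.of_forall fun p => ?_)
  simp only [Prod.fst_swap, Prod.snd_swap, Matrix.conjTranspose_apply, RCLike.star_def,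
    Complex.conj_conj]
  rw [norm_sub_rev, Finset.sum_comm]
  simp only [mul_comm]

theorem ae_prod_of_ae {P : Space → Prop} (h : ∀ᵐ x, P x) :
    ∀ᵐ p : Space × Space, P p.1 ∧ P p.2 :=
  (Measure.quasiMeasurePreserving_fst.ae h).and (Measure.quasiMeasurePreserving_snd.ae h)

/-- Used with the three densities that make up the density of a rotated frame, to exhibit the energy
as a polynomial in the trigonometric coefficients. -/
theorem coulombPairing_sum (hg : CoulombBounded g) {ι : Type*} [Fintype ι] {ρ : ι → Space → ℝ}
    (hρ : ∀ i, DominatedDensity g (ρ i)) (c : ι → ℝ) {σ : Space → ℝ}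
    (hσ : ∀ᵐ x, σ x = ∑ i, c i * ρ i x) :
    coulombPairing σ σ = ∑ i, ∑ j, c i * c j * coulombPairing (ρ i) (ρ j) := by
  have hI := fun i j => (coulombPairing_integrable hg (hρ i) (hρ j)).const_mul (c i * c j)
  calc coulombPairing σ σ = ∫ p : Space × Space, ∑ i, ∑ j,
        c i * c j * (ρ i p.1 * ρ j p.2 / ‖p.1 - p.2‖) := by
        refine integral_congr_ae ?_
        filter_upwards [ae_prod_of_ae hσ] with p hp
        rw [hp.1, hp.2, Finset.sum_mul_sum, Finset.sum_div]
        refine Finset.sum_congr rfl fun i _ => ?_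
        rw [Finset.sum_div]
        exact Finset.sum_congr rfl fun j _ => by ring
    _ = _ := by
        rw [integral_finsetSum _ fun i _ => integrable_finsetSum _ fun j _ => hI i j]
        refine Finset.sum_congr rfl fun i _ => ?_
        rw [integral_finsetSum _ fun j _ => hI i j]
        exact Finset.sum_congr rfl fun j _ => integral_const_mul _ _

theorem sum_sum_comm {ι κ : Type*} [Fintype ι] [Fintype κ] (f : κ → κ → ι → ι → ℂ) :
    ∑ s, ∑ t, ∑ i, ∑ j, f s t i j = ∑ i, ∑ j, ∑ s, ∑ t, f s t i j := by
  calc _ = ∑ s, ∑ i, ∑ t, ∑ j, f s t i j := Finset.sum_congr rfl fun s _ => Finset.sum_comm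
    _ = ∑ i, ∑ s, ∑ t, ∑ j, f s t i j := Finset.sum_comm
    _ = ∑ i, ∑ s, ∑ j, ∑ t, f s t i j :=
        Finset.sum_congr rfl fun i _ => Finset.sum_congr rfl fun s _ => Finset.sum_comm
    _ = _ := Finset.sum_congr rfl fun i _ => Finset.sum_comm

theorem exchangePairing_sum (hg : CoulombBounded g) {ι : Type*} [Fintype ι]
    {K : ι → Space → Space → Matrix (Fin 4) (Fin 4) ℂ} (hK : ∀ i, DominatedKernel g (K i))
    (c : ι → ℝ) {L : Space → Space → Matrix (Fin 4) (Fin 4) ℂ}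
    (hL : ∀ᵐ p : Space × Space, ∀ s t, L p.1 p.2 s t = ∑ i, (c i : ℂ) * K i p.1 p.2 s t) :
    exchangePairing L L = ∑ i, ∑ j, ((c i * c j : ℝ) : ℂ) * exchangePairing (K i) (K j) := by
  have hI := fun i j => (exchangePairing_integrable hg (hK i) (hK j)).const_mul
    ((c i * c j : ℝ) : ℂ)
  calc exchangePairing L L = ∫ p : Space × Space, ∑ i, ∑ j, ((c i * c j : ℝ) : ℂ) *
        ((∑ s, ∑ t, (starRingEnd ℂ) (K i p.1 p.2 s t) * K j p.1 p.2 s t) /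
          (‖p.1 - p.2‖ : ℂ)) := by
        refine integral_congr_ae ?_
        filter_upwards [hL] with p hp
        simp only [hp, map_sum, map_mul, Complex.conj_ofReal, Finset.sum_mul_sum]
        rw [sum_sum_comm, Finset.sum_div]
        refine Finset.sum_congr rfl fun i _ => ?_
        rw [Finset.sum_div]
        refine Finset.sum_congr rfl fun j _ => ?_
        rw [← mul_div_assoc]
        congr 1
        simp only [Finset.mul_sum]
        refine Finset.sum_congr rfl fun s _ => Finset.sum_congr rfl fun t _ => ?_
        push_cast
        ring
    _ = _ := by
        rw [integral_finsetSum _ fun i _ => integrable_finsetSum _ fun j _ => hI i j]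
        refine Finset.sum_congr rfl fun i _ => ?_
        rw [integral_finsetSum _ fun j _ => hI i j]
        exact Finset.sum_congr rfl fun j _ => integral_const_mul _ _

end Pairing

/-! ### The form of the Dirac-Fock operator -/

/-- The integral kernel `φ(x) ψ(y)*` of the operator `|φ⟩⟨ψ|`. -/
def rankOneKernel (φ ψ : Hil) (x y : Space) : Matrix (Fin 4) (Fin 4) ℂ :=
  Matrix.of fun s t => φ x s * (starRingEnd ℂ) (ψ y t)

theorem dominatedKernel_rankOne {g : Space → ℝ≥0∞} {φ ψ : Hil} (hφ : ∀ x, ‖φ x‖ₑ ≤ g x)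
    (hψ : ∀ x, ‖ψ x‖ₑ ≤ g x) : DominatedKernel g (rankOneKernel φ ψ) := by
  refine ⟨fun s t => ?_, fun x y s t => ?_⟩
  · exact ((measurable_eval φ s).comp measurable_fst).mul
      (Complex.continuous_conj.measurable.comp ((measurable_eval ψ t).comp measurable_snd))
  · rw [rankOneKernel, Matrix.of_apply, enorm_mul, RCLike.enorm_conj]
    gcongr
    exacts [(enorm_eval_le _ _).trans (hφ x), (enorm_eval_le _ _).trans (hψ y)]

theorem kernel_conjTranspose (δ : Hil →L[ℂ] Hil) (x y : Space) :
    (kernel δ y x).conjTranspose = kernel δ x y := by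
  ext s t
  simp only [kernel, Matrix.conjTranspose_apply, Matrix.of_apply, RCLike.star_def]
  rw [Complex.conj_tsum]
  refine tsum_congr fun n => ?_
  simp only [map_mul, Complex.conj_ofReal, Complex.conj_conj]
  ring

theorem rankOneKernel_conjTranspose (φ ψ : Hil) (x y : Space) :
    (rankOneKernel φ ψ y x).conjTranspose = rankOneKernel ψ φ x y := by
  ext s t
  simp only [rankOneKernel, Matrix.conjTranspose_apply, Matrix.of_apply, RCLike.star_def,
    map_mul, Complex.conj_conj]
  ring

/-- The kernel of δ is Hermitian by its eigenfunction expansion, and taking adjoints exchanges φ and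
ψ in the rank-one kernel. -/
theorem exchangePairing_rankOne_conj_symm (δ : Hil →L[ℂ] Hil) (φ ψ : Hil) :
    (starRingEnd ℂ) (exchangePairing (rankOneKernel ψ φ) (kernel δ)) =
      exchangePairing (rankOneKernel φ ψ) (kernel δ) := by
  rw [exchangePairing_conj_symm, ← exchangePairing_adjoint]
  congr 1 <;> funext x y
  exacts [rankOneKernel_conjTranspose _ _ _ _, kernel_conjTranspose _ _ _]

/-- The sesquilinear form of the Dirac-Fock operator `D^{(γ)}`. -/
def fockSesq (m α Z : ℝ) (γ : Hil →L[ℂ] Hil) (φ ψ : Hil) : ℂ :=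
  diracSesq m α Z φ ψ + (α : ℂ) * (mulForm (realMul (directPotential γ)) φ ψ -
    exchangePairing (rankOneKernel φ ψ) (kernel γ))

section FockSesq

variable {m : ℝ} (α Z : ℝ) {γ : Hil →L[ℂ] Hil}

theorem fockSesq_conj_symm (φ ψ : Hil) :
    (starRingEnd ℂ) (fockSesq m α Z γ ψ φ) = fockSesq m α Z γ φ ψ := by
  simp only [fockSesq, map_add, map_mul, map_sub, Complex.conj_ofReal]
  rw [diracSesq_conj_symm, mulForm_conj_symm (realMul_inner _), exchangePairing_rankOne_conj_symm]

/-- Fubini, with |φ| + |ψ| + `amplitude γ` as the common dominating amplitude; this is where both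
vectors are required to be in H^{1/2}. -/
theorem inner_exchange (hm : 0 < m) (hγ : MemF m γ) {φ ψ : Hil} (hφ : φ ∈ formDomain m)
    (hψ : ψ ∈ formDomain m) (h : ψ ∈ (exchange γ).domain) :
    ⟪φ, exchange γ ⟨ψ, h⟩⟫_ℂ = exchangePairing (rankOneKernel φ ψ) (kernel γ) := by
  have hg : CoulombBounded fun x => ‖φ x‖ₑ + ‖ψ x‖ₑ + amplitude γ x :=
    ((coulombBounded_enorm hφ).add (coulombBounded_enorm hψ)).add (coulombBounded_amplitude hm hγ)
  have hK : DominatedKernel (fun x => ‖φ x‖ₑ + ‖ψ x‖ₑ + amplitude γ x) (kernel γ) :=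
    ⟨(dominatedKernel_kernel γ).measurable, fun x y s t =>
      ((dominatedKernel_kernel γ).bound x y s t).trans (mul_le_mul' le_add_self le_add_self)⟩
  have hR := dominatedKernel_rankOne (g := fun x => ‖φ x‖ₑ + ‖ψ x‖ₑ + amplitude γ x)
    (φ := φ) (ψ := ψ) (fun x => le_self_add.trans le_self_add)
    (fun x => le_add_self.trans le_self_add)
  have hI := exchangePairing_integrable hg hR hK
  rw [L2.inner_def, exchangePairing, Measure.volume_eq_prod, integral_prod _ hI]
  refine integral_congr_ae ?_
  have h1 : (exchange γ ⟨ψ, h⟩ : Hil) =ᵐ[volume] exchangeFun γ ψ := MemLp.coeFn_toLp h.2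
  filter_upwards [h1, h.1] with x hx hx'
  rw [hx, exchangeFun, ← integral_inner hx']
  refine integral_congr_ae (.of_forall fun y => ?_)
  simp only [exchangeIntegrand, inner_smul_right, PiLp.inner_apply, RCLike.inner_apply,
    rankOneKernel, Matrix.of_apply, map_mul, Complex.conj_conj, Matrix.ofLp_toEuclideanCLM,
    Matrix.mulVec, dotProduct, Finset.sum_mul]
  rw [div_eq_mul_inv, mul_comm]
  push_cast
  congr 1
  refine Finset.sum_congr rfl fun s _ => Finset.sum_congr rfl fun t _ => ?_
  ring

theorem inner_diracFock (hm : 0 < m) (hγ : MemF m γ) {φ : Hil} (hφ : φ ∈ formDomain m)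
    (ψ : (diracFock m α Z γ).domain) :
    ⟪φ, diracFock m α Z γ ψ⟫_ℂ = fockSesq m α Z γ φ ψ := by
  have hψ : (ψ : Hil) ∈ formDomain m := diracFree_domain_le m ψ.2.1.1
  have h0 : diracFock m α Z γ ψ = diracCoulomb m α Z ⟨ψ, ψ.2.1⟩ + (α : ℂ) •
    (potential (directPotential γ) ⟨ψ, ψ.2.2.1⟩ - exchange γ ⟨ψ, ψ.2.2.2⟩) := rfl
  rw [h0, inner_add_right, inner_smul_right, inner_sub_right, inner_diracCoulomb,
    inner_exchange hm hγ hφ hψ, fockSesq]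
  congr 3
  exact inner_mulOp _ _ _

/-- The mean field acts as an everywhere defined operator, so linearity of the form reduces to that
of the Coulomb-Dirac form. Forms for different mean fields can also be compared in this way. -/
theorem fockSesq_eq (hm : 0 < m) (hγ : MemF m γ) {φ ψ : Hil} (hφ : φ ∈ formDomain m)
    (hψ : ψ ∈ formDomain m) (h : ψ ∈ (meanField γ).domain) :
    fockSesq m α Z γ φ ψ = diracSesq m α Z φ ψ + (α : ℂ) * ⟪φ, meanField γ ⟨ψ, h⟩⟫_ℂ := by
  have h0 : meanField γ ⟨ψ, h⟩ =
    potential (directPotential γ) ⟨ψ, h.1⟩ - exchange γ ⟨ψ, h.2⟩ := rfl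
  rw [h0, inner_sub_right, inner_exchange hm hγ hφ hψ, fockSesq]
  congr 3
  exact (inner_mulOp (realMul (directPotential γ)) φ ⟨ψ, h.1⟩).symm

theorem fockSesq_add_right (hm : 0 < m) (hγ : MemF m γ) {φ ψ χ : Hil} (hφ : φ ∈ formDomain m)
    (hψ : ψ ∈ formDomain m) (hχ : χ ∈ formDomain m) :
    fockSesq m α Z γ φ (ψ + χ) = fockSesq m α Z γ φ ψ + fockSesq m α Z γ φ χ := by
  have hd : ∀ ψ, ψ ∈ (meanField γ).domain := fun ψ => by rw [meanField_domain hm hγ]; trivial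
  have h1 : meanField γ ⟨ψ + χ, hd _⟩ = meanField γ ⟨ψ, hd _⟩ + meanField γ ⟨χ, hd _⟩ :=
    LinearPMap.map_add _ ⟨ψ, hd _⟩ ⟨χ, hd _⟩
  rw [fockSesq_eq α Z hm hγ hφ hψ (hd _), fockSesq_eq α Z hm hγ hφ hχ (hd _),
    fockSesq_eq α Z hm hγ hφ (add_mem hψ hχ) (hd _), h1, inner_add_right,
    diracSesq_add_right α Z hφ hψ hχ]
  ring

theorem fockSesq_smul_right (hm : 0 < m) (hγ : MemF m γ) (c : ℂ) {φ ψ : Hil}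
    (hφ : φ ∈ formDomain m) (hψ : ψ ∈ formDomain m) :
    fockSesq m α Z γ φ (c • ψ) = c * fockSesq m α Z γ φ ψ := by
  have hd : ∀ ψ, ψ ∈ (meanField γ).domain := fun ψ => by rw [meanField_domain hm hγ]; trivial
  have h1 : meanField γ ⟨c • ψ, hd _⟩ = c • meanField γ ⟨ψ, hd _⟩ :=
    LinearPMap.map_smul _ c ⟨ψ, hd _⟩
  rw [fockSesq_eq α Z hm hγ hφ hψ (hd _), fockSesq_eq α Z hm hγ hφ
    (Submodule.smul_mem _ c hψ) (hd _), h1, inner_smul_right, diracSesq_smul_right]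
  ring

end FockSesq

/-! ### Finite-rank projections -/

theorem sqrtAbs_of_isStarProjection {H : Type*} [NormedAddCommGroup H] [InnerProductSpace ℂ H]
    [CompleteSpace H] {p : H →L[ℂ] H} (hp : IsStarProjection p) : sqrtAbs p = p := by
  have h : CFC.sqrt p = p := CFC.sqrt_unique hp.isIdempotentElem hp.nonneg
  rw [sqrtAbs, CFC.abs, hp.isSelfAdjoint.star_eq, hp.isIdempotentElem.eq, h, h]

section FrameProj

variable {r : ℕ}

/-- The operator `∑ᵢ |uᵢ⟩⟨uᵢ|`. -/
def frameProj (u : Fin r → Hil) : Hil →L[ℂ] Hil :=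
  ∑ i, (innerSL ℂ (u i)).smulRight (u i)

theorem frameProj_apply (u : Fin r → Hil) (x : Hil) :
    frameProj u x = ∑ i, ⟪u i, x⟫_ℂ • u i := by
  simp [frameProj, sum_apply]

variable {u : Fin r → Hil}

theorem frameProj_self (hu : Orthonormal ℂ u) (i : Fin r) : frameProj u (u i) = u i := by
  rw [frameProj_apply]
  simp [orthonormal_iff_ite.1 hu]

theorem frameProj_inner_left (u : Fin r → Hil) (x y : Hil) :
    ⟪frameProj u x, y⟫_ℂ = ⟪x, frameProj u y⟫_ℂ := by
  rw [frameProj_apply, frameProj_apply, sum_inner, inner_sum]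
  refine Finset.sum_congr rfl fun i _ => ?_
  rw [inner_smul_left, inner_smul_right, inner_conj_symm, mul_comm]

theorem isStarProjection_frameProj (hu : Orthonormal ℂ u) : IsStarProjection (frameProj u) := by
  refine ⟨?_, ?_⟩
  · ext1 x
    change frameProj u (frameProj u x) = frameProj u x
    rw [frameProj_apply u x, map_sum]
    simp only [map_smul, frameProj_self hu]
  · rw [ContinuousLinearMap.isSelfAdjoint_iff_isSymmetric]
    exact frameProj_inner_left u

theorem frameProj_le {P : Hil →L[ℂ] Hil} (hP : IsStarProjection P) (hu : Orthonormal ℂ u)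
    (h : ∀ i, P (u i) = u i) : frameProj u ≤ P := by
  refine (isStarProjection_frameProj hu).le_of_mul_eq_right hP ?_
  ext1 x
  change P (frameProj u x) = frameProj u x
  rw [frameProj_apply, map_sum]
  simp only [map_smul, h]

theorem freeEnergy_sum_le (m : ℝ) {ι : Type*} (s : Finset ι) (f : ι → Hil) :
    freeEnergy m (∑ i ∈ s, f i) ≤ 2 ^ s.card * ∑ i ∈ s, freeEnergy m (f i) := by
  classical
  induction s using Finset.induction_on with
  | empty =>
    have := freeEnergy_smul m 0 0
    simp only [zero_smul, enorm_zero, ne_eq, OfNat.ofNat_ne_zero, not_false_eq_true, zero_pow,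
      zero_mul] at this
    simp [this]
  | insert a s ha ih =>
    rw [Finset.sum_insert ha, Finset.sum_insert ha, Finset.card_insert_of_notMem ha]
    refine (freeEnergy_add_le m _ _).trans ?_
    rw [mul_add, pow_succ]
    refine add_le_add ?_ ?_
    · gcongr
      exact le_mul_of_one_le_left (by simp) (one_le_pow₀ (by norm_num))
    · calc _ ≤ 2 * (2 ^ s.card * ∑ i ∈ s, freeEnergy m (f i)) := by gcongr
        _ = _ := by ring

/-- A projection equals its own |·|^{1/2}. The energies of the uᵢ bound the norm because Bessel's
inequality gives ∑ |⟨uᵢ, e⟩|² ≤ 1 over any orthonormal set; the factor 2^r comes from repeated use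
of the crude estimate `freeEnergy_add_le`. -/
theorem memF_frameProj {m : ℝ} (hu : Orthonormal ℂ u) (huF : ∀ i, u i ∈ formDomain m) :
    MemF m (frameProj u) := by
  have hp := isStarProjection_frameProj hu
  refine ⟨hp.isSelfAdjoint, ?_⟩
  have hsqrt : sqrtAbs (frameProj u) = frameProj u :=
    sqrtAbs_of_isStarProjection hp
  have hlt : 2 ^ r * ∑ i, freeEnergy m (u i) < ∞ :=
    ENNReal.mul_lt_top (by simp) (ENNReal.sum_lt_top.2 fun i _ => huF i)
  refine lt_of_le_of_lt (iSup₂_le fun s hs => ?_) hlt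
  calc ∑ e ∈ s, freeEnergy m (sqrtAbs (frameProj u) e)
      ≤ ∑ e ∈ s, 2 ^ r * ∑ i, ‖⟪u i, e⟫_ℂ‖ₑ ^ 2 * freeEnergy m (u i) := by
        refine Finset.sum_le_sum fun e _ => ?_
        rw [hsqrt, frameProj_apply]
        refine (freeEnergy_sum_le m _ _).trans (le_of_eq ?_)
        simp only [freeEnergy_smul, Finset.card_univ, Fintype.card_fin]
    _ = 2 ^ r * ∑ i, (∑ e ∈ s, ‖⟪u i, e⟫_ℂ‖ₑ ^ 2) * freeEnergy m (u i) := by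
        rw [← Finset.mul_sum, Finset.sum_comm]
        simp only [Finset.sum_mul]
    _ ≤ 2 ^ r * ∑ i, freeEnergy m (u i) := by
        gcongr with i
        refine mul_le_of_le_one_left (by simp) ?_
        have h := hs.sum_inner_products_le (u i) (s := Finset.univ)
        rw [hu.1 i, one_pow, Finset.univ_eq_attach,
          Finset.sum_attach s fun e => ‖⟪e, u i⟫_ℂ‖ ^ 2] at h
        simp only [← ofReal_norm, ← ENNReal.ofReal_pow (norm_nonneg _)]
        rw [← ENNReal.ofReal_sum_of_nonneg fun _ _ => by positivity, ENNReal.ofReal_le_one]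
        simpa only [norm_inner_symm] using h

/-- Each vector of an orthonormal basis of the range is fixed by |γ|^{1/2} and contributes at least
m to ‖γ‖_F, so there are at most ‖γ‖_F / m of them, each of finite free energy. -/
theorem exists_eq_frameProj {m : ℝ} (hm : 0 < m) {γ : Hil →L[ℂ] Hil} (hγ : IsStarProjection γ)
    (hF : MemF m γ) : ∃ (r : ℕ) (u : Fin r → Hil), Orthonormal ℂ u ∧
      (∀ i, u i ∈ formDomain m) ∧ γ = frameProj u := by
  have hinner : ∀ x y, ⟪γ x, y⟫_ℂ = ⟪x, γ y⟫_ℂ := fun x y => hγ.isSelfAdjoint.isSymmetric x y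
  set K : Submodule ℂ Hil := LinearMap.range (γ : Hil →ₗ[ℂ] Hil) with hK
  have hγγ : ∀ x, γ (γ x) = γ x := fun x =>
    congrArg (fun T : Hil →L[ℂ] Hil => T x) hγ.isIdempotentElem.eq
  have hKmem : ∀ x, x ∈ K ↔ γ x = x := fun x =>
    ⟨fun ⟨y, hy⟩ => by
      have hy' : γ y = x := hy
      rw [← hy', hγγ], fun h => ⟨x, h⟩⟩
  have hsq : ∀ x ∈ K, sqrtAbs γ x = x := fun x hx => by
    have := sqrtAbs_apply_of_eigenvector hγ.isSelfAdjoint (e := x) (c := 1)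
      (by simpa using (hKmem x).1 hx)
    simpa using this
  have hclosed : IsClosed (K : Set Hil) := by
    have : (K : Set Hil) = {x | γ x = x} := Set.ext hKmem
    rw [this]
    exact isClosed_eq γ.continuous continuous_id
  have : CompleteSpace K := hclosed.completeSpace_coe
  obtain ⟨w, b, hb⟩ := exists_hilbertBasis ℂ K
  have hon : Orthonormal ℂ fun i : w => ((b i : K) : Hil) :=
    b.orthonormal.comp_linearIsometry K.subtypeₗᵢ
  have hfin : Finite w := by
    by_contra hinf
    rw [not_finite_iff_infinite] at hinf
    have hN : ∀ N : ℕ, ENNReal.ofReal m * N ≤ normF m γ := by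
      intro N
      obtain ⟨s, hs⟩ := Infinite.exists_subset_card_eq w N
      refine le_trans ?_ (sum_freeEnergy_le_normF m γ s hon)
      calc ENNReal.ofReal m * N = ∑ i ∈ s, ENNReal.ofReal m * ‖((b i : K) : Hil)‖ₑ ^ 2 := by
            have : ∀ i, ‖((b i : K) : Hil)‖ₑ = 1 := fun i => by
              rw [← ofReal_norm, hon.1 i, ENNReal.ofReal_one]
            simp [this, hs, mul_comm]
        _ ≤ _ := by
            refine Finset.sum_le_sum fun i _ => ?_
            rw [hsq _ (b i).2]
            exact enorm_sq_le_freeEnergy m _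
    have hne : normF m γ / ENNReal.ofReal m ≠ ∞ :=
      ENNReal.div_ne_top hF.2.ne (by simpa using hm)
    obtain ⟨N, hN'⟩ := ENNReal.exists_nat_gt hne
    rw [ENNReal.div_lt_iff (Or.inl (by simpa using hm)) (Or.inl ENNReal.ofReal_ne_top),
      mul_comm] at hN'
    exact absurd (hN N) (not_le.2 hN')
  have := Fintype.ofFinite w
  set e := Fintype.equivFin w
  refine ⟨Fintype.card w, fun i => ((b (e.symm i) : K) : Hil), hon.comp _ e.symm.injective,
    fun i => ?_, ?_⟩
  · have h := sum_freeEnergy_le_normF m γ {e.symm i} hon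
    rw [Finset.sum_singleton, hsq _ (b (e.symm i)).2] at h
    exact h.trans_lt hF.2
  · ext1 x
    have h1 := b.toOrthonormalBasis.sum_repr' ⟨γ x, ⟨x, rfl⟩⟩
    have h2 := congrArg (fun y : K => (y : Hil)) h1
    simp only [AddSubmonoidClass.coe_finsetSum, Submodule.coe_smul, Submodule.coe_inner,
      HilbertBasis.coe_toOrthonormalBasis] at h2
    rw [frameProj_apply, ← h2, ← e.symm.sum_comp]
    refine Finset.sum_congr rfl fun i _ => ?_
    rw [← hinner, (hKmem _).1 (b (e.symm i)).2]

/-! ### Eigensystems of finite-rank projections -/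

/-- `EigenSystem` requires a basis indexed by ℕ, so infinite dimension has to be checked. Indicators
of disjoint balls of radius 1/2 around integer points of an axis are independent. -/
theorem not_finiteDimensional_hil : ¬ FiniteDimensional ℂ Hil := by
  intro hfd
  set a : ℕ → Space := fun n => EuclideanSpace.single 0 (n : ℝ) with ha
  have hd : ∀ i j, i ≠ j → 1 ≤ dist (a i) (a j) := by
    intro i j hij
    simp only [ha, PiLp.dist_single_same, Real.dist_eq]
    have h : (1 : ℤ) ≤ |(i : ℤ) - j| := Int.one_le_abs (sub_ne_zero.2 (by exact_mod_cast hij))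
    exact_mod_cast h
  set v : Spinor := EuclideanSpace.single 0 1 with hv
  have hv1 : ‖v‖ = 1 := by simp [hv]
  set f : ℕ → Hil := fun n => indicatorConstLp 2 (s := Metric.ball (a n) (1 / 2))
    Metric.isOpen_ball.measurableSet measure_ball_lt_top.ne v with hf
  have hli : LinearIndependent ℂ f := by
    refine linearIndependent_of_ne_zero_of_inner_eq_zero (fun n h0 => ?_) fun i j hij => ?_
    · have h1 : ‖f n‖ = 0 := by rw [h0, norm_zero]
      simp only [hf] at h1
      rw [norm_indicatorConstLp two_ne_zero ENNReal.ofNat_ne_top, hv1, one_mul] at h1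
      have h2 : 0 < volume.real (Metric.ball (a n) (1 / 2)) :=
        ENNReal.toReal_pos (Metric.measure_ball_pos _ _ (by norm_num)).ne' measure_ball_lt_top.ne
      exact (Real.rpow_pos_of_pos h2 _).ne' h1
    · simp only [hf]
      rw [L2.inner_indicatorConstLp_eq_setIntegral_inner]
      refine (setIntegral_congr_ae (g := fun _ => (0 : ℂ)) Metric.isOpen_ball.measurableSet ?_).trans
        (by simp)
      filter_upwards [indicatorConstLp_coeFn (p := 2) (s := Metric.ball (a j) (1 / 2))
        (hs := Metric.isOpen_ball.measurableSet) (hμs := measure_ball_lt_top.ne) (c := v)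
        (μ := (volume : Measure Space))] with x hx hxi
      rw [hx, Set.indicator_of_notMem, inner_zero_right]
      intro hxj
      have h1 := hd i j hij
      have h2 := dist_triangle_left (a i) (a j) x
      rw [Metric.mem_ball] at hxi hxj
      linarith
  exact not_finite_iff_infinite.2 inferInstance hli.finite

/-- Distinct orthonormal vectors are √2 apart, so balls of radius 1/2 around them are disjoint, and
L² is separable. -/
theorem countable_of_orthonormal {w : Set Hil} (hw : Orthonormal ℂ ((↑) : w → Hil)) :
    w.Countable := by
  have : Fact ((2 : ℝ≥0∞) ≠ ∞) := ⟨ENNReal.ofNat_ne_top⟩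
  refine Set.PairwiseDisjoint.countable_of_isOpen (s := fun x : Hil => Metric.ball x (1 / 2))
    (fun x hx y hy hxy => ?_) (fun x _ => Metric.isOpen_ball)
    (fun x _ => Metric.nonempty_ball.2 (by norm_num))
  refine Metric.ball_disjoint_ball ?_
  have h0 : ⟪x, y⟫_ℂ = 0 := hw.2 (i := ⟨x, hx⟩) (j := ⟨y, hy⟩) (fun h => hxy (by simpa using h))
  have h1 : ‖x‖ = 1 := hw.1 ⟨x, hx⟩
  have h2 : ‖y‖ = 1 := hw.1 ⟨y, hy⟩
  have h3 := @norm_sub_sq ℂ Hil _ _ _ x y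
  rw [h0, h1, h2] at h3
  rw [dist_eq_norm]
  simp only [map_zero] at h3
  nlinarith [norm_nonneg (x - y)]

/-- The frame extends to a Hilbert basis, countably infinite by the two preceding lemmas. The
projection is diagonal in it: 1 on the frame, 0 on the added vectors. -/
theorem nonempty_eigenSystem_frameProj (hu : Orthonormal ℂ u) :
    Nonempty (EigenSystem (frameProj u)) := by
  obtain ⟨w, b, hsw, hb⟩ := hu.toSubtypeRange.exists_hilbertBasis_extension
  have hw : Orthonormal ℂ ((↑) : w → Hil) := hb ▸ b.orthonormal
  have hinf : Infinite w := by
    rw [← not_finite_iff_infinite]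
    intro hfin
    have := Fintype.ofFinite w
    exact not_finiteDimensional_hil b.toOrthonormalBasis.toBasis.finiteDimensional_of_finite
  have := (countable_of_orthonormal hw).to_subtype
  obtain ⟨e⟩ : Nonempty (ℕ ≃ w) := nonempty_equiv_of_countable
  have hon : Orthonormal ℂ fun n => b (e n) := b.orthonormal.comp e e.injective
  have hsp : ⊤ ≤ (Submodule.span ℂ (Set.range fun n => b (e n))).topologicalClosure := by
    have : Set.range (fun n => b (e n)) = Set.range b := e.surjective.range_comp b
    rw [this, b.dense_span]
  classical
  refine ⟨⟨HilbertBasis.mk hon hsp, fun n => if (e n : Hil) ∈ Set.range u then 1 else 0,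
    fun n => ?_⟩⟩
  rw [HilbertBasis.coe_mk]
  simp only [hb]
  split_ifs with h
  · obtain ⟨i, hi⟩ := h
    rw [← hi, frameProj_self hu]
    simp
  · rw [frameProj_apply, Finset.sum_eq_zero fun i _ => ?_]
    · simp
    · have h1 : ⟪u i, (e n : Hil)⟫_ℂ = 0 :=
        hw.2 (i := ⟨u i, hsw ⟨i, rfl⟩⟩) (j := e n) fun hc => h ⟨i, by rw [← hc]⟩
      rw [h1, zero_smul]

/-- The chosen eigenvectors of `∑ᵢ |uᵢ⟩⟨uᵢ|` with eigenvalue `1` are related to the `uᵢ` by a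
unitary matrix. -/
theorem exists_eigen_expansion (hu : Orthonormal ℂ u) : ∃ (S : Finset ℕ) (c : Fin r → ℕ → ℂ),
    (∀ n ∈ S, eigenvalue (frameProj u) n = 1 ∧
      eigenvector (frameProj u) n = ∑ i, c i n • u i) ∧
    (∀ n ∉ S, eigenvalue (frameProj u) n = 0) ∧
    ∀ i j, ∑ n ∈ S, c i n * (starRingEnd ℂ) (c j n) = if i = j then 1 else 0 := by
  have hne := nonempty_eigenSystem_frameProj hu
  set E := hne.some with hE
  have hval : ∀ n, eigenvalue (frameProj u) n = E.eigenvalue n := fun n => by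
    rw [eigenvalue, dif_pos hne]
  have hvec : ∀ n, eigenvector (frameProj u) n = E.basis n := fun n => by
    rw [eigenvector, dif_pos hne]
  set c : Fin r → ℕ → ℂ := fun i n => ⟪u i, E.basis n⟫_ℂ with hc
  have hinner : ∀ i n, c i n = (E.eigenvalue n : ℂ) * c i n := fun i n => by
    have h1 := frameProj_inner_left u (u i) (E.basis n)
    rw [frameProj_self hu, E.apply_basis, inner_smul_right] at h1
    exact h1
  have hexp : ∀ n, (E.eigenvalue n : ℂ) • E.basis n = ∑ i, c i n • u i := fun n => by
    rw [← E.apply_basis, frameProj_apply]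
  have h01 : ∀ n, E.eigenvalue n = 1 ∨ E.eigenvalue n = 0 := by
    intro n
    by_contra! hcon
    have hz : ∀ i, c i n = 0 := fun i => by
      have h1 : (1 - (E.eigenvalue n : ℂ)) * c i n = 0 := by
        linear_combination hinner i n
      refine (mul_eq_zero.1 h1).resolve_left fun h => hcon.1 ?_
      exact_mod_cast (sub_eq_zero.1 h).symm
    have h2 := hexp n
    simp only [hz, zero_smul, Finset.sum_const_zero, smul_eq_zero] at h2
    rcases h2 with h2 | h2
    · exact hcon.2 (by exact_mod_cast h2)
    · have := E.basis.orthonormal.1 n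
      rw [h2, norm_zero] at this
      exact zero_ne_one this
  -- Eigenvectors for the eigenvalue 1 are independent vectors in the finite-dimensional span of the
  -- frame.
  have hfin : {n | E.eigenvalue n = 1}.Finite := by
    have hli : LinearIndependent ℂ fun n : {n | E.eigenvalue n = 1} => E.basis n :=
      E.basis.orthonormal.linearIndependent.comp _ Subtype.val_injective
    set W := Submodule.span ℂ (Set.range u)
    have hW : ∀ n : {n | E.eigenvalue n = 1}, E.basis n ∈ W := fun n => by
      have h1 := hexp n
      rw [show E.eigenvalue n = 1 from n.2, Complex.ofReal_one, one_smul] at h1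
      rw [h1]
      exact W.sum_mem fun i _ => W.smul_mem _ (Submodule.subset_span ⟨i, rfl⟩)
    have hli' : LinearIndependent ℂ fun n : {n | E.eigenvalue n = 1} => (⟨_, hW n⟩ : W) :=
      LinearIndependent.of_comp W.subtype hli
    have : FiniteDimensional ℂ W := FiniteDimensional.span_of_finite ℂ (Set.finite_range u)
    exact hli'.finite
  refine ⟨hfin.toFinset, c, fun n hn => ?_, fun n hn => ?_, fun i j => ?_⟩
  · have h1 : E.eigenvalue n = 1 := by simpa using hn
    have h2 := hexp n
    rw [h1, Complex.ofReal_one, one_smul] at h2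
    exact ⟨by rw [hval, h1], by rw [hvec, h2]⟩
  · rw [hval]
    exact (h01 n).resolve_left (by simpa using hn)
  -- Parseval for ⟨uᵢ, uⱼ⟩; eigenvectors with eigenvalue 0 are orthogonal to the frame, so only the
  -- indices with eigenvalue 1 contribute.
  · have h1 := E.basis.hasSum_inner_mul_inner (u i) (u j)
    have h2 : HasSum (fun n => ⟪u i, E.basis n⟫_ℂ * ⟪E.basis n, u j⟫_ℂ)
        (∑ n ∈ hfin.toFinset, c i n * (starRingEnd ℂ) (c j n)) := by
      have h3 := hasSum_sum_of_ne_finset_zero (L := SummationFilter.unconditional ℕ)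
        (s := hfin.toFinset) (f := fun n => ⟪u i, E.basis n⟫_ℂ * ⟪E.basis n, u j⟫_ℂ) (by
          intro n hn
          have h4 : E.eigenvalue n = 0 := (h01 n).resolve_left (by simpa using hn)
          have h5 := hinner i n
          rw [h4, Complex.ofReal_zero, zero_mul] at h5
          rw [show ⟪u i, E.basis n⟫_ℂ = 0 from h5, zero_mul])
      convert h3 using 3
      simp only [hc]
      rw [inner_conj_symm]
    rw [h2.unique h1]
    exact orthonormal_iff_ite.1 hu i j

theorem sum_expansion {S : Finset ℕ} {c : Fin r → ℕ → ℂ}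
    (hc : ∀ i j, ∑ n ∈ S, c i n * (starRingEnd ℂ) (c j n) = if i = j then 1 else 0)
    (D : Fin r → Fin r → ℂ) :
    ∑ n ∈ S, ∑ i, ∑ j, c i n * (starRingEnd ℂ) (c j n) * D i j = ∑ i, D i i := by
  rw [Finset.sum_comm]
  refine Finset.sum_congr rfl fun i _ => ?_
  rw [Finset.sum_comm]
  simp only [← Finset.sum_mul, hc, ite_mul, one_mul, zero_mul, Finset.sum_ite_eq,
    Finset.mem_univ, if_true]

end FrameProj

/-! ### Traces, kernels and densities of finite-rank projections -/

theorem sesq_sum_right {V : Submodule ℂ Hil} {B : Hil → Hil → ℂ}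
    (hadd : ∀ {φ ψ χ : Hil}, φ ∈ V → ψ ∈ V → χ ∈ V → B φ (ψ + χ) = B φ ψ + B φ χ)
    (hsmul : ∀ (c : ℂ) {φ ψ : Hil}, φ ∈ V → ψ ∈ V → B φ (c • ψ) = c * B φ ψ)
    {ι : Type*} (s : Finset ι) (c : ι → ℂ) {u : ι → Hil} (hu : ∀ i, u i ∈ V) {φ : Hil}
    (hφ : φ ∈ V) : B φ (∑ i ∈ s, c i • u i) = ∑ i ∈ s, c i * B φ (u i) := by
  classical
  induction s using Finset.induction_on with
  | empty =>
    have := hsmul 0 hφ (V.zero_mem)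
    simpa using this
  | insert a t ha ih =>
    rw [Finset.sum_insert ha, Finset.sum_insert ha, hadd hφ (V.smul_mem _ (hu a))
      (V.sum_mem fun i _ => V.smul_mem _ (hu i)), ih, hsmul _ hφ (hu a)]

theorem sesq_sum_sum {V : Submodule ℂ Hil} {B : Hil → Hil → ℂ}
    (hadd : ∀ {φ ψ χ : Hil}, φ ∈ V → ψ ∈ V → χ ∈ V → B φ (ψ + χ) = B φ ψ + B φ χ)
    (hsmul : ∀ (c : ℂ) {φ ψ : Hil}, φ ∈ V → ψ ∈ V → B φ (c • ψ) = c * B φ ψ)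
    (hconj : ∀ φ ψ, (starRingEnd ℂ) (B ψ φ) = B φ ψ) {ι : Type*} (s : Finset ι) (c : ι → ℂ)
    {u : ι → Hil} (hu : ∀ i, u i ∈ V) :
    B (∑ i ∈ s, c i • u i) (∑ i ∈ s, c i • u i) =
      ∑ i ∈ s, ∑ j ∈ s, c i * (starRingEnd ℂ) (c j) * B (u j) (u i) := by
  rw [sesq_sum_right hadd hsmul s c hu (V.sum_mem fun i _ => V.smul_mem _ (hu i))]
  refine Finset.sum_congr rfl fun i _ => ?_
  rw [← hconj, sesq_sum_right hadd hsmul s c hu (hu i), map_sum, Finset.mul_sum]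
  refine Finset.sum_congr rfl fun j _ => ?_
  rw [map_mul, hconj, mul_assoc]

section FrameTraces

variable {r : ℕ} {u : Fin r → Hil}

theorem tsum_eigenvalue_mul {γ : Hil →L[ℂ] Hil} {S : Finset ℕ}
    (h1 : ∀ n ∈ S, eigenvalue γ n = 1) (h0 : ∀ n ∉ S, eigenvalue γ n = 0) (f : ℕ → ℝ) :
    ∑' n, eigenvalue γ n * f n = ∑ n ∈ S, f n := by
  rw [tsum_eq_sum (s := S) fun n hn => by rw [h0 n hn, zero_mul]]
  exact Finset.sum_congr rfl fun n hn => by rw [h1 n hn, one_mul]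

/-- Basis independence of the trace of a Hermitian form. With the inner product as B it gives the
charge, with the Coulomb-Dirac form the trace of D_Z γ. -/
theorem tsum_eigenvalue_frameProj (hu : Orthonormal ℂ u) {V : Submodule ℂ Hil}
    {B : Hil → Hil → ℂ}
    (hadd : ∀ {φ ψ χ : Hil}, φ ∈ V → ψ ∈ V → χ ∈ V → B φ (ψ + χ) = B φ ψ + B φ χ)
    (hsmul : ∀ (c : ℂ) {φ ψ : Hil}, φ ∈ V → ψ ∈ V → B φ (c • ψ) = c * B φ ψ)
    (hconj : ∀ φ ψ, (starRingEnd ℂ) (B ψ φ) = B φ ψ) (huV : ∀ i, u i ∈ V) {b : Hil → ℝ}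
    (hb : ∀ {ψ}, ψ ∈ V → b ψ = (B ψ ψ).re) :
    ∑' n, eigenvalue (frameProj u) n * b (eigenvector (frameProj u) n) = ∑ i, b (u i) := by
  obtain ⟨S, c, h1, h0, hc⟩ := exists_eigen_expansion hu
  have hmem : ∀ n, ∑ i, c i n • u i ∈ V := fun n =>
    V.sum_mem fun i _ => V.smul_mem _ (huV i)
  rw [tsum_eigenvalue_mul (fun n hn => (h1 n hn).1) h0 fun n => b (eigenvector (frameProj u) n)]
  calc ∑ n ∈ S, b (eigenvector (frameProj u) n)
      = ∑ n ∈ S, (∑ i, ∑ j, c i n * (starRingEnd ℂ) (c j n) * B (u j) (u i)).re := by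
        refine Finset.sum_congr rfl fun n hn => ?_
        rw [(h1 n hn).2, hb (hmem n),
          sesq_sum_sum (V := V) hadd hsmul hconj Finset.univ (fun i => c i n) huV]
    _ = ∑ i, b (u i) := by
        rw [← Complex.re_sum, sum_expansion hc fun i j => B (u j) (u i), Complex.re_sum]
        exact Finset.sum_congr rfl fun i _ => (hb (huV i)).symm

theorem opTrace_frameProj (hu : Orthonormal ℂ u) : opTrace (frameProj u) = r := by
  have hne := nonempty_eigenSystem_frameProj hu
  have h := tsum_eigenvalue_frameProj hu (V := ⊤) (B := fun φ ψ => ⟪φ, ψ⟫_ℂ)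
    (b := fun ψ => ‖ψ‖ ^ 2) (fun _ _ _ => inner_add_right _ _ _)
    (fun c _ _ _ _ => inner_smul_right _ _ c) (fun φ ψ => inner_conj_symm φ ψ) (fun _ => trivial)
    (fun {ψ} _ => by
      rw [inner_self_eq_norm_sq_to_K]
      norm_cast)
  have hn : ∀ n, ‖eigenvector (frameProj u) n‖ = 1 := fun n => by
    rw [eigenvector, dif_pos hne]
    exact hne.some.basis.orthonormal.1 n
  simpa [hn, hu.1, opTrace] using h

theorem diracTrace_frameProj {m : ℝ} (α Z : ℝ) (hu : Orthonormal ℂ u)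
    (huF : ∀ i, u i ∈ formDomain m) :
    diracTrace m α Z (frameProj u) = ∑ i, diracForm m α Z (u i) :=
  tsum_eigenvalue_frameProj hu (V := formDomain m) (diracSesq_add_right α Z)
    (fun c φ ψ _ _ => diracSesq_smul_right α Z c φ ψ) (diracSesq_conj_symm α Z) huF
    (diracForm_eq_re α Z)

/-- A full-measure set of points is used instead of almost all pairs, because the density is read
off on the diagonal, a null set of pairs. -/
theorem exists_kernel_frameProj (hu : Orthonormal ℂ u) : ∃ G : Set Space, (∀ᵐ x, x ∈ G) ∧
    ∀ x ∈ G, ∀ y ∈ G, ∀ s t, kernel (frameProj u) x y s t =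
      ∑ i, u i x s * (starRingEnd ℂ) (u i y t) := by
  obtain ⟨S, c, h1, h0, hc⟩ := exists_eigen_expansion hu
  refine ⟨{x | ∀ n ∈ S, eigenvector (frameProj u) n x = ∑ i, c i n • u i x}, ?_, ?_⟩
  · have h2 : ∀ n ∈ S, ∀ᵐ x, eigenvector (frameProj u) n x = ∑ i, c i n • u i x := by
      intro n hn
      rw [(h1 n hn).2]
      have h3 : ∀ᵐ x, ∀ i, (c i n • u i : Hil) x = c i n • u i x :=
        ae_all_iff.2 fun i => Lp.coeFn_smul (c i n) (u i)
      filter_upwards [Lp.coeFn_finsetSum Finset.univ fun i => c i n • u i, h3] with x hx hx3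
      rw [hx, Finset.sum_apply]
      exact Finset.sum_congr rfl fun i _ => hx3 i
    exact (ae_ball_iff S.countable_toSet).2 h2
  · intro x hx y hy s t
    rw [kernel, Matrix.of_apply, tsum_eq_sum (s := S) fun n hn => by
      rw [h0 n hn, Complex.ofReal_zero, zero_mul, zero_mul]]
    rw [← sum_expansion hc fun i j => u i x s * (starRingEnd ℂ) (u j y t)]
    refine Finset.sum_congr rfl fun n hn => ?_
    rw [(h1 n hn).1, hx n hn, hy n hn]
    simp only [PiLp.smul_apply, WithLp.ofLp_sum, Finset.sum_apply, smul_eq_mul, map_sum, map_mul,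
      Complex.ofReal_one, one_mul, Finset.sum_mul_sum]
    refine Finset.sum_congr rfl fun i _ => Finset.sum_congr rfl fun j _ => ?_
    ring

theorem ae_density_frameProj (hu : Orthonormal ℂ u) :
    ∀ᵐ x, density (frameProj u) x = ∑ i, ‖u i x‖ ^ 2 := by
  obtain ⟨G, hG, h⟩ := exists_kernel_frameProj hu
  filter_upwards [hG] with x hx
  have h1 : ∀ s, ∑' n, eigenvalue (frameProj u) n * ‖eigenvector (frameProj u) n x s‖ ^ 2 =
      ∑ i, ‖u i x s‖ ^ 2 := fun s => by
    have h2 := h x hx x hx s s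
    simp only [kernel, Matrix.of_apply, mul_assoc, Complex.mul_conj'] at h2
    exact_mod_cast h2
  rw [density, Finset.sum_congr rfl fun s _ => h1 s, Finset.sum_comm]
  exact Finset.sum_congr rfl fun i _ => (EuclideanSpace.norm_sq_eq _).symm

end FrameTraces

/-! ### First variation of the energy -/

/-- The expression vanishes at θ = 0, which is therefore a minimum. Its derivative there is a, every
other term being of second order in θ. -/
theorem eq_zero_of_forall_trig_nonneg {a b c d e : ℝ}
    (h : ∀ θ : ℝ, 0 ≤ Real.cos θ * Real.sin θ * a + Real.sin θ ^ 2 * b +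
      (Real.cos θ * Real.sin θ) ^ 2 * c + Real.cos θ * Real.sin θ * Real.sin θ ^ 2 * d +
      Real.sin θ ^ 2 * Real.sin θ ^ 2 * e) : a = 0 := by
  set f : ℝ → ℝ := fun θ => Real.cos θ * Real.sin θ * a + Real.sin θ ^ 2 * b +
      (Real.cos θ * Real.sin θ) ^ 2 * c + Real.cos θ * Real.sin θ * Real.sin θ ^ 2 * d +
      Real.sin θ ^ 2 * Real.sin θ ^ 2 * e with hf
  have hs : HasDerivAt Real.sin 1 0 := by simpa using Real.hasDerivAt_sin 0
  have hcs : HasDerivAt (fun θ => Real.cos θ * Real.sin θ) 1 0 := by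
    simpa using (Real.hasDerivAt_cos 0).fun_mul (Real.hasDerivAt_sin 0)
  have hs2 : HasDerivAt (fun θ => Real.sin θ ^ 2) 0 0 := by simpa using hs.fun_pow 2
  have hcs2 : HasDerivAt (fun θ => (Real.cos θ * Real.sin θ) ^ 2) 0 0 := by
    simpa using hcs.fun_pow 2
  have h1 := ((((hcs.mul_const a).add (hs2.mul_const b)).add (hcs2.mul_const c)).add
    ((hcs.mul hs2).mul_const d)).add ((hs2.mul hs2).mul_const e)
  have hd : HasDerivAt f a 0 := by
    refine h1.congr_deriv ?_
    simp
  have hmin : IsLocalMin f 0 := .of_forall fun θ => by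
    have h0 : f 0 = 0 := by simp [hf]
    rw [h0]
    exact h θ
  exact hmin.hasDerivAt_eq_zero hd

theorem DominatedDensity.mono {g h : Space → ℝ≥0∞} {ρ : Space → ℝ} (hρ : DominatedDensity g ρ)
    (hgh : ∀ x, g x ≤ h x) : DominatedDensity h ρ :=
  ⟨hρ.measurable, fun x => (hρ.bound x).trans (by gcongr; exact hgh x)⟩

theorem DominatedKernel.mono {g h : Space → ℝ≥0∞}
    {K : Space → Space → Matrix (Fin 4) (Fin 4) ℂ} (hK : DominatedKernel g K)
    (hgh : ∀ x, g x ≤ h x) : DominatedKernel h K :=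
  ⟨hK.measurable, fun x y s t => (hK.bound x y s t).trans (mul_le_mul' (hgh x) (hgh y))⟩

/-- The density `2 Re ⟪φ(x), ψ(x)⟫`. -/
def crossDensity (φ ψ : Hil) (x : Space) : ℝ := 2 * (⟪φ x, ψ x⟫_ℂ).re

theorem enorm_re_inner_le (v w : Spinor) : ‖2 * (⟪v, w⟫_ℂ).re‖ₑ ≤ (‖v‖ₑ + ‖w‖ₑ) ^ 2 := by
  simp only [← ofReal_norm]
  rw [← ENNReal.ofReal_add (norm_nonneg _) (norm_nonneg _), ← ENNReal.ofReal_pow (by positivity)]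
  refine ENNReal.ofReal_le_ofReal ?_
  have h1 : |(⟪v, w⟫_ℂ).re| ≤ ‖v‖ * ‖w‖ := (Complex.abs_re_le_norm _).trans (norm_inner_le_norm _ _)
  rw [Real.norm_eq_abs, abs_mul, abs_two]
  nlinarith [sq_nonneg (‖v‖ - ‖w‖), sq_nonneg ‖v‖, sq_nonneg ‖w‖]

theorem dominatedDensity_cross (φ ψ : Hil) :
    DominatedDensity (fun x => ‖φ x‖ₑ + ‖ψ x‖ₑ) (crossDensity φ ψ) := by
  refine ⟨?_, fun x => enorm_re_inner_le _ _⟩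
  exact (Complex.continuous_re.measurable.comp
    ((Lp.stronglyMeasurable φ).inner (Lp.stronglyMeasurable ψ)).measurable).const_mul 2

theorem dominatedDensity_sq_sub_sq (φ ψ : Hil) :
    DominatedDensity (fun x => ‖φ x‖ₑ + ‖ψ x‖ₑ) fun x => ‖φ x‖ ^ 2 - ‖ψ x‖ ^ 2 := by
  refine ⟨((Lp.stronglyMeasurable φ).measurable.norm.pow_const 2).sub
    ((Lp.stronglyMeasurable ψ).measurable.norm.pow_const 2), fun x => ?_⟩
  simp only [← ofReal_norm]
  rw [← ENNReal.ofReal_add (norm_nonneg _) (norm_nonneg _), ← ENNReal.ofReal_pow (by positivity)]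
  refine ENNReal.ofReal_le_ofReal ?_
  rw [Real.norm_eq_abs, abs_le]
  constructor <;> nlinarith [norm_nonneg (φ x), norm_nonneg (ψ x),
    mul_nonneg (norm_nonneg (φ x)) (norm_nonneg (ψ x))]

theorem dominatedKernel_cross (φ ψ : Hil) : DominatedKernel (fun x => ‖φ x‖ₑ + ‖ψ x‖ₑ)
    fun x y => rankOneKernel φ ψ x y + rankOneKernel ψ φ x y := by
  have h1 : DominatedKernel (fun x => ‖φ x‖ₑ + ‖ψ x‖ₑ) (rankOneKernel φ ψ) :=
    dominatedKernel_rankOne (fun x => le_self_add) fun x => le_add_self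
  have h2 : DominatedKernel (fun x => ‖φ x‖ₑ + ‖ψ x‖ₑ) (rankOneKernel ψ φ) :=
    dominatedKernel_rankOne (fun x => le_add_self) fun x => le_self_add
  refine ⟨fun s t => (h1.measurable s t).add (h2.measurable s t), fun x y s t => ?_⟩
  calc _ ≤ ‖rankOneKernel φ ψ x y s t‖ₑ + ‖rankOneKernel ψ φ x y s t‖ₑ := enorm_add_le _ _
    _ ≤ ‖φ x‖ₑ * ‖ψ y‖ₑ + ‖ψ x‖ₑ * ‖φ y‖ₑ := by
      simp only [rankOneKernel, Matrix.of_apply, enorm_mul, RCLike.enorm_conj]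
      gcongr <;> exact enorm_eval_le _ _
    _ ≤ (‖φ x‖ₑ * ‖ψ y‖ₑ + ‖ψ x‖ₑ * ‖φ y‖ₑ) + (‖φ x‖ₑ * ‖φ y‖ₑ + ‖ψ x‖ₑ * ‖ψ y‖ₑ) := le_self_add
    _ = _ := by ring

theorem dominatedKernel_self_sub_self (φ ψ : Hil) : DominatedKernel (fun x => ‖φ x‖ₑ + ‖ψ x‖ₑ)
    fun x y => rankOneKernel φ φ x y - rankOneKernel ψ ψ x y := by
  have h1 : DominatedKernel (fun x => ‖φ x‖ₑ + ‖ψ x‖ₑ) (rankOneKernel φ φ) :=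
    dominatedKernel_rankOne (fun x => le_self_add) fun x => le_self_add
  have h2 : DominatedKernel (fun x => ‖φ x‖ₑ + ‖ψ x‖ₑ) (rankOneKernel ψ ψ) :=
    dominatedKernel_rankOne (fun x => le_add_self) fun x => le_add_self
  refine ⟨fun s t => (h1.measurable s t).sub (h2.measurable s t), fun x y s t => ?_⟩
  calc _ ≤ ‖rankOneKernel φ φ x y s t‖ₑ + ‖rankOneKernel ψ ψ x y s t‖ₑ := enorm_sub_le
    _ ≤ ‖φ x‖ₑ * ‖φ y‖ₑ + ‖ψ x‖ₑ * ‖ψ y‖ₑ := by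
      simp only [rankOneKernel, Matrix.of_apply, enorm_mul, RCLike.enorm_conj]
      gcongr <;> exact enorm_eval_le _ _
    _ ≤ (‖φ x‖ₑ * ‖φ y‖ₑ + ‖ψ x‖ₑ * ‖ψ y‖ₑ) + (‖φ x‖ₑ * ‖ψ y‖ₑ + ‖ψ x‖ₑ * ‖φ y‖ₑ) := le_self_add
    _ = _ := by ring

theorem exchangePairing_add_left {g : Space → ℝ≥0∞} (hg : CoulombBounded g)
    {K L M : Space → Space → Matrix (Fin 4) (Fin 4) ℂ} (hK : DominatedKernel g K)
    (hL : DominatedKernel g L) (hM : DominatedKernel g M) :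
    exchangePairing (fun x y => K x y + L x y) M = exchangePairing K M + exchangePairing L M := by
  rw [exchangePairing, exchangePairing, exchangePairing, ← integral_add
    (exchangePairing_integrable hg hK hM) (exchangePairing_integrable hg hL hM)]
  refine integral_congr_ae (.of_forall fun p => ?_)
  simp only [Matrix.add_apply, map_add, add_mul, Finset.sum_add_distrib, add_div]

/-- Integrating out the second variable turns the density of γ into its direct potential, so the
first-order Coulomb term is a matrix element of the mean field. -/
theorem coulombPairing_cross {m : ℝ} (hm : 0 < m) {γ : Hil →L[ℂ] Hil} (hγ : MemF m γ)
    {φ ψ : Hil} (hφ : φ ∈ formDomain m) (hψ : ψ ∈ formDomain m) :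
    coulombPairing (crossDensity φ ψ) (density γ) =
    2 * (mulForm (realMul (directPotential γ)) φ ψ).re := by
  have hg := ((coulombBounded_enorm hφ).add (coulombBounded_enorm hψ)).add
    (coulombBounded_amplitude hm hγ)
  have hI := coulombPairing_integrable hg
    ((dominatedDensity_cross φ ψ).mono fun x => le_self_add)
    ((dominatedDensity_density γ).mono fun x => le_add_self)
  have hd : ψ ∈ (potential (directPotential γ)).domain := by
    have := (dominatedDensity_density γ).potential_domain (coulombBounded_amplitude hm hγ)
    exact this ▸ trivial
  have hM : Integrable fun x => ⟪φ x, realMul (directPotential γ) x (ψ x)⟫_ℂ := by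
    refine (L2.integrable_inner φ (mulOp (realMul (directPotential γ)) ⟨ψ, hd⟩)).congr ?_
    have h : (mulOp (realMul (directPotential γ)) ⟨ψ, hd⟩ : Hil) =ᵐ[volume]
      fun x => realMul (directPotential γ) x (ψ x) := MemLp.coeFn_toLp hd
    filter_upwards [h] with x hx
    rw [hx]
  have hre : (mulForm (realMul (directPotential γ)) φ ψ).re =
      ∫ x, (⟪φ x, realMul (directPotential γ) x (ψ x)⟫_ℂ).re := (integral_re hM).symm
  rw [hre, coulombPairing, Measure.volume_eq_prod, integral_prod _ hI, ← integral_const_mul]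
  refine integral_congr_ae (.of_forall fun x => ?_)
  simp only [smul_apply, ContinuousLinearMap.id_apply, inner_smul_right, Complex.re_ofReal_mul,
    directPotential, mul_div_assoc, integral_const_mul, crossDensity]
  ring

theorem re_exchangePairing_cross {m : ℝ} (hm : 0 < m) {γ : Hil →L[ℂ] Hil} (hγ : MemF m γ)
    {φ ψ : Hil} (hφ : φ ∈ formDomain m) (hψ : ψ ∈ formDomain m) :
    (exchangePairing (fun x y => rankOneKernel φ ψ x y + rankOneKernel ψ φ x y) (kernel γ)).re =
      2 * (exchangePairing (rankOneKernel φ ψ) (kernel γ)).re := by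
  have hg := ((coulombBounded_enorm hφ).add (coulombBounded_enorm hψ)).add
    (coulombBounded_amplitude hm hγ)
  rw [exchangePairing_add_left hg (dominatedKernel_rankOne (fun x => le_self_add.trans le_self_add)
    fun x => le_add_self.trans le_self_add) (dominatedKernel_rankOne
    (fun x => le_add_self.trans le_self_add) fun x => le_self_add.trans le_self_add)
    ((dominatedKernel_kernel γ).mono fun x => le_add_self), Complex.add_re,
    ← exchangePairing_rankOne_conj_symm γ ψ φ, Complex.conj_re]
  ring

/-! ### Rotating one vector of the frame and the resulting stationarity -/

section Variation

variable {r : ℕ} {u : Fin r → Hil}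

/-- Rotate the `k`-th vector of a frame towards `φ`. -/
def rotate (u : Fin r → Hil) (k : Fin r) (φ : Hil) (θ : ℝ) : Fin r → Hil :=
  Function.update u k ((Real.cos θ : ℂ) • u k + (Real.sin θ : ℂ) • φ)

theorem rotate_mem {u : Fin r → Hil} {k : Fin r} {φ : Hil} (V : Submodule ℂ Hil)
    (hu : ∀ i, u i ∈ V) (hφ : φ ∈ V) (θ : ℝ) (i : Fin r) : rotate u k φ θ i ∈ V := by
  rcases eq_or_ne i k with rfl | hi
  · rw [rotate, Function.update_self]
    exact V.add_mem (V.smul_mem _ (hu _)) (V.smul_mem _ hφ)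
  · rw [rotate, Function.update_of_ne hi]
    exact hu i

theorem orthonormal_rotate (hu : Orthonormal ℂ u) (k : Fin r) {φ : Hil} (hφ : ‖φ‖ = 1)
    (hφu : ∀ i, ⟪u i, φ⟫_ℂ = 0) (θ : ℝ) : Orthonormal ℂ (rotate u k φ θ) := by
  have hφu' : ∀ i, ⟪φ, u i⟫_ℂ = 0 := fun i => inner_eq_zero_symm.1 (hφu i)
  have hself : ∀ i, ⟪u i, u i⟫_ℂ = 1 := fun i => by
    rw [inner_self_eq_norm_sq_to_K, hu.1 i]; simp
  have hφφ : ⟪φ, φ⟫_ℂ = 1 := by rw [inner_self_eq_norm_sq_to_K, hφ]; simp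
  have hne : ∀ {i j}, i ≠ j → ⟪u i, u j⟫_ℂ = 0 := fun h => hu.2 h
  rw [orthonormal_iff_ite]
  intro i j
  rcases eq_or_ne i k with rfl | hi <;> rcases eq_or_ne j i with rfl | hj
  · rw [if_pos rfl, rotate, Function.update_self]
    simp only [inner_add_left, inner_add_right, inner_smul_left, inner_smul_right, hφu, hφu',
      hself, hφφ, Complex.conj_ofReal]
    have := Real.cos_sq_add_sin_sq θ
    have h2 : ((Real.cos θ : ℂ)) ^ 2 + (Real.sin θ : ℂ) ^ 2 = 1 := by exact_mod_cast this
    linear_combination h2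
  · rw [if_neg hj.symm, rotate, Function.update_self, Function.update_of_ne hj]
    simp [inner_add_left, inner_smul_left, hφu', hne hj.symm]
  · rw [if_pos rfl, rotate, Function.update_of_ne hi, hself]
  · rw [if_neg hj.symm, rotate, Function.update_of_ne hi]
    rcases eq_or_ne j k with rfl | hjk
    · rw [Function.update_self]
      simp [inner_add_right, inner_smul_right, hφu, hne hi]
    · rw [Function.update_of_ne hjk, hne hj.symm]

theorem energy_eq {m : ℝ} (hm : 0 < m) (α Z : ℝ) {γ : Hil →L[ℂ] Hil} (hγ : MemF m γ) :
    energy m α Z γ = diracTrace m α Z γ + α * (1 / 2 * coulombPairing (density γ) (density γ) -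
      1 / 2 * (exchangePairing (kernel γ) (kernel γ)).re) := by
  have hg := coulombBounded_amplitude hm hγ
  rw [energy, interaction, coulombProduct_eq hg (dominatedDensity_density γ)
    (dominatedDensity_density γ), exchangeProduct_eq hg (dominatedKernel_kernel γ)
    (dominatedKernel_kernel γ)]

theorem sum_rotate (u : Fin r → Hil) (k : Fin r) (φ : Hil) (θ : ℝ) {M : Type*}
    [AddCommGroup M] (F : Hil → M) : ∑ i, F (rotate u k φ θ i) =
      ∑ i, F (u i) + (F ((Real.cos θ : ℂ) • u k + (Real.sin θ : ℂ) • φ) - F (u k)) := by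
  rw [← Finset.add_sum_erase _ _ (Finset.mem_univ k), ← Finset.add_sum_erase _ (fun i => F (u i))
    (Finset.mem_univ k), rotate, Function.update_self, Finset.sum_congr rfl fun i hi => by
    rw [Function.update_of_ne (Finset.ne_of_mem_erase hi)]]
  abel

theorem diracForm_rotate {m : ℝ} (α Z : ℝ) {φ ψ : Hil} (hφ : φ ∈ formDomain m)
    (hψ : ψ ∈ formDomain m) (θ : ℝ) :
    diracForm m α Z ((Real.cos θ : ℂ) • ψ + (Real.sin θ : ℂ) • φ) - diracForm m α Z ψ =
      Real.cos θ * Real.sin θ * (2 * (diracSesq m α Z φ ψ).re) +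
        Real.sin θ ^ 2 * (diracForm m α Z φ - diracForm m α Z ψ) := by
  have hmem : ∀ c s : ℂ, c • ψ + s • φ ∈ formDomain m := fun c s =>
    add_mem (Submodule.smul_mem _ c hψ) (Submodule.smul_mem _ s hφ)
  have h1 := sesq_sum_sum (V := formDomain m) (diracSesq_add_right α Z)
    (fun c φ ψ _ _ => diracSesq_smul_right α Z c φ ψ) (diracSesq_conj_symm α Z) Finset.univ
    ![(Real.cos θ : ℂ), (Real.sin θ : ℂ)] (u := ![ψ, φ]) (fun i => by
      fin_cases i
      exacts [hψ, hφ])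
  simp only [Fin.sum_univ_two, Matrix.cons_val_zero, Matrix.cons_val_one, Complex.conj_ofReal]
    at h1
  rw [diracForm_eq_re α Z (hmem _ _), diracForm_eq_re α Z hφ, diracForm_eq_re α Z hψ, h1,
    ← diracSesq_conj_symm α Z ψ φ]
  simp only [← Complex.ofReal_mul, Complex.add_re, Complex.re_ofReal_mul, Complex.conj_re]
  linear_combination (diracSesq m α Z ψ ψ).re * Real.cos_sq_add_sin_sq θ

/-- Only the k-th summand changes, and cos²θ is rewritten as 1 - sin²θ, so that every increment
carries the factor cos θ sin θ or sin²θ. -/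
theorem ae_density_rotate (hu : Orthonormal ℂ u) (k : Fin r) {φ : Hil} (hφ : ‖φ‖ = 1)
    (hφu : ∀ i, ⟪u i, φ⟫_ℂ = 0) (θ : ℝ) :
    ∀ᵐ x, density (frameProj (rotate u k φ θ)) x = density (frameProj u) x +
      Real.cos θ * Real.sin θ * crossDensity φ (u k) x +
        Real.sin θ ^ 2 * (‖φ x‖ ^ 2 - ‖u k x‖ ^ 2) := by
  filter_upwards [ae_density_frameProj (orthonormal_rotate hu k hφ hφu θ),
    ae_density_frameProj hu, Lp.coeFn_add ((Real.cos θ : ℂ) • u k) ((Real.sin θ : ℂ) • φ),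
    Lp.coeFn_smul (Real.cos θ : ℂ) (u k), Lp.coeFn_smul (Real.sin θ : ℂ) φ] with x h1 h2 h3 h4 h5
  rw [h1, h2, sum_rotate u k φ θ fun v => ‖v x‖ ^ 2, h3, Pi.add_apply, h4, h5, Pi.smul_apply,
    Pi.smul_apply, @norm_add_sq ℂ, norm_smul, norm_smul, Complex.norm_real, Complex.norm_real,
    mul_pow, mul_pow, Real.norm_eq_abs, Real.norm_eq_abs, sq_abs, sq_abs, inner_smul_left,
    inner_smul_right, Complex.conj_ofReal, ← mul_assoc, ← Complex.ofReal_mul, crossDensity,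
    ← inner_conj_symm (φ x), Complex.conj_re]
  change _ + (_ + 2 * (((Real.cos θ * Real.sin θ : ℝ) : ℂ) * _).re + _ - _) = _
  rw [Complex.re_ofReal_mul]
  linear_combination ‖u k x‖ ^ 2 * Real.cos_sq_add_sin_sq θ

theorem ae_kernel_rotate (hu : Orthonormal ℂ u) (k : Fin r) {φ : Hil} (hφ : ‖φ‖ = 1)
    (hφu : ∀ i, ⟪u i, φ⟫_ℂ = 0) (θ : ℝ) :
    ∀ᵐ p : Space × Space, ∀ s t, kernel (frameProj (rotate u k φ θ)) p.1 p.2 s t =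
      kernel (frameProj u) p.1 p.2 s t +
      ((Real.cos θ * Real.sin θ : ℝ) : ℂ) *
        (rankOneKernel φ (u k) p.1 p.2 + rankOneKernel (u k) φ p.1 p.2) s t +
        ((Real.sin θ ^ 2 : ℝ) : ℂ) *
          (rankOneKernel φ φ p.1 p.2 - rankOneKernel (u k) (u k) p.1 p.2) s t := by
  obtain ⟨G₁, hG₁, h₁⟩ := exists_kernel_frameProj (orthonormal_rotate hu k hφ hφu θ)
  obtain ⟨G₂, hG₂, h₂⟩ := exists_kernel_frameProj hu
  have hv : ∀ᵐ x, ((Real.cos θ : ℂ) • u k + (Real.sin θ : ℂ) • φ : Hil) x =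
      (Real.cos θ : ℂ) • u k x + (Real.sin θ : ℂ) • φ x := by
    filter_upwards [Lp.coeFn_add ((Real.cos θ : ℂ) • u k) ((Real.sin θ : ℂ) • φ),
      Lp.coeFn_smul (Real.cos θ : ℂ) (u k), Lp.coeFn_smul (Real.sin θ : ℂ) φ] with x h3 h4 h5
    rw [h3, Pi.add_apply, h4, h5, Pi.smul_apply, Pi.smul_apply]
  filter_upwards [ae_prod_of_ae hG₁, ae_prod_of_ae hG₂, ae_prod_of_ae hv] with p hp₁ hp₂ hp s t
  rw [h₁ _ hp₁.1 _ hp₁.2, h₂ _ hp₂.1 _ hp₂.2,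
    sum_rotate u k φ θ fun v => v p.1 s * (starRingEnd ℂ) (v p.2 t), hp.1, hp.2]
  simp only [PiLp.add_apply, PiLp.smul_apply, smul_eq_mul, map_add, map_mul, Complex.conj_ofReal,
    Matrix.add_apply, Matrix.sub_apply, rankOneKernel, Matrix.of_apply, Complex.ofReal_mul,
    Complex.ofReal_pow]
  have h2 : ((Real.cos θ : ℂ)) ^ 2 + (Real.sin θ : ℂ) ^ 2 = 1 := by
    exact_mod_cast Real.cos_sq_add_sin_sq θ
  linear_combination u k p.1 s * (starRingEnd ℂ) (u k p.2 t) * h2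

/-- The first-order coefficient of the energy along the rotation is twice this real part. The
factors 1/2 in the interaction cancel against the two equal cross terms. -/
theorem re_fockSesq_eq_zero {m : ℝ} (hm : 0 < m) (α Z : ℝ) (hu : Orthonormal ℂ u)
    (huF : ∀ i, u i ∈ formDomain m) (k : Fin r) {φ : Hil} (hφF : φ ∈ formDomain m)
    (hφ : ‖φ‖ = 1) (hφu : ∀ i, ⟪u i, φ⟫_ℂ = 0)
    (hmin : ∀ θ, energy m α Z (frameProj u) ≤ energy m α Z (frameProj (rotate u k φ θ))) :
    (fockSesq m α Z (frameProj u) φ (u k)).re = 0 := by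
  have hγ := memF_frameProj hu huF
  set g : Space → ℝ≥0∞ := fun x => ‖φ x‖ₑ + ‖u k x‖ₑ + amplitude (frameProj u) x with hgdef
  have hg : CoulombBounded g := ((coulombBounded_enorm hφF).add (coulombBounded_enorm (huF k))).add
    (coulombBounded_amplitude hm hγ)
  set ρ : Fin 3 → Space → ℝ := ![density (frameProj u), crossDensity φ (u k),
    fun x => ‖φ x‖ ^ 2 - ‖u k x‖ ^ 2] with hρdef
  set K : Fin 3 → Space → Space → Matrix (Fin 4) (Fin 4) ℂ := ![kernel (frameProj u),
    fun x y => rankOneKernel φ (u k) x y + rankOneKernel (u k) φ x y,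
    fun x y => rankOneKernel φ φ x y - rankOneKernel (u k) (u k) x y] with hKdef
  have hρ : ∀ i, DominatedDensity g (ρ i) := fun i => by
    fin_cases i
    exacts [(dominatedDensity_density _).mono fun x => le_add_self,
      (dominatedDensity_cross _ _).mono fun x => le_self_add,
      (dominatedDensity_sq_sub_sq _ _).mono fun x => le_self_add]
  have hK : ∀ i, DominatedKernel g (K i) := fun i => by
    fin_cases i
    exacts [(dominatedKernel_kernel _).mono fun x => le_add_self,
      (dominatedKernel_cross _ _).mono fun x => le_self_add,
      (dominatedKernel_self_sub_self _ _).mono fun x => le_self_add]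
  have hE : ∀ θ, energy m α Z (frameProj (rotate u k φ θ)) = (diracTrace m α Z (frameProj u) +
      (Real.cos θ * Real.sin θ * (2 * (diracSesq m α Z φ (u k)).re) +
        Real.sin θ ^ 2 * (diracForm m α Z φ - diracForm m α Z (u k)))) +
      α * (1 / 2 * ∑ i, ∑ j, ![1, Real.cos θ * Real.sin θ, Real.sin θ ^ 2] i *
        ![1, Real.cos θ * Real.sin θ, Real.sin θ ^ 2] j * coulombPairing (ρ i) (ρ j) -
      1 / 2 * ∑ i, ∑ j, ![1, Real.cos θ * Real.sin θ, Real.sin θ ^ 2] i *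
        ![1, Real.cos θ * Real.sin θ, Real.sin θ ^ 2] j * (exchangePairing (K i) (K j)).re) := by
    intro θ
    have hr := orthonormal_rotate hu k hφ hφu θ
    have hrF := rotate_mem (k := k) (formDomain m) huF hφF θ
    rw [energy_eq hm α Z (memF_frameProj hr hrF), diracTrace_frameProj α Z hr hrF,
      diracTrace_frameProj α Z hu huF, sum_rotate u k φ θ (diracForm m α Z),
      diracForm_rotate α Z hφF (huF k),
      coulombPairing_sum hg hρ ![1, Real.cos θ * Real.sin θ, Real.sin θ ^ 2] ?_,
      exchangePairing_sum hg hK ![1, Real.cos θ * Real.sin θ, Real.sin θ ^ 2] ?_]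
    · simp only [Complex.re_sum, Complex.re_ofReal_mul]
    · filter_upwards [ae_kernel_rotate hu k hφ hφu θ] with p hp s t
      rw [hp, Fin.sum_univ_three]
      change _ = ((1 : ℝ) : ℂ) * kernel (frameProj u) p.1 p.2 s t + _ + _
      rw [Complex.ofReal_one, one_mul]
      rfl
    · filter_upwards [ae_density_rotate hu k hφ hφu θ] with x hx
      rw [hx, Fin.sum_univ_three]
      change _ = 1 * density (frameProj u) x + _ + _
      rw [one_mul]
      rfl
  have hE0 : energy m α Z (frameProj u) = diracTrace m α Z (frameProj u) +
      α * (1 / 2 * coulombPairing (ρ 0) (ρ 0) - 1 / 2 * (exchangePairing (K 0) (K 0)).re) :=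
    energy_eq hm α Z hγ
  have hKs : (exchangePairing (K 0) (K 1)).re = (exchangePairing (K 1) (K 0)).re := by
    rw [← exchangePairing_conj_symm, Complex.conj_re]
  have hc : coulombPairing (ρ 1) (ρ 0) =
      2 * (mulForm (realMul (directPotential (frameProj u))) φ (u k)).re :=
    coulombPairing_cross hm hγ hφF (huF k)
  have hx : (exchangePairing (K 1) (K 0)).re =
      2 * (exchangePairing (rankOneKernel φ (u k)) (kernel (frameProj u))).re :=
    re_exchangePairing_cross hm hγ hφF (huF k)
  -- The coefficients a, …, e belong to cos θ sin θ, sin²θ and the three products of these; only a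
  -- matters.
  have hzero := eq_zero_of_forall_trig_nonneg
    (a := 2 * (diracSesq m α Z φ (u k)).re + α * (coulombPairing (ρ 1) (ρ 0) -
      (exchangePairing (K 1) (K 0)).re))
    (b := diracForm m α Z φ - diracForm m α Z (u k) + α / 2 * (coulombPairing (ρ 0) (ρ 2) +
      coulombPairing (ρ 2) (ρ 0) - (exchangePairing (K 0) (K 2)).re -
        (exchangePairing (K 2) (K 0)).re))
    (c := α / 2 * (coulombPairing (ρ 1) (ρ 1) - (exchangePairing (K 1) (K 1)).re))
    (d := α / 2 * (coulombPairing (ρ 1) (ρ 2) + coulombPairing (ρ 2) (ρ 1) -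
      (exchangePairing (K 1) (K 2)).re - (exchangePairing (K 2) (K 1)).re))
    (e := α / 2 * (coulombPairing (ρ 2) (ρ 2) - (exchangePairing (K 2) (K 2)).re))
    (fun θ => by
      have h := hmin θ
      rw [hE θ, hE0] at h
      simp only [Fin.sum_univ_three, Matrix.cons_val_zero, Matrix.cons_val_one, Matrix.cons_val]
        at h
      rw [hKs, coulombPairing_comm (ρ 0) (ρ 1)] at h
      refine (sub_nonneg.2 h).trans (le_of_eq ?_)
      ring)
  rw [hc, hx] at hzero
  simp only [fockSesq, Complex.add_re, Complex.re_ofReal_mul, Complex.sub_re]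
  linarith

theorem fockSesq_eq_zero {m : ℝ} (hm : 0 < m) (α Z : ℝ) (hu : Orthonormal ℂ u)
    (huF : ∀ i, u i ∈ formDomain m) (k : Fin r) {P : Hil →L[ℂ] Hil}
    (hmin : ∀ (φ : Hil), φ ∈ formDomain m → ‖φ‖ = 1 → (∀ i, ⟪u i, φ⟫_ℂ = 0) → P φ = φ →
      ∀ θ, energy m α Z (frameProj u) ≤ energy m α Z (frameProj (rotate u k φ θ)))
    {φ : Hil} (hφF : φ ∈ formDomain m) (hφu : ∀ i, ⟪u i, φ⟫_ℂ = 0) (hφP : P φ = φ) :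
    fockSesq m α Z (frameProj u) φ (u k) = 0 := by
  have hγ := memF_frameProj hu huF
  rcases eq_or_ne φ 0 with rfl | h0
  · rw [← fockSesq_conj_symm]
    have := fockSesq_smul_right α Z hm hγ 0 (huF k) (zero_mem (formDomain m))
    rw [zero_smul, zero_mul] at this
    rw [this, map_zero]
  have hn : ‖φ‖ ≠ 0 := norm_ne_zero_iff.2 h0
  -- φ is normalised and multiplied by a phase c, both permitted for test vectors; c = 1 and c = i
  -- give the real and the imaginary part.
  have key : ∀ c : ℂ, ‖c‖ = 1 → (c * fockSesq m α Z (frameProj u) (u k) φ).re = 0 := by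
    intro c hc
    have h := re_fockSesq_eq_zero hm α Z hu huF k
      (φ := (c * ((‖φ‖⁻¹ : ℝ) : ℂ)) • φ) (Submodule.smul_mem _ _ hφF) ?_ ?_ (hmin _ ?_ ?_ ?_ ?_)
    · rw [← fockSesq_conj_symm, Complex.conj_re, fockSesq_smul_right α Z hm hγ _ (huF k) hφF,
        mul_comm c, mul_assoc, Complex.re_ofReal_mul] at h
      exact (mul_eq_zero.1 h).resolve_left (inv_ne_zero hn)
    all_goals first
      | exact Submodule.smul_mem _ _ hφF
      | (rw [norm_smul, norm_mul, hc, one_mul, Complex.norm_real, norm_inv, norm_norm,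
          inv_mul_cancel₀ hn])
      | (intro i; rw [inner_smul_right, hφu, mul_zero])
      | rw [map_smul, hφP]
  have h1 := key 1 (by simp)
  have h2 := key Complex.I (by simp)
  rw [← fockSesq_conj_symm, map_eq_zero]
  refine Complex.ext (by simpa using h1) (by simpa using h2)

end Variation

/-! ### From the weak Euler–Lagrange equation to operator commutation -/

section EulerLagrange

variable {m : ℝ} {r : ℕ} {u : Fin r → Hil}

theorem inner_frameProj (hu : Orthonormal ℂ u) (i : Fin r) (χ : Hil) :
    ⟪u i, frameProj u χ⟫_ℂ = ⟪u i, χ⟫_ℂ := by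
  rw [← frameProj_inner_left, frameProj_self hu]

theorem frameProj_mem (V : Submodule ℂ Hil) (hV : ∀ i, u i ∈ V) (χ : Hil) : frameProj u χ ∈ V := by
  rw [frameProj_apply]
  exact V.sum_mem fun i _ => V.smul_mem _ (hV i)

theorem fockSesq_add_left (hm : 0 < m) (α Z : ℝ) {γ : Hil →L[ℂ] Hil} (hγ : MemF m γ)
    {φ ψ χ : Hil} (hφ : φ ∈ formDomain m) (hψ : ψ ∈ formDomain m) (hχ : χ ∈ formDomain m) :
    fockSesq m α Z γ (φ + ψ) χ = fockSesq m α Z γ φ χ + fockSesq m α Z γ ψ χ := by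
  rw [← fockSesq_conj_symm, fockSesq_add_right α Z hm hγ hχ hφ hψ, map_add, fockSesq_conj_symm,
    fockSesq_conj_symm]

theorem fockSesq_frameProj_right (hm : 0 < m) (α Z : ℝ) {γ : Hil →L[ℂ] Hil} (hγ : MemF m γ)
    (huF : ∀ i, u i ∈ formDomain m) {φ : Hil} (hφ : φ ∈ formDomain m) (χ : Hil) :
    fockSesq m α Z γ φ (frameProj u χ) = ∑ i, ⟪u i, χ⟫_ℂ * fockSesq m α Z γ φ (u i) := by
  rw [frameProj_apply]
  exact sesq_sum_right (fockSesq_add_right α Z hm hγ) (fockSesq_smul_right α Z hm hγ) _ _ huF hφ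

/-- A solution of the Euler–Lagrange equation for the form of `D^{(γ)}` lies in the operator
domain. -/
theorem frame_mem_domain (hm : 0 < m) (α Z : ℝ) (hu : Orthonormal ℂ u)
    (huF : ∀ i, u i ∈ formDomain m) {δ : Hil →L[ℂ] Hil} (hδ : MemF m δ)
    {E : ProjValuedMeasure Hil} (hE : E.Resolves (diracFock m α Z δ))
    (hPu : ∀ i, E.proj (Set.Ici 0) (u i) = u i)
    (hEL : ∀ φ ∈ formDomain m, (∀ i, ⟪u i, φ⟫_ℂ = 0) → E.proj (Set.Ici 0) φ = φ →
      ∀ k, fockSesq m α Z (frameProj u) φ (u k) = 0) (k : Fin r) :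
    u k ∈ (diracFock m α Z δ).domain := by
  have hγ := memF_frameProj hu huF
  have hδd : u k ∈ (meanField δ).domain := by rw [meanField_domain hm hδ]; trivial
  have hγd : u k ∈ (meanField (frameProj u)).domain := by rw [meanField_domain hm hγ]; trivial
  -- The first part of C bounds the coupling of u_k to the frame, the second the difference of the
  -- two mean fields acting on u_k.
  refine hE.mem_domain_of_bounded (hPu k)
    (C := ∑ i, ‖fockSesq m α Z (frameProj u) (u k) (u i)‖ +
      ‖(α : ℂ)‖ * ‖meanField δ ⟨u k, hδd⟩ - meanField (frameProj u) ⟨u k, hγd⟩‖) fun φ hφP => ?_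
  have hφ : (φ : Hil) ∈ formDomain m := diracFree_domain_le m φ.2.1.1
  have hγφ := frameProj_mem (formDomain m) huF φ
  have hsub := sub_mem hφ hγφ
  have h1 : ⟪diracFock m α Z δ φ, u k⟫_ℂ = fockSesq m α Z δ φ (u k) := by
    rw [← inner_conj_symm, inner_diracFock α Z hm hδ (huF k), fockSesq_conj_symm]
  have h2 : fockSesq m α Z δ φ (u k) = fockSesq m α Z (frameProj u) φ (u k) +
      (α : ℂ) * ⟪(φ : Hil), meanField δ ⟨u k, hδd⟩ - meanField (frameProj u) ⟨u k, hγd⟩⟫_ℂ := by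
    rw [fockSesq_eq α Z hm hδ hφ (huF k) hδd, fockSesq_eq α Z hm hγ hφ (huF k) hγd,
      inner_sub_right]
    ring
  -- The component of φ orthogonal to the frame stays in the electron subspace and drops out by the
  -- Euler–Lagrange equation. Only finitely many matrix elements remain, and these are bounded in
  -- the L² norm of φ.
  have h3 : fockSesq m α Z (frameProj u) φ (u k) =
      (starRingEnd ℂ) (fockSesq m α Z (frameProj u) (u k) (frameProj u φ)) := by
    have h4 := hEL (φ - frameProj u φ) hsub
      (fun i => by rw [inner_sub_right, inner_frameProj hu, sub_self])
      (by rw [map_sub, hφP]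
          congr 1
          rw [frameProj_apply, map_sum]
          simp only [map_smul, hPu]) k
    have h5 := fockSesq_add_left hm α Z hγ hγφ hsub (huF k)
    rw [h4, add_zero, add_sub_cancel] at h5
    rw [h5, fockSesq_conj_symm]
  rw [h1, h2, h3, fockSesq_frameProj_right hm α Z hγ huF (huF k), add_mul]
  refine (norm_add_le _ _).trans (add_le_add ?_ ?_)
  · rw [RCLike.norm_conj, Finset.sum_mul]
    refine (norm_sum_le _ _).trans (Finset.sum_le_sum fun i _ => ?_)
    rw [norm_mul, mul_comm]
    gcongr
    simpa [hu.1 i] using norm_inner_le_norm (𝕜 := ℂ) (u i) (φ : Hil)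
  · rw [norm_mul, mul_assoc]
    gcongr
    rw [mul_comm]
    exact norm_inner_le_norm _ _

/-- With h the form of D^{(γ)}, both sides tested against w agree because h(Pw, γχ) = h(γw, γχ) =
h(γw, Pχ): the off-diagonal blocks vanish by the Euler–Lagrange equation and its conjugate. -/
theorem commutesWith_compress (hm : 0 < m) (α Z : ℝ) (hu : Orthonormal ℂ u)
    (huF : ∀ i, u i ∈ formDomain m) {δ : Hil →L[ℂ] Hil} (hδ : MemF m δ)
    {E : ProjValuedMeasure Hil} (hE : E.Resolves (diracFock m α Z δ))
    (hPu : ∀ i, E.proj (Set.Ici 0) (u i) = u i)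
    (hEL : ∀ φ ∈ formDomain m, (∀ i, ⟪u i, φ⟫_ℂ = 0) → E.proj (Set.Ici 0) φ = φ →
      ∀ k, fockSesq m α Z (frameProj u) φ (u k) = 0) :
    CommutesWith (frameProj u)
      (compress (E.proj (Set.Ici 0)) (diracFock m α Z (frameProj u))) := by
  have hγ := memF_frameProj hu huF
  have hdom : (diracFock m α Z (frameProj u)).domain = (diracFock m α Z δ).domain := by
    rw [diracFock_domain hm α Z hγ, diracFock_domain hm α Z hδ]
  have huD := frame_mem_domain hm α Z hu huF hδ hE hPu hEL
  set P := E.proj (Set.Ici 0) with hP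
  have hPP : ∀ x, P (P x) = P x := fun x => by
    rw [hP, E.proj_proj measurableSet_Ici measurableSet_Ici, Set.inter_self]
  have hPinner : ∀ x y, ⟪P x, y⟫_ℂ = ⟪x, P y⟫_ℂ := E.inner_proj_left measurableSet_Ici
  have hPγ : ∀ x, P (frameProj u x) = frameProj u x := fun x => by
    rw [frameProj_apply, map_sum]
    simp only [map_smul, hPu]
  have hγP : ∀ x, frameProj u (P x) = frameProj u x := fun x => by
    rw [frameProj_apply, frameProj_apply]
    simp only [← hPinner, hPu]
  have hFdom : ∀ x ∈ (diracFock m α Z δ).domain, x ∈ formDomain m := fun x hx =>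
    diracFree_domain_le m hx.1.1
  have hzero : ∀ φ ∈ formDomain m, P φ = φ → ∀ χ,
      fockSesq m α Z (frameProj u) (φ - frameProj u φ) (frameProj u χ) = 0 := by
    intro φ hφ hφP χ
    have hsub := sub_mem hφ (frameProj_mem (formDomain m) huF φ)
    rw [fockSesq_frameProj_right hm α Z hγ huF hsub]
    refine Finset.sum_eq_zero fun i _ => ?_
    rw [hEL _ hsub (fun i => by rw [inner_sub_right, inner_frameProj hu, sub_self])
      (by rw [map_sub, hφP, hPγ]), mul_zero]
  intro χ
  have hv : P χ ∈ (diracFock m α Z (frameProj u)).domain := χ.2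
  have hγχ : frameProj u χ ∈ (diracFock m α Z (frameProj u)).domain := by
    rw [hdom]
    exact frameProj_mem _ huD χ
  have hmem : P (frameProj u χ) ∈ (diracFock m α Z (frameProj u)).domain := by
    rw [hPγ]; exact hγχ
  refine ⟨hmem, ?_⟩
  change P (diracFock m α Z (frameProj u) ⟨P (frameProj u χ), hmem⟩) =
    frameProj u (P (diracFock m α Z (frameProj u) ⟨P χ, hv⟩))
  have hdense : Dense ((diracFock m α Z δ).domain : Set Hil) :=
    Submodule.dense_iff_topologicalClosure_eq_top.2 hE.dense_domain
  -- Test vectors are taken in dom D^{(δ)}, which P preserves, so that Pw lies in the form domain.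
  refine hdense.eq_of_inner_right ℂ fun w hw => ?_
  have hPw : P w ∈ formDomain m := hFdom _ (hE.proj_mem measurableSet_Ici hw)
  have hγw : frameProj u w ∈ formDomain m := frameProj_mem _ huF w
  have hγχF : frameProj u χ ∈ formDomain m := frameProj_mem _ huF χ
  have hvF : P χ ∈ formDomain m := hFdom _ (hdom ▸ hv)
  rw [← hPinner, inner_diracFock α Z hm hγ hPw, ← frameProj_inner_left, ← hPinner, hPγ w,
    inner_diracFock α Z hm hγ hγw]
  change fockSesq m α Z (frameProj u) (P w) (P (frameProj u χ)) =
    fockSesq m α Z (frameProj u) (frameProj u w) (P χ)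
  have h1 := hzero (P w) hPw (hPP w) χ
  have h2 := hzero (P χ) hvF (hPP χ) w
  rw [hγP] at h1 h2
  have h3 := fockSesq_add_left hm α Z hγ hγw (sub_mem hPw hγw) hγχF
  have h4 := fockSesq_add_right α Z hm hγ hγw hγχF (sub_mem hvF hγχF)
  rw [add_sub_cancel, h1, add_zero] at h3
  rw [add_sub_cancel, ← fockSesq_conj_symm α Z _ (P (χ : Hil) - _), h2, map_zero, add_zero] at h4
  rw [hPγ, h3, h4]

end EulerLagrange

/-- For a projection γ ≤ Λ₊ the lower bound follows from -Λ₋ ≤ 0 ≤ γ, and Λ₋γ = 0 makes the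
off-diagonal condition automatic. -/
theorem frameProj_mem_densityMatricesOfCharge {m : ℝ} (α Z : ℝ) {r : ℕ} {u : Fin r → Hil}
    (hu : Orthonormal ℂ u) (huF : ∀ i, u i ∈ formDomain m) {δ : Hil →L[ℂ] Hil}
    (hP : IsStarProjection (projPlus m α Z δ)) (hPu : ∀ i, projPlus m α Z δ (u i) = u i) :
    frameProj u ∈ densityMatricesOfCharge m α Z δ r := by
  have hp := isStarProjection_frameProj hu
  have hle := frameProj_le hP hu hPu
  refine ⟨⟨memF_frameProj hu huF, ?_, hle, ?_⟩, opTrace_frameProj hu⟩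
  · exact (neg_nonpos.2 hP.one_sub.nonneg).trans hp.nonneg
  · rw [projMinus, sub_mul, one_mul, (hp.le_iff_mul_eq_right hP).1 hle, sub_self, zero_mul]

end DiracFock

end

theorem mainTheorem3 (m α Z : ℝ) (hm : 0 < m) (hα : 0 ≤ α) (hαZ : 0 ≤ α * Z)
    (hαZ' : α * Z < Real.sqrt 3 / 2)
    (δ : DiracFock.Hil →L[ℂ] DiracFock.Hil) (hδ : DiracFock.MemF m δ) (q : ℕ)
    (γ : DiracFock.Hil →L[ℂ] DiracFock.Hil) (hproj : IsStarProjection γ)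
    (hγ : γ ∈ DiracFock.densityMatricesOfCharge m α Z δ q)
    (hmin : IsMinOn (DiracFock.energy m α Z) (DiracFock.densityMatricesOfCharge m α Z δ q) γ) :
    DiracFock.CommutesWith γ
      (DiracFock.compress (DiracFock.projPlus m α Z δ) (DiracFock.diracFock m α Z γ)) := by
  -- Without a spectral resolution, `projPlus` is 0 by default, the compressed operator is zero on
  -- all of L², and commutation is trivial.
  by_cases hres : ∃ E : DiracFock.ProjValuedMeasure DiracFock.Hil,
      E.Resolves (DiracFock.diracFock m α Z δ)
  · have hP : DiracFock.projPlus m α Z δ = hres.choose.proj (Set.Ici 0) := by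
      rw [DiracFock.projPlus, DiracFock.spectralProjection, dif_pos hres]
    have hPs : IsStarProjection (DiracFock.projPlus m α Z δ) := by
      rw [hP]
      exact hres.choose.isStarProjection _ measurableSet_Ici
    obtain ⟨r, u, hu, huF, rfl⟩ := DiracFock.exists_eq_frameProj hm hproj hγ.1.1
    have hr : (r : ℝ) = q := (DiracFock.opTrace_frameProj hu).symm.trans hγ.2
    have hPu : ∀ i, DiracFock.projPlus m α Z δ (u i) = u i := fun i => by
      have h := congrArg (fun T : DiracFock.Hil →L[ℂ] DiracFock.Hil => T (u i))
        ((hproj.le_iff_mul_eq_right hPs).1 hγ.1.2.2.1)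
      change DiracFock.projPlus m α Z δ (DiracFock.frameProj u (u i)) =
        DiracFock.frameProj u (u i) at h
      rwa [DiracFock.frameProj_self hu] at h
    have hEL : ∀ φ ∈ DiracFock.formDomain m, (∀ i, inner ℂ (u i) φ = 0) →
        DiracFock.projPlus m α Z δ φ = φ →
        ∀ k, DiracFock.fockSesq m α Z (DiracFock.frameProj u) φ (u k) = 0 := by
      intro φ hφF hφu hφP k
      refine DiracFock.fockSesq_eq_zero hm α Z hu huF k (P := DiracFock.projPlus m α Z δ)
        (fun φ hφF hφ hφu hφP θ => hmin ?_) hφF hφu hφP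
      rw [← hr]
      refine DiracFock.frameProj_mem_densityMatricesOfCharge α Z
        (DiracFock.orthonormal_rotate hu k hφ hφu θ)
        (DiracFock.rotate_mem (DiracFock.formDomain m) huF hφF θ) hPs fun i => ?_
      -- The vectors fixed by the electron projection form a subspace, so rotation towards φ stays
      -- inside it.
      exact DiracFock.rotate_mem (LinearMap.eqLocus
        (DiracFock.projPlus m α Z δ : DiracFock.Hil →ₗ[ℂ] DiracFock.Hil) LinearMap.id)
        hPu hφP θ i
    rw [hP] at hPu hEL ⊢
    exact DiracFock.commutesWith_compress hm α Z hu huF hδ hres.choose_spec hPu hEL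
  · have hP : DiracFock.projPlus m α Z δ = 0 := by
      rw [DiracFock.projPlus, DiracFock.spectralProjection, dif_neg hres]
    rw [hP]
    intro ψ
    refine ⟨Submodule.zero_mem (DiracFock.diracFock m α Z γ).domain, ?_⟩
    change (0 : DiracFock.Hil) = γ 0
    rw [map_zero]
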